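/- **Conventions.** Fix $p\in[1,\infty)$. An $SQ_p$ space is a Banach space isometric to a subspace of a quotient of an $L_p$ space. A *filtered $SQ_p$ algebra* is a norm-closed subalgebra $A\subseteq B(E)$, $E$ an $SQ_p$ space, with closed linear subspaces $(A_r)_{r>0}$ such that $A_r\subseteq A_{r'}$ for $r\le r'$, $A_rA_{r'}\subseteq A_{r+r'}$, and $\bigcup_r A_r$ is dense in $A$; if $A$ is unital, then $1_A\in A_r$ for all $r$ and $\|1_A\|=1$ (unless $A=0$). $M_n(A)\subseteq M_n(B(E))=B(\ell_p^n(E))$ carries the operator norm. The unitization $A^+$ is $A+\mathbb C\,1\subseteq B(E)$ if $A$ is non-unital; if $A$ is unital, $A^+\cong A\oplus\mathbb C$ via $(a,z)\mapsto(a+z1_A,z)$ and $M_n(A^+)=M_n(A)\oplus M_n(\mathbb C)$ has the maximum norm, where $M_n(\mathbb C)=B(\ell_p^n)$. Put $(A^+)_r=A_r+\mathbb C$. Put $\tilde A=A$ if $A$ is unital and $\tilde A=A^+$ otherwise. For a closed two-sided ideal $J$, $A/J$ has the filtration $((A_r+J)/J)_r$, and $M_n((A/J)^+)$ is identified with $M_n(A^+)/M_n(J)$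 with the quotient norm, where $(A/J)^+$ is the algebra obtained by adjoining a unit to $A/J$. A *filtered homomorphism* $\phi:A\to B$ is an algebra homomorphism with $\|\phi\|_{pcb}=\sup_n\|\phi_n:M_n(A)\to M_n(B)\|<\infty$ and $\phi(A_r)\subseteq B_r$ for all $r>0$; $\phi^+(a,z)=(\phi(a),z)$. **Quantitative $K$-theory.** Let $0<\varepsilon<\frac1{20}$, $r>0$, $N\ge1$ and let $U$ be one of the unital algebras $A^+$ above (or $\mathbb C$). An $(\varepsilon,r,N)$-idempotent is $e\in M_n(U_r)$ with $\|e^2-e\|<\varepsilon$ and $\max(\|e\|,\|1-e\|)\le N$; an $(\varepsilon,r,N)$-invertible is $u\in M_n(U_r)$ such that there is $v\in M_n(U_r)$ with $\max(\|uv-1\|,\|vu-1\|)<\varepsilon$ and $\max(\|u\|,\|v\|)\le N$. Homotopies are norm-continuous paths of such elements (for invertibles, pairs of continuous paths $(u_t,v_t)$ satisfying these conditions). $K_0^{\varepsilon,r,N}(U)$ is the Grothendieck group of the $(\varepsilon,r,N)$-idempotents of all sizes, up to $(4\varepsilon,r,4N)$-homotopy after stabilization $e\mapsto\mathrm{diag}(e,0)$;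 $K_1^{\varepsilon,r,N}(U)$ is the group of the $(\varepsilon,r,N)$-invertibles of all sizes, up to $(4\varepsilon,2r,4N)$-homotopy after stabilization $u\mapsto\mathrm{diag}(u,1)$; in both cases addition is $\mathrm{diag}$. For every $A$ put $K_i^{\varepsilon,r,N}(A)=\ker\big(K_i^{\varepsilon,r,N}(A^+)\to K_i^{\varepsilon,r,N}(\mathbb C)\big)$, with the obvious relaxation maps $\iota$ for increasing parameters, and $\mathcal K_i(A)=(K_i^{\varepsilon,r,N}(A))_{\varepsilon,r,N}$. **Control.** A *control pair* $(\lambda,h)$ consists of a non-decreasing $\lambda:[1,\infty)\to[1,\infty)$ and $h:(0,\frac1{20})\times[1,\infty)\to[1,\infty)$ with $h(\cdot,N)$ non-increasing; $(\lambda,h)\le(\lambda',h')$ means pointwise inequality, and $(\lambda'\cdot\lambda)_N=\lambda'_{\lambda_N}\lambda_N$, $(h'\cdot h)_{\varepsilon,N}=h'_{\lambda_N\varepsilon,\lambda_N}h_{\varepsilon,N}$. A $(\lambda,h)$-controlled morphism $\mathcal F$ is a family of homomorphisms $F^{\varepsilon,r,N}$ from the $(\varepsilon,r,N)$-group to the $(\lambda_N\varepsilon,h_{\varepsilon,N}r,\lambda_N)$-group,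 for $0<\varepsilon<\frac1{20\lambda_N}$, compatible with relaxation. A filtered homomorphism $\phi$ induces $\phi_*$ through $\phi^+$, with control pair $(\|\phi^+\|_{pcb}N,1)$. The identity is used with control pair $(N,1)$, and zero morphisms with control pair $(1,1)$. For morphisms with pairs $(\lambda^{\mathcal F},h^{\mathcal F}),(\lambda^{\mathcal G},h^{\mathcal G})$ one writes $\mathcal F\stackrel{(\lambda,h)}\sim\mathcal G$ if both pairs are $\le(\lambda,h)$ and $\iota F^{\varepsilon,r,N}=\iota G^{\varepsilon,r,N}$ in the $(\lambda_N\varepsilon,h_{\varepsilon,N}r,\lambda_N)$-group for $0<\varepsilon<\frac1{20\lambda_N}$; a composite $\mathcal G\circ\mathcal F$ has the pair $(\lambda^{\mathcal G}\cdot\lambda^{\mathcal F},h^{\mathcal G}\cdot h^{\mathcal F})$. $\mathcal F$ is a $(\lambda,h)$-*isomorphism* if its pair is $\le(\lambda,h)$ and there is a controlled morphism $\mathcal G$ with $\mathcal G\circ\mathcal F\stackrel{(\lambda,h)}\sim\mathrm{Id}$ and $\mathcal F\circ\mathcal G\stackrel{(\lambda,h)}\sim\mathrm{Id}$. A composition $\cdot\stackrel{\mathcal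 F}\to\cdot\stackrel{\mathcal G}\to\cdot$ is $(\lambda,h)$-*exact* if $\mathcal G\circ\mathcal F=0$ and, whenever $0<\varepsilon<\frac1{20\max((\lambda^{\mathcal F}\cdot\lambda)_N,\lambda^{\mathcal G}_N)}$ and $G^{\varepsilon,r,N}(y)=0$, there is $x$ in degree $(\lambda_N\varepsilon,h_{\varepsilon,N}r,\lambda_N)$ with $F^{\lambda_N\varepsilon,h_{\varepsilon,N}r,\lambda_N}(x)=\iota(y)$ in degree $((\lambda^{\mathcal F}\cdot\lambda)_N\varepsilon,(h^{\mathcal F}\cdot h)_{\varepsilon,N}r,(\lambda^{\mathcal F}\cdot\lambda)_N)$. **Statement.** There is a control pair $(\lambda,h)$ (independent of $p$ and of the algebras) such that the following holds. Let $A$ be a filtered $SQ_p$ algebra and $J\subseteq A$ a closed two-sided ideal which is a filtered $SQ_p$ algebra with $J_r=J\cap A_r$; let $j:J\to A$ be the inclusion and $q:A\to A/J$ the quotient map. Suppose that there is a filtered homomorphism $s:A/J\to A$ with $q\circ s=\mathrm{id}$ such that the induced homomorphism $\tilde A/J\to\tilde A$ (that is, $s$ if $A$ is unital, and $s^+:A^+/J\to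 A^+$ otherwise) is $p$-completely contractive. (Then the extension is automatically completely filtered.) Then for $i\in\{0,1\}$ the sequence $$0\to\mathcal K_i(J)\xrightarrow{j_*}\mathcal K_i(A)\xrightarrow{q_*}\mathcal K_i(A/J)\to0$$ is $(\lambda,h)$-exact at $\mathcal K_i(J)$, $\mathcal K_i(A)$ and $\mathcal K_i(A/J)$, and $$\mathcal K_i(J)\oplus\mathcal K_i(A/J)\to\mathcal K_i(A),\qquad(x,y)\mapsto j_*(x)+s_*(y),$$ is a $(\lambda,h)$-isomorphism (here $j_*$ and $s_*$ are both taken with the control pair $(CN,1)$, $C=\max(\|j^+\|_{pcb},\|s^+\|_{pcb})$). -/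

import Mathlib

namespace QK

section Stable

/-- Extend an `n × n` matrix to a `K × K` matrix by putting `d` on the remaining diagonal
(used for `n ≤ K`, with `d = 0` for idempotents and `d = 1` for invertibles). -/
def pad {U : Type*} [Zero U] (d : U) {n : ℕ} (K : ℕ) (x : Matrix (Fin n) (Fin n) U) :
    Matrix (Fin K) (Fin K) U :=
  fun i j => if h : i.1 < n ∧ j.1 < n then x ⟨i.1, h.1⟩ ⟨j.1, h.2⟩ else if i = j then d else 0

/-- The block diagonal matrix `diag(x, y)`. -/
def bdiag {U : Type*} [Zero U] {n m : ℕ} (x : Matrix (Fin n) (Fin n) U)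
    (y : Matrix (Fin m) (Fin m) U) : Matrix (Fin (n + m)) (Fin (n + m)) U :=
  (Matrix.fromBlocks x 0 0 y).submatrix finSumFinEquiv.symm finSumFinEquiv.symm

section lemmas
variable {U : Type*} [Zero U] {n m : ℕ} (x : Matrix (Fin n) (Fin n) U)
    (y : Matrix (Fin m) (Fin m) U)

@[simp] theorem bdiag_ll (i j : Fin n) : bdiag x y (Fin.castAdd m i) (Fin.castAdd m j) = x i j := by
  simp [bdiag]
@[simp] theorem bdiag_lr (i : Fin n) (j : Fin m) :
    bdiag x y (Fin.castAdd m i) (Fin.natAdd n j) = 0 := by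
  simp [bdiag]
@[simp] theorem bdiag_rl (i : Fin m) (j : Fin n) :
    bdiag x y (Fin.natAdd n i) (Fin.castAdd m j) = 0 := by
  simp [bdiag]
@[simp] theorem bdiag_rr (i j : Fin m) : bdiag x y (Fin.natAdd n i) (Fin.natAdd n j) = y i j := by
  simp [bdiag]

theorem pad_eq_bdiag (d : U) (k : ℕ) :
    pad d (n + k) x = bdiag x (Matrix.diagonal fun _ : Fin k => d) := by
  ext i j
  refine Fin.addCases (fun i => ?_) (fun i => ?_) i <;>
    refine Fin.addCases (fun j => ?_) (fun j => ?_) j <;>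
    simp [pad, Matrix.diagonal_apply, Fin.ext_iff] <;> omega

theorem pad_self (d : U) : pad d n x = x := by
  ext i j
  simp [pad]

theorem pad_pad (d : U) {K L : ℕ} (h : n ≤ K) (_ : K ≤ L) : pad d L (pad d K x) = pad d L x := by
  ext i j
  simp only [pad, Fin.ext_iff]
  split_ifs <;> first | rfl | omega

end lemmas

/-- The data needed to form a commutative monoid of stable homotopy classes of matrices:
sets `S n` of `n × n` matrices, a homotopy relation `H n`, and the element `d` used for
the inclusions `S n → S (n + 1)`, `x ↦ diag(x, d)`. -/
structure StableSystem (U : Type*) [Ring U] where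
  d : U
  S : ∀ n, Set (Matrix (Fin n) (Fin n) U)
  H : ∀ n, Matrix (Fin n) (Fin n) U → Matrix (Fin n) (Fin n) U → Prop
  refl : ∀ {n x}, x ∈ S n → H n x x
  symm : ∀ {n x y}, H n x y → H n y x
  trans : ∀ {n x y z}, H n x y → H n y z → H n x z
  S_diag : ∀ n, Matrix.diagonal (fun _ => d) ∈ S n
  S_bdiag : ∀ {n m x y}, x ∈ S n → y ∈ S m → bdiag x y ∈ S (n + m)
  H_diag : ∀ n, H n (Matrix.diagonal fun _ => d) (Matrix.diagonal fun _ => d)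
  H_bdiag : ∀ {n m x x' y y'}, H n x x' → H m y y' → H (n + m) (bdiag x y) (bdiag x' y')
  S_perm : ∀ {n x} (σ : Equiv.Perm (Fin n)), x ∈ S n → x.submatrix σ σ ∈ S n
  H_perm : ∀ {n x} (σ : Equiv.Perm (Fin n)), x ∈ S n → H n x (x.submatrix σ σ)

namespace StableSystem

variable {U : Type*} [Ring U] (T : StableSystem U)

/-- The disjoint union of the sets `S n`; matrices of different sizes are identified by `rel`. -/
abbrev Elt : Type _ := Σ n : ℕ, T.S n

/-- Homotopy in `M_∞`: after enlarging both matrices to a common size, they are homotopic. -/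
def rel (x y : T.Elt) : Prop :=
  ∃ K : ℕ, x.1 ≤ K ∧ y.1 ≤ K ∧ T.H K (pad T.d K x.2.1) (pad T.d K y.2.1)

theorem S_pad {n K : ℕ} {x : Matrix (Fin n) (Fin n) U} (h : n ≤ K) (hx : x ∈ T.S n) :
    pad T.d K x ∈ T.S K := by
  obtain ⟨k, rfl⟩ := Nat.exists_eq_add_of_le h
  rw [pad_eq_bdiag]
  exact T.S_bdiag hx (T.S_diag k)

theorem H_pad {n K : ℕ} {x y : Matrix (Fin n) (Fin n) U} (h : n ≤ K) (hx : T.H n x y) :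
    T.H K (pad T.d K x) (pad T.d K y) := by
  obtain ⟨k, rfl⟩ := Nat.exists_eq_add_of_le h
  rw [pad_eq_bdiag, pad_eq_bdiag]
  exact T.H_bdiag hx (T.H_diag k)

theorem rel_refl (x : T.Elt) : T.rel x x :=
  ⟨x.1, le_rfl, le_rfl, by simpa [pad_self] using T.refl x.2.2⟩

theorem rel_symm {x y : T.Elt} (h : T.rel x y) : T.rel y x := by
  obtain ⟨K, h1, h2, h3⟩ := h
  exact ⟨K, h2, h1, T.symm h3⟩

theorem rel_trans {x y z : T.Elt} (h : T.rel x y) (h' : T.rel y z) : T.rel x z := by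
  obtain ⟨K, h1, h2, h3⟩ := h
  obtain ⟨L, h1', h2', h3'⟩ := h'
  refine ⟨max K L, h1.trans (le_max_left _ _), h2'.trans (le_max_right _ _), ?_⟩
  have a := T.H_pad (le_max_left K L) h3
  have b := T.H_pad (le_max_right K L) h3'
  rw [pad_pad _ _ h1 (le_max_left _ _), pad_pad _ _ h2 (le_max_left _ _)] at a
  rw [pad_pad _ _ h1' (le_max_right _ _), pad_pad _ _ h2' (le_max_right _ _)] at b
  exact T.trans a b

instance setoid : Setoid T.Elt := ⟨T.rel, T.rel_refl, T.rel_symm, T.rel_trans⟩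

theorem rel_of_embed {n K : ℕ} {x : Matrix (Fin n) (Fin n) U} (hx : x ∈ T.S n)
    {X : Matrix (Fin K) (Fin K) U} (hX : X ∈ T.S K)
    (g : Fin n → Fin K) (hg : Function.Injective g) (h1 : ∀ i j, X (g i) (g j) = x i j)
    (h2 : ∀ a b, (a ∉ Set.range g ∨ b ∉ Set.range g) → X a b = if a = b then T.d else 0) :
    T.rel ⟨n, x, hx⟩ ⟨K, X, hX⟩ := by
  have hnK : n ≤ K := by simpa using Fintype.card_le_of_injective g hg
  let e : {a // a ∈ Set.range (Fin.castLE hnK)} ≃ {a // a ∈ Set.range g} :=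
    (Equiv.ofInjective _ (Fin.castLE_injective hnK)).symm.trans (Equiv.ofInjective g hg)
  let σ : Equiv.Perm (Fin K) := e.extendSubtype
  have hσ : ∀ i, σ (Fin.castLE hnK i) = g i := by
    intro i
    have := e.extendSubtype_apply_of_mem (Fin.castLE hnK i) ⟨i, rfl⟩
    rw [show σ (Fin.castLE hnK i) = _ from this]
    simp only [e, Equiv.trans_apply]
    rw [Equiv.ofInjective_symm_apply]
    simp
  have hσ' : ∀ a : Fin K, ¬ a.1 < n → σ a ∉ Set.range g := by
    rintro a ha ⟨i, hi⟩
    rw [← hσ i] at hi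
    have := σ.injective hi
    apply ha
    rw [← this]
    exact i.2
  have hp : X.submatrix σ σ = pad T.d K x := by
    ext a b
    simp only [Matrix.submatrix_apply, pad]
    split_ifs with h hab
    · rw [← h1, ← hσ, ← hσ]
      rfl
    · rw [h2, if_pos (by rw [hab])]
      by_cases ha : a.1 < n
      · right; exact hσ' b fun hb => h ⟨ha, hb⟩
      · left; exact hσ' a ha
    · rw [h2, if_neg (fun hh => hab (σ.injective hh))]
      by_cases ha : a.1 < n
      · right; exact hσ' b fun hb => h ⟨ha, hb⟩
      · left; exact hσ' a ha
  refine ⟨K, hnK, le_rfl, ?_⟩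
  simp only [pad_self]
  rw [← hp]
  exact T.symm (T.H_perm σ hX)

/-- Addition on representatives: `diag(x, y)`. -/
def addElt (x y : T.Elt) : T.Elt := ⟨x.1 + y.1, bdiag x.2.1 y.2.1, T.S_bdiag x.2.2 y.2.2⟩

theorem rel_add_left {x x' : T.Elt} (y : T.Elt) (h : T.rel x x') :
    T.rel (T.addElt x y) (T.addElt x' y) := by
  obtain ⟨K, h1, h2, h3⟩ := h
  have key : ∀ (z : T.Elt) (hz : z.1 ≤ K), T.rel (T.addElt z y)
      (T.addElt ⟨K, pad T.d K z.2.1, T.S_pad hz z.2.2⟩ y) := by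
    rintro ⟨n, z, hz⟩ hnK
    obtain ⟨m, y, hy⟩ := y
    obtain ⟨k, rfl⟩ := Nat.exists_eq_add_of_le hnK
    refine T.rel_of_embed (T.S_bdiag hz hy) _
      (Fin.addCases (fun i => Fin.castAdd m (Fin.castAdd k i)) (fun j => Fin.natAdd (n + k) j))
      ?_ ?_ ?_
    · intro i j
      refine Fin.addCases (fun i => ?_) (fun i => ?_) i <;>
        refine Fin.addCases (fun j => ?_) (fun j => ?_) j <;>
        simp [Fin.ext_iff] <;> omega
    · intro i j
      refine Fin.addCases (fun i => ?_) (fun i => ?_) i <;>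
        refine Fin.addCases (fun j => ?_) (fun j => ?_) j <;>
        simp [pad_eq_bdiag]
    · intro a b
      simp only [Set.mem_range, not_exists]
      refine Fin.addCases (fun a => ?_) (fun a => ?_) a
      · refine Fin.addCases (fun a => ?_) (fun a => ?_) a
        · refine Fin.addCases (fun b => ?_) (fun b => ?_) b
          · refine Fin.addCases (fun b => ?_) (fun b => ?_) b
            · rintro (h | h)
              · exact absurd (by simp) (h (Fin.castAdd m a))
              · exact absurd (by simp) (h (Fin.castAdd m b))
            · simp [pad_eq_bdiag, Fin.ext_iff]
              omega
          · rintro (h | h)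
            · exact absurd (by simp) (h (Fin.castAdd m a))
            · exact absurd (by simp) (h (Fin.natAdd n b))
        · intro _
          refine Fin.addCases (fun b => ?_) (fun b => ?_) b
          · refine Fin.addCases (fun b => ?_) (fun b => ?_) b
            · simp [pad_eq_bdiag, Fin.ext_iff]
              omega
            · simp [pad_eq_bdiag, Matrix.diagonal_apply, Fin.ext_iff]
          · simp [Fin.ext_iff]
            omega
      · refine Fin.addCases (fun b => ?_) (fun b => ?_) b
        · intro _
          simp [Fin.ext_iff]
          omega
        · rintro (h | h)
          · exact absurd (by simp) (h (Fin.natAdd n a))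
          · exact absurd (by simp) (h (Fin.natAdd n b))
  refine T.rel_trans (key x h1) (T.rel_trans ?_ (T.rel_symm (key x' h2)))
  refine ⟨K + y.1, le_rfl, le_rfl, ?_⟩
  simp only [addElt, pad_self]
  exact T.H_bdiag h3 (T.refl y.2.2)

theorem rel_add_comm (x y : T.Elt) : T.rel (T.addElt x y) (T.addElt y x) := by
  obtain ⟨n, x, hx⟩ := x
  obtain ⟨m, y, hy⟩ := y
  refine T.rel_of_embed (T.S_bdiag hx hy) _
    (Fin.addCases (fun i => Fin.natAdd m i) (fun j => Fin.castAdd n j)) ?_ ?_ ?_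
  · intro i j
    refine Fin.addCases (fun i => ?_) (fun i => ?_) i <;>
      refine Fin.addCases (fun j => ?_) (fun j => ?_) j <;>
      simp [Fin.ext_iff] <;> omega
  · intro i j
    refine Fin.addCases (fun i => ?_) (fun i => ?_) i <;>
      refine Fin.addCases (fun j => ?_) (fun j => ?_) j <;> simp
  · have : ∀ a, a ∈ Set.range (Fin.addCases (fun i => Fin.natAdd m i) (fun j => Fin.castAdd n j) :
        Fin (n + m) → Fin (m + n)) := by
      intro a
      refine Fin.addCases (fun a => ⟨Fin.natAdd n a, by simp⟩)
        (fun a => ⟨Fin.castAdd m a, by simp⟩) a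
    rintro a b (h | h) <;> exact absurd (this _) h

theorem rel_add_right {x x' : T.Elt} (y : T.Elt) (h : T.rel x x') :
    T.rel (T.addElt y x) (T.addElt y x') :=
  T.rel_trans (T.rel_add_comm _ _) (T.rel_trans (T.rel_add_left y h) (T.rel_add_comm _ _))

theorem rel_add_assoc (x y z : T.Elt) :
    T.rel (T.addElt (T.addElt x y) z) (T.addElt x (T.addElt y z)) := by
  obtain ⟨n, x, hx⟩ := x
  obtain ⟨m, y, hy⟩ := y
  obtain ⟨k, z, hz⟩ := z
  refine T.rel_of_embed (T.S_bdiag (T.S_bdiag hx hy) hz) _ (Fin.cast (Nat.add_assoc n m k))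
    (Fin.cast_injective _) ?_ ?_
  · have c1 : ∀ i : Fin n, Fin.cast (Nat.add_assoc n m k) (Fin.castAdd k (Fin.castAdd m i)) =
      Fin.castAdd (m + k) i := fun i => rfl
    have c2 : ∀ i : Fin m, Fin.cast (Nat.add_assoc n m k) (Fin.castAdd k (Fin.natAdd n i)) =
      Fin.natAdd n (Fin.castAdd k i) := fun i => rfl
    have c3 : ∀ i : Fin k, Fin.cast (Nat.add_assoc n m k) (Fin.natAdd (n + m) i) =
      Fin.natAdd n (Fin.natAdd m i) := fun i => by simp [Fin.ext_iff, Nat.add_assoc]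
    have key : ∀ i j, bdiag x (bdiag y z) (Fin.cast (Nat.add_assoc n m k) i)
        (Fin.cast (Nat.add_assoc n m k) j) = bdiag (bdiag x y) z i j := by
      intro i j
      refine Fin.addCases (fun i => Fin.addCases (fun i => ?_) (fun i => ?_) i) (fun i => ?_) i <;>
      refine Fin.addCases (fun j => Fin.addCases (fun j => ?_) (fun j => ?_) j) (fun j => ?_) j <;>
      simp only [c1, c2, c3, bdiag_ll, bdiag_lr, bdiag_rl, bdiag_rr]
    exact key
  · have : ∀ a, a ∈ Set.range (Fin.cast (Nat.add_assoc n m k)) :=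
      fun a => ⟨Fin.cast (Nat.add_assoc n m k).symm a, by simp⟩
    rintro a b (h | h) <;> exact absurd (this _) h

/-- The neutral element: the empty matrix. -/
def zeroElt : T.Elt := ⟨0, Matrix.diagonal fun _ => T.d, T.S_diag 0⟩

theorem rel_zero_add (x : T.Elt) : T.rel (T.addElt T.zeroElt x) x := by
  obtain ⟨n, x, hx⟩ := x
  refine T.rel_of_embed _ hx (Fin.cast (Nat.zero_add n)) (Fin.cast_injective _) ?_ ?_
  · intro i j
    refine Fin.addCases (fun i => i.elim0) (fun i => ?_) i
    refine Fin.addCases (fun j => j.elim0) (fun j => ?_) j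
    simp only [bdiag_rr]
    congr 1 <;> exact Fin.ext (Nat.zero_add _)
  · have : ∀ a, a ∈ Set.range (Fin.cast (Nat.zero_add n)) :=
      fun a => ⟨Fin.cast (Nat.zero_add n).symm a, by simp⟩
    rintro a b (h | h) <;> exact absurd (this _) h

/-- Stable homotopy classes. -/
def Cls : Type _ := Quotient T.setoid

/-- The class of a matrix. -/
def cls {n : ℕ} (x : Matrix (Fin n) (Fin n) U) (hx : x ∈ T.S n) : T.Cls :=
  Quotient.mk T.setoid ⟨n, x, hx⟩

instance : Add T.Cls := ⟨Quotient.map₂ T.addElt fun _ x' h _ _ h' =>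
    T.rel_trans (T.rel_add_left _ h) (T.rel_add_right x' h')⟩

instance : Zero T.Cls := ⟨Quotient.mk _ T.zeroElt⟩

instance : AddCommMonoid T.Cls where
  add_assoc := by
    rintro ⟨a⟩ ⟨b⟩ ⟨c⟩
    exact Quotient.sound (T.rel_add_assoc a b c)
  add_comm := by
    rintro ⟨a⟩ ⟨b⟩
    exact Quotient.sound (T.rel_add_comm a b)
  zero_add := by
    rintro ⟨a⟩
    exact Quotient.sound (T.rel_zero_add a)
  add_zero := by
    rintro ⟨a⟩
    exact Quotient.sound (T.rel_trans (T.rel_add_comm _ _) (T.rel_zero_add a))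
  nsmul := nsmulRec

variable {T}

/-- The map on classes induced by applying a ring homomorphism to the entries. -/
def mapCls {V : Type*} [Ring V] {T' : StableSystem V} (φ : U →+* V) (hd : φ T.d = T'.d)
    (hS : ∀ {n x}, x ∈ T.S n → x.map φ ∈ T'.S n)
    (hH : ∀ {n x y}, T.H n x y → T'.H n (x.map φ) (y.map φ)) : T.Cls →+ T'.Cls where
  toFun := Quotient.map (fun x => ⟨x.1, x.2.1.map φ, hS x.2.2⟩) (by
    rintro ⟨n, x, hx⟩ ⟨m, y, hy⟩ ⟨K, h1, h2, h3⟩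
    refine ⟨K, h1, h2, ?_⟩
    have key : ∀ {l : ℕ} (z : Matrix (Fin l) (Fin l) U),
        pad T'.d K (z.map φ) = (pad T.d K z).map φ := by
      intro l z
      ext i j
      simp only [pad, Matrix.map_apply]
      split_ifs <;> simp [hd]
    rw [key, key]
    exact hH h3)
  map_zero' := by
    refine Quotient.sound ⟨0, le_rfl, le_rfl, ?_⟩
    have : ∀ x y : Matrix (Fin 0) (Fin 0) V, x = y := fun x y => by ext i; exact i.elim0
    rw [this (pad _ _ _) (Matrix.diagonal fun _ => T'.d),
      this (pad _ _ T'.zeroElt.2.1) (Matrix.diagonal fun _ => T'.d)]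
    exact T'.H_diag 0
  map_add' := by
    rintro ⟨n, x, hx⟩ ⟨m, y, hy⟩
    refine congrArg (Quotient.mk _) ?_
    refine Sigma.ext rfl (heq_of_eq (Subtype.ext ?_))
    ext i j
    refine Fin.addCases (fun i => ?_) (fun i => ?_) i <;>
      refine Fin.addCases (fun j => ?_) (fun j => ?_) j <;> simp [addElt]

end StableSystem
end Stable
end QK


namespace QK

open scoped ENNReal

section MatrixNorm

/-- A matrix of bounded operators on `E`, acting on the `ℓ_p`-direct sum `ℓ_p^n(E)`. -/
noncomputable def matCLM (p : ℝ≥0∞) [Fact (1 ≤ p)] {E : Type*} [NormedAddCommGroup E]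
    [NormedSpace ℂ E] {n : ℕ} (T : Matrix (Fin n) (Fin n) (E →L[ℂ] E)) :
    PiLp p (fun _ : Fin n => E) →L[ℂ] PiLp p (fun _ : Fin n => E) :=
  ((PiLp.continuousLinearEquiv p ℂ (fun _ : Fin n => E)).symm :
      (∀ _ : Fin n, E) →L[ℂ] PiLp p (fun _ : Fin n => E)) ∘L
    (ContinuousLinearMap.pi fun i => ∑ j, (T i j) ∘L PiLp.proj p (fun _ : Fin n => E) j)

/-- The norm of a matrix of operators, under `M_n(B(E)) = B(ℓ_p^n(E))`. -/
noncomputable def opNorm (p : ℝ≥0∞) [Fact (1 ≤ p)] {E : Type*} [NormedAddCommGroup E]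
    [NormedSpace ℂ E] {n : ℕ} (T : Matrix (Fin n) (Fin n) (E →L[ℂ] E)) : ℝ :=
  ‖matCLM p T‖

/-- The norm of a complex matrix, under `M_n(ℂ) = B(ℓ_p^n)`. -/
noncomputable def cNorm (p : ℝ≥0∞) [Fact (1 ≤ p)] {n : ℕ} (z : Matrix (Fin n) (Fin n) ℂ) : ℝ :=
  opNorm p (z.map fun c => c • ContinuousLinearMap.id ℂ ℂ)

section
variable (p : ℝ≥0∞) [Fact (1 ≤ p)] {E : Type*} [NormedAddCommGroup E] [NormedSpace ℂ E] {n m : ℕ}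

@[simp] theorem matCLM_apply (T : Matrix (Fin n) (Fin n) (E →L[ℂ] E))
    (v : PiLp p (fun _ : Fin n => E)) (i : Fin n) : matCLM p T v i = ∑ j, T i j (v j) := by
  simp [matCLM]

theorem matCLM_mul (S T : Matrix (Fin n) (Fin n) (E →L[ℂ] E)) :
    matCLM p (S * T) = matCLM p S ∘L matCLM p T := by
  ext v i
  simp only [matCLM_apply, Matrix.mul_apply, ContinuousLinearMap.comp_apply,
    sum_apply, map_sum]
  rw [Finset.sum_comm]
  rfl

/-- `matCLM` as a linear map. -/
noncomputable def matCLMₗ : Matrix (Fin n) (Fin n) (E →L[ℂ] E) →ₗ[ℂ]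
    (PiLp p (fun _ : Fin n => E) →L[ℂ] PiLp p (fun _ : Fin n => E)) where
  toFun := matCLM p
  map_add' S T := by
    ext v i
    simp [Finset.sum_add_distrib]
  map_smul' c T := by
    ext v i
    simp [Finset.smul_sum]

theorem opNorm_mul_le (S T : Matrix (Fin n) (Fin n) (E →L[ℂ] E)) :
    opNorm p (S * T) ≤ opNorm p S * opNorm p T := by
  rw [opNorm, matCLM_mul]
  exact ContinuousLinearMap.opNorm_comp_le _ _

theorem opNorm_perm_left (σ : Equiv.Perm (Fin n)) (T : Matrix (Fin n) (Fin n) (E →L[ℂ] E)) :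
    opNorm p (T.submatrix σ id) ≤ opNorm p T := by
  refine ContinuousLinearMap.opNorm_le_bound _ (norm_nonneg _) fun v => ?_
  have : matCLM p (T.submatrix σ id) v =
      LinearIsometryEquiv.piLpCongrLeft p ℂ E σ.symm (matCLM p T v) := by
    ext i
    simp [LinearIsometryEquiv.piLpCongrLeft_apply]
  rw [this, LinearIsometryEquiv.norm_map]
  exact ContinuousLinearMap.le_opNorm _ _

theorem opNorm_perm_right (σ : Equiv.Perm (Fin n)) (T : Matrix (Fin n) (Fin n) (E →L[ℂ] E)) :
    opNorm p (T.submatrix id σ) ≤ opNorm p T := by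
  refine ContinuousLinearMap.opNorm_le_bound _ (norm_nonneg _) fun v => ?_
  have : matCLM p (T.submatrix id σ) v =
      matCLM p T (LinearIsometryEquiv.piLpCongrLeft p ℂ E σ v) := by
    ext i
    simp only [matCLM_apply, Matrix.submatrix_apply, id]
    refine Fintype.sum_equiv σ _ _ fun j => ?_
    simp [LinearIsometryEquiv.piLpCongrLeft_apply]
  rw [this]
  refine (ContinuousLinearMap.le_opNorm _ _).trans ?_
  rw [LinearIsometryEquiv.norm_map]
  rfl

theorem norm_rpow_piLp (hp : p ≠ ⊤) (v : PiLp p (fun _ : Fin n => E)) :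
    ‖v‖ ^ p.toReal = ∑ i, ‖v i‖ ^ p.toReal := by
  have h1 : (0 : ℝ) < p.toReal := ENNReal.toReal_pos
    (zero_lt_one.trans_le (Fact.out : 1 ≤ p)).ne' hp
  rw [PiLp.norm_eq_sum h1, ← Real.rpow_mul (Finset.sum_nonneg fun i _ => by positivity),
    one_div_mul_cancel h1.ne', Real.rpow_one]

theorem opNorm_le_iff (hp : p ≠ ⊤) (T : Matrix (Fin n) (Fin n) (E →L[ℂ] E)) {C : ℝ} (hC : 0 ≤ C) :
    opNorm p T ≤ C ↔ ∀ v : Fin n → E, ∑ i, ‖∑ j, T i j (v j)‖ ^ p.toReal ≤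
      C ^ p.toReal * ∑ i, ‖v i‖ ^ p.toReal := by
  have h1 : (0 : ℝ) < p.toReal := ENNReal.toReal_pos
    (zero_lt_one.trans_le (Fact.out : 1 ≤ p)).ne' hp
  have key : ∀ v : PiLp p (fun _ : Fin n => E), ‖matCLM p T v‖ ≤ C * ‖v‖ ↔
      ∑ i, ‖∑ j, T i j (v j)‖ ^ p.toReal ≤ C ^ p.toReal * ∑ i, ‖v i‖ ^ p.toReal := by
    intro v
    rw [← norm_rpow_piLp p hp v, ← Real.mul_rpow hC (norm_nonneg _),
      ← Real.rpow_le_rpow_iff (norm_nonneg _) (by positivity) h1, norm_rpow_piLp p hp]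
    simp
  rw [opNorm, ContinuousLinearMap.opNorm_le_iff hC]
  constructor
  · intro h v
    exact (key (WithLp.toLp p v)).1 (h _)
  · intro h v
    exact (key v).2 (h _)

theorem opNorm_bdiag_le (hp : p ≠ ⊤) (S : Matrix (Fin n) (Fin n) (E →L[ℂ] E))
    (T : Matrix (Fin m) (Fin m) (E →L[ℂ] E)) :
    opNorm p (bdiag S T) ≤ max (opNorm p S) (opNorm p T) := by
  have hS : 0 ≤ opNorm p S := norm_nonneg _
  have hT : 0 ≤ opNorm p T := norm_nonneg _
  have hM : 0 ≤ max (opNorm p S) (opNorm p T) := hS.trans (le_max_left _ _)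
  rw [opNorm_le_iff p hp _ hM]
  intro v
  rw [Fin.sum_univ_add, Fin.sum_univ_add (f := fun i => ‖v i‖ ^ p.toReal), mul_add]
  refine add_le_add ?_ ?_
  · have := (opNorm_le_iff p hp S hM).1 (le_max_left _ _) fun i => v (Fin.castAdd m i)
    simpa [Fin.sum_univ_add] using this
  · have := (opNorm_le_iff p hp T hM).1 (le_max_right _ _) fun i => v (Fin.natAdd n i)
    simpa [Fin.sum_univ_add] using this

theorem opNorm_diagonal_le (hp : p ≠ ⊤) (a : E →L[ℂ] E) :
    opNorm p (Matrix.diagonal fun _ : Fin n => a) ≤ ‖a‖ := by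
  rw [opNorm_le_iff p hp _ (norm_nonneg a)]
  intro v
  rw [Finset.mul_sum]
  refine Finset.sum_le_sum fun i _ => ?_
  rw [← Real.mul_rpow (norm_nonneg _) (norm_nonneg _)]
  refine Real.rpow_le_rpow (norm_nonneg _) ?_ ENNReal.toReal_nonneg
  have : ∑ j, (Matrix.diagonal (fun _ : Fin n => a) i j) (v j) = a (v i) := by
    rw [Finset.sum_eq_single i]
    · simp
    · intro j _ hj
      simp [Matrix.diagonal_apply, hj.symm]
    · simp
  rw [this]
  exact a.le_opNorm _

theorem cNorm_le_iff (hp : p ≠ ⊤) (z : Matrix (Fin n) (Fin n) ℂ) {C : ℝ} (hC : 0 ≤ C) :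
    cNorm p z ≤ C ↔ ∀ v : Fin n → ℂ, ∑ i, ‖∑ j, z i j * v j‖ ^ p.toReal ≤
      C ^ p.toReal * ∑ i, ‖v i‖ ^ p.toReal := by
  rw [cNorm, opNorm_le_iff p hp _ hC]
  simp

theorem cNorm_one_le (hp : p ≠ ⊤) : cNorm p (1 : Matrix (Fin n) (Fin n) ℂ) ≤ 1 := by
  rw [cNorm_le_iff p hp _ zero_le_one]
  intro v
  simp [Matrix.one_apply]

end

theorem cNorm_zero (p : ℝ≥0∞) [Fact (1 ≤ p)] {n : ℕ} :
    cNorm p (0 : Matrix (Fin n) (Fin n) ℂ) = 0 := by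
  have : (0 : Matrix (Fin n) (Fin n) ℂ).map (fun c => c • ContinuousLinearMap.id ℂ ℂ) = 0 := by
    ext; simp
  rw [cNorm, this]
  show ‖matCLMₗ p (0 : Matrix (Fin n) (Fin n) (ℂ →L[ℂ] ℂ))‖ = 0
  rw [map_zero, norm_zero]

end MatrixNorm
end QK

set_option linter.style.haveILetI false
namespace QK

open scoped ENNReal

theorem cNorm_one_le' (p : ℝ≥0∞) [Fact (1 ≤ p)] {n : ℕ} :
    cNorm p (1 : Matrix (Fin n) (Fin n) ℂ) ≤ 1 := by
  have : matCLM p ((1 : Matrix (Fin n) (Fin n) ℂ).map fun c => c • ContinuousLinearMap.id ℂ ℂ) =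
      ContinuousLinearMap.id ℂ _ := by
    ext v i
    simp only [matCLM_apply, Matrix.map_apply, Matrix.one_apply]
    rw [Finset.sum_eq_single i]
    · simp
    · intro j _ hj
      simp [hj.symm]
    · simp
  rw [cNorm, opNorm, this]
  exact ContinuousLinearMap.norm_id_le

/-- A unital complex algebra `U` with a norm on each `M_n(U)` and a filtration, as far as this is
needed to form the quantitative `K`-groups. -/
structure QAlg (p : ℝ≥0∞) [Fact (1 ≤ p)] (U : Type*) [Ring U] [Algebra ℂ U] where
  nrm : ∀ n, Seminorm ℂ (Matrix (Fin n) (Fin n) U)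
  mul_le : ∀ {n} (x y : Matrix (Fin n) (Fin n) U), nrm n (x * y) ≤ nrm n x * nrm n y
  perm_left : ∀ {n} (σ : Equiv.Perm (Fin n)) (x : Matrix (Fin n) (Fin n) U),
    nrm n (x.submatrix σ id) ≤ nrm n x
  perm_right : ∀ {n} (σ : Equiv.Perm (Fin n)) (x : Matrix (Fin n) (Fin n) U),
    nrm n (x.submatrix id σ) ≤ nrm n x
  bdiag_le : ∀ {n m} (x : Matrix (Fin n) (Fin n) U) (y : Matrix (Fin m) (Fin m) U),
    nrm (n + m) (bdiag x y) ≤ max (nrm n x) (nrm m y)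
  scalar_le : ∀ {n} (z : Matrix (Fin n) (Fin n) ℂ),
    nrm n (z.map (algebraMap ℂ U)) ≤ cNorm p z
  filt : ℝ → Submodule ℂ U
  filt_mono : ∀ {r s}, r ≤ s → filt r ≤ filt s
  filt_mul : ∀ {r s}, 0 < r → 0 < s → ∀ {x y}, x ∈ filt r → y ∈ filt s → x * y ∈ filt (r + s)
  filt_one : ∀ {r}, 0 < r → (1 : U) ∈ filt r

namespace QAlg

variable {p : ℝ≥0∞} [Fact (1 ≤ p)] {U : Type*} [Ring U] [Algebra ℂ U] (X : QAlg p U)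

/-- The normed group structure of `M_n(U)`. -/
abbrev sng (n : ℕ) : SeminormedAddCommGroup (Matrix (Fin n) (Fin n) U) :=
  (X.nrm n).toAddGroupSeminorm.toSeminormedAddCommGroup

/-- The norm topology of `M_n(U)`. -/
abbrev topo (n : ℕ) : TopologicalSpace (Matrix (Fin n) (Fin n) U) :=
  (X.sng n).toPseudoMetricSpace.toUniformSpace.toTopologicalSpace

/-- The normed ring structure of `M_n(U)`. -/
abbrev srng (n : ℕ) : SeminormedRing (Matrix (Fin n) (Fin n) U) :=
  { X.sng n, (inferInstance : Ring (Matrix (Fin n) (Fin n) U)) with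
    norm_mul_le := X.mul_le }

theorem norm_one_le (n : ℕ) : X.nrm n 1 ≤ 1 := by
  refine le_trans ?_ ((X.scalar_le (1 : Matrix (Fin n) (Fin n) ℂ)).trans (cNorm_one_le' p))
  rw [Matrix.map_one _ (map_zero _) (map_one _)]

/-- The matrices with entries in `U_r`. -/
def mfilt (r : ℝ) (n : ℕ) : Set (Matrix (Fin n) (Fin n) U) := {x | ∀ i j, x i j ∈ X.filt r}

/-- The `(ε, r, N)`-idempotents in `M_n(U)`. -/
def Idem (ε r N : ℝ) (n : ℕ) : Set (Matrix (Fin n) (Fin n) U) :=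
  {e | e ∈ X.mfilt r n ∧ X.nrm n (e * e - e) < ε ∧ X.nrm n e ≤ N ∧ X.nrm n (1 - e) ≤ N}

/-- The `(ε, r, N)`-inverse pairs in `M_n(U)`. -/
def InvPair (ε r N : ℝ) (n : ℕ) : Set (Matrix (Fin n) (Fin n) U × Matrix (Fin n) (Fin n) U) :=
  {w | w.1 ∈ X.mfilt r n ∧ w.2 ∈ X.mfilt r n ∧ X.nrm n (w.1 * w.2 - 1) < ε ∧
    X.nrm n (w.2 * w.1 - 1) < ε ∧ X.nrm n w.1 ≤ N ∧ X.nrm n w.2 ≤ N}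

/-- The `(ε, r, N)`-invertibles in `M_n(U)`. -/
def QInv (ε r N : ℝ) (n : ℕ) : Set (Matrix (Fin n) (Fin n) U) := {u | ∃ v, (u, v) ∈ X.InvPair ε r N n}

/-- Homotopy of `(ε, r, N)`-idempotents: a norm continuous path of `(ε, r, N)`-idempotents. -/
def IdemHtpy (ε r N : ℝ) (n : ℕ) (x y : Matrix (Fin n) (Fin n) U) : Prop :=
  @JoinedIn _ (X.topo n) (X.Idem ε r N n) x y

/-- Homotopy of `(ε, r, N)`-invertibles: an `(ε, r, N)`-inverse pair of norm continuous paths. -/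
def GLHtpy (ε r N : ℝ) (n : ℕ) (x y : Matrix (Fin n) (Fin n) U) : Prop :=
  ∃ x' y', @JoinedIn _ (@instTopologicalSpaceProd _ _ (X.topo n) (X.topo n))
    (X.InvPair ε r N n) (x, x') (y, y')

section basic
variable {X}

theorem idem_mono {ε r N ε' r' N' : ℝ} (h1 : ε ≤ ε') (h2 : r ≤ r') (h3 : N ≤ N') (n : ℕ) :
    X.Idem ε r N n ⊆ X.Idem ε' r' N' n := fun _ he =>
  ⟨fun i j => X.filt_mono h2 (he.1 i j), he.2.1.trans_le h1, he.2.2.1.trans h3,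
    he.2.2.2.trans h3⟩

theorem invPair_mono {ε r N ε' r' N' : ℝ} (h1 : ε ≤ ε') (h2 : r ≤ r') (h3 : N ≤ N') (n : ℕ) :
    X.InvPair ε r N n ⊆ X.InvPair ε' r' N' n := fun _ he =>
  ⟨fun i j => X.filt_mono h2 (he.1 i j), fun i j => X.filt_mono h2 (he.2.1 i j),
    he.2.2.1.trans_le h1, he.2.2.2.1.trans_le h1, he.2.2.2.2.1.trans h3, he.2.2.2.2.2.trans h3⟩

theorem one_mem_mfilt {r : ℝ} (hr : 0 < r) (n : ℕ) : (1 : Matrix (Fin n) (Fin n) U) ∈ X.mfilt r n := by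
  intro i j
  rw [Matrix.one_apply]
  split_ifs
  exacts [X.filt_one hr, zero_mem _]

theorem add_mem_mfilt {r : ℝ} {n : ℕ} {x y : Matrix (Fin n) (Fin n) U} (hx : x ∈ X.mfilt r n)
    (hy : y ∈ X.mfilt r n) : x + y ∈ X.mfilt r n := fun i j => add_mem (hx i j) (hy i j)

theorem sub_mem_mfilt {r : ℝ} {n : ℕ} {x y : Matrix (Fin n) (Fin n) U} (hx : x ∈ X.mfilt r n)
    (hy : y ∈ X.mfilt r n) : x - y ∈ X.mfilt r n := fun i j => sub_mem (hx i j) (hy i j)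

theorem smul_mem_mfilt {r : ℝ} {n : ℕ} (c : ℂ) {x : Matrix (Fin n) (Fin n) U}
    (hx : x ∈ X.mfilt r n) : c • x ∈ X.mfilt r n := fun i j =>
  Submodule.smul_mem _ c (hx i j)

theorem mul_mem_mfilt {r s : ℝ} (hr : 0 < r) (hs : 0 < s) {n : ℕ} {x y : Matrix (Fin n) (Fin n) U}
    (hx : x ∈ X.mfilt r n) (hy : y ∈ X.mfilt s n) : x * y ∈ X.mfilt (r + s) n := by
  intro i j
  rw [Matrix.mul_apply]
  exact sum_mem fun k _ => X.filt_mul hr hs (hx i k) (hy k j)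

theorem bdiag_mem_mfilt {r : ℝ} {n m : ℕ} {x : Matrix (Fin n) (Fin n) U}
    {y : Matrix (Fin m) (Fin m) U} (hx : x ∈ X.mfilt r n) (hy : y ∈ X.mfilt r m) :
    bdiag x y ∈ X.mfilt r (n + m) := by
  intro i j
  refine Fin.addCases (fun i => ?_) (fun i => ?_) i <;>
    refine Fin.addCases (fun j => ?_) (fun j => ?_) j
  · simpa using hx i j
  · simp
  · simp
  · simpa using hy i j

end basic

end QAlg

section bdiagAlg
variable {U : Type*} [Ring U] {n m : ℕ} (x x' : Matrix (Fin n) (Fin n) U)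
  (y y' : Matrix (Fin m) (Fin m) U)

theorem bdiag_mul : bdiag x y * bdiag x' y' = bdiag (x * x') (y * y') := by
  simp only [bdiag]
  rw [Matrix.submatrix_mul_equiv, Matrix.fromBlocks_multiply]
  simp

theorem bdiag_sub : bdiag x y - bdiag x' y' = bdiag (x - x') (y - y') := by
  ext i j
  refine Fin.addCases (fun i => ?_) (fun i => ?_) i <;>
    refine Fin.addCases (fun j => ?_) (fun j => ?_) j <;> simp

theorem bdiag_one : bdiag (1 : Matrix (Fin n) (Fin n) U) (1 : Matrix (Fin m) (Fin m) U) = 1 := by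
  simp only [bdiag, Matrix.fromBlocks_one, Matrix.submatrix_one_equiv]

end bdiagAlg

namespace QAlg
variable {p : ℝ≥0∞} [Fact (1 ≤ p)] {U : Type*} [Ring U] [Algebra ℂ U] {X : QAlg p U}

theorem idem_bdiag {ε r N : ℝ} {n m : ℕ} {x : Matrix (Fin n) (Fin n) U}
    {y : Matrix (Fin m) (Fin m) U} (hx : x ∈ X.Idem ε r N n) (hy : y ∈ X.Idem ε r N m) :
    bdiag x y ∈ X.Idem ε r N (n + m) := by
  refine ⟨bdiag_mem_mfilt hx.1 hy.1, ?_, ?_, ?_⟩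
  · rw [bdiag_mul, bdiag_sub]
    exact (X.bdiag_le _ _).trans_lt (max_lt hx.2.1 hy.2.1)
  · exact (X.bdiag_le _ _).trans (max_le hx.2.2.1 hy.2.2.1)
  · rw [← bdiag_one, bdiag_sub]
    exact (X.bdiag_le _ _).trans (max_le hx.2.2.2 hy.2.2.2)

theorem invPair_bdiag {ε r N : ℝ} {n m : ℕ} {x x' : Matrix (Fin n) (Fin n) U}
    {y y' : Matrix (Fin m) (Fin m) U} (hx : (x, x') ∈ X.InvPair ε r N n)
    (hy : (y, y') ∈ X.InvPair ε r N m) :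
    (bdiag x y, bdiag x' y') ∈ X.InvPair ε r N (n + m) := by
  obtain ⟨a1, a2, a3, a4, a5, a6⟩ := hx
  obtain ⟨b1, b2, b3, b4, b5, b6⟩ := hy
  refine ⟨bdiag_mem_mfilt a1 b1, bdiag_mem_mfilt a2 b2, ?_, ?_, ?_, ?_⟩
  · rw [← bdiag_one, bdiag_mul, bdiag_sub]
    exact (X.bdiag_le _ _).trans_lt (max_lt a3 b3)
  · rw [← bdiag_one, bdiag_mul, bdiag_sub]
    exact (X.bdiag_le _ _).trans_lt (max_lt a4 b4)
  · exact (X.bdiag_le _ _).trans (max_le a5 b5)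
  · exact (X.bdiag_le _ _).trans (max_le a6 b6)

theorem idem_zero {ε r N : ℝ} (hε : 0 < ε) (hN : 1 ≤ N) (n : ℕ) :
    (0 : Matrix (Fin n) (Fin n) U) ∈ X.Idem ε r N n := by
  refine ⟨fun i j => zero_mem _, ?_, ?_, ?_⟩
  · simpa using hε
  · rw [map_zero]
    linarith
  · rw [sub_zero]
    exact (X.norm_one_le n).trans hN

theorem invPair_one {ε r N : ℝ} (hε : 0 < ε) (hr : 0 < r) (hN : 1 ≤ N) (n : ℕ) :
    ((1, 1) : Matrix (Fin n) (Fin n) U × Matrix (Fin n) (Fin n) U) ∈ X.InvPair ε r N n := by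
  refine ⟨one_mem_mfilt hr n, one_mem_mfilt hr n, ?_, ?_, ?_, ?_⟩
  · simpa using hε
  · simpa using hε
  · exact (X.norm_one_le n).trans hN
  · exact (X.norm_one_le n).trans hN

/-- A map which is Lipschitz for the norms is continuous. -/
theorem cont_of_bound {V : Type*} [Ring V] [Algebra ℂ V] {Y : QAlg p V} {n m : ℕ}
    (f : Matrix (Fin n) (Fin n) U → Matrix (Fin m) (Fin m) V) (c : ℝ)
    (h : ∀ x y, Y.nrm m (f x - f y) ≤ c * X.nrm n (x - y)) :
    @Continuous _ _ (X.topo n) (Y.topo m) f := by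
  letI := X.sng n
  letI := Y.sng m
  refine (LipschitzWith.of_dist_le_mul (K := c.toNNReal) fun x y => ?_).continuous
  rw [dist_eq_norm, dist_eq_norm]
  refine (h x y).trans ?_
  exact mul_le_mul_of_nonneg_right (Real.le_coe_toNNReal c) (apply_nonneg _ _)

theorem continuous_bdiag (n m : ℕ) :
    @Continuous _ _ (@instTopologicalSpaceProd _ _ (X.topo n) (X.topo m)) (X.topo (n + m))
      (fun w : Matrix (Fin n) (Fin n) U × Matrix (Fin m) (Fin m) U => bdiag w.1 w.2) := by
  letI := X.sng n
  letI := X.sng m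
  letI := X.sng (n + m)
  refine (LipschitzWith.of_dist_le_mul (K := 1) fun x y => ?_).continuous
  rw [dist_eq_norm, dist_eq_norm, NNReal.coe_one, one_mul]
  rw [bdiag_sub]
  exact X.bdiag_le _ _

theorem idemHtpy_bdiag {ε r N : ℝ} {n m : ℕ} {x x' : Matrix (Fin n) (Fin n) U}
    {y y' : Matrix (Fin m) (Fin m) U} (hx : X.IdemHtpy ε r N n x x')
    (hy : X.IdemHtpy ε r N m y y') : X.IdemHtpy ε r N (n + m) (bdiag x y) (bdiag x' y') := by
  letI := X.topo n
  letI := X.topo m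
  letI := X.topo (n + m)
  have := (JoinedIn.prod hx hy).map (continuous_bdiag (X := X) n m)
  refine this.mono ?_
  rintro _ ⟨⟨a, b⟩, ⟨ha, hb⟩, rfl⟩
  exact idem_bdiag ha hb

theorem glHtpy_bdiag {ε r N : ℝ} {n m : ℕ} {x x' : Matrix (Fin n) (Fin n) U}
    {y y' : Matrix (Fin m) (Fin m) U} (hx : X.GLHtpy ε r N n x x')
    (hy : X.GLHtpy ε r N m y y') : X.GLHtpy ε r N (n + m) (bdiag x y) (bdiag x' y') := by
  letI := X.topo n
  letI := X.topo m
  letI := X.topo (n + m)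
  obtain ⟨a, b, hx⟩ := hx
  obtain ⟨c, d, hy⟩ := hy
  have hc := continuous_bdiag (X := X) n m
  have := (JoinedIn.prod hx hy).map (f := fun w => (bdiag w.1.1 w.2.1, bdiag w.1.2 w.2.2))
    ((hc.comp (by fun_prop : Continuous fun w : (Matrix (Fin n) (Fin n) U × Matrix (Fin n) (Fin n) U) ×
        (Matrix (Fin m) (Fin m) U × Matrix (Fin m) (Fin m) U) => (w.1.1, w.2.1))).prodMk
      (hc.comp (by fun_prop : Continuous fun w : (Matrix (Fin n) (Fin n) U × Matrix (Fin n) (Fin n) U) ×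
        (Matrix (Fin m) (Fin m) U × Matrix (Fin m) (Fin m) U) => (w.1.2, w.2.2))))
  refine ⟨bdiag a c, bdiag b d, this.mono ?_⟩
  rintro _ ⟨⟨⟨a, b⟩, ⟨a', b'⟩⟩, ⟨ha, hb⟩, rfl⟩
  exact invPair_bdiag ha hb

theorem idemHtpy_refl {ε r N : ℝ} {n : ℕ} {x : Matrix (Fin n) (Fin n) U}
    (hx : x ∈ X.Idem ε r N n) : X.IdemHtpy ε r N n x x :=
  letI := X.topo n
  JoinedIn.refl hx

theorem glHtpy_refl {ε r N : ℝ} {n : ℕ} {x : Matrix (Fin n) (Fin n) U}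
    (hx : x ∈ X.QInv ε r N n) : X.GLHtpy ε r N n x x := by
  letI := X.topo n
  obtain ⟨v, hv⟩ := hx
  exact ⟨v, v, JoinedIn.refl hv⟩

theorem norm_convex {n : ℕ} {t : ℝ} (ht : t ∈ Set.Icc (0 : ℝ) 1) {a b : ℝ}
    {x y : Matrix (Fin n) (Fin n) U} (hx : X.nrm n x ≤ a) (hy : X.nrm n y ≤ b) :
    X.nrm n (((1 - t : ℝ) : ℂ) • x + (t : ℂ) • y) ≤ (1 - t) * a + t * b := by
  refine (map_add_le_add _ _ _).trans ?_
  rw [map_smul_eq_mul, map_smul_eq_mul, Complex.norm_real, Complex.norm_real,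
    Real.norm_of_nonneg (sub_nonneg.2 ht.2), Real.norm_of_nonneg ht.1]
  exact add_le_add (mul_le_mul_of_nonneg_left hx (sub_nonneg.2 ht.2))
    (mul_le_mul_of_nonneg_left hy ht.1)

theorem continuous_segment {n : ℕ} (x y : Matrix (Fin n) (Fin n) U) :
    @Continuous _ _ _ (X.topo n) fun t : ℝ => ((1 - t : ℝ) : ℂ) • x + (t : ℂ) • y := by
  letI := X.sng n
  letI : NormedSpace ℂ (Matrix (Fin n) (Fin n) U) :=
    { (inferInstance : Module ℂ (Matrix (Fin n) (Fin n) U)) with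
      norm_smul_le := fun c x => (map_smul_eq_mul (X.nrm n) c x).le }
  fun_prop

theorem glHtpy_trans {ε r N : ℝ} {n : ℕ} {x y z : Matrix (Fin n) (Fin n) U}
    (h1 : X.GLHtpy ε r N n x y) (h2 : X.GLHtpy ε r N n y z) : X.GLHtpy ε r N n x z := by
  letI := X.topo n
  obtain ⟨a, b, h1⟩ := h1
  obtain ⟨c, d, h2⟩ := h2
  refine ⟨a, d, h1.trans (JoinedIn.trans ?_ h2)⟩
  have hb := h1.target_mem
  have hc := h2.source_mem
  obtain ⟨b1, b2, b3, b4, b5, b6⟩ := hb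
  obtain ⟨c1, c2, c3, c4, c5, c6⟩ := hc
  refine JoinedIn.ofLine (f := fun t => (y, ((1 - t : ℝ) : ℂ) • b + (t : ℂ) • c)) ?_
    (by simp) (by simp) ?_
  · exact (continuous_const.prodMk (continuous_segment b c)).continuousOn
  rintro _ ⟨t, ht, rfl⟩
  have hlt : (1 - t) * X.nrm n (y * b - 1) + t * X.nrm n (y * c - 1) < ε := by
    rcases ht.1.eq_or_lt with h | h
    · rw [← h]; simpa using b3
    · have := mul_lt_mul_of_pos_left c3 h
      have := mul_le_mul_of_nonneg_left b3.le (sub_nonneg.2 ht.2)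
      simp only at *
      linarith
  have hlt' : (1 - t) * X.nrm n (b * y - 1) + t * X.nrm n (c * y - 1) < ε := by
    rcases ht.1.eq_or_lt with h | h
    · rw [← h]; simpa using b4
    · have := mul_lt_mul_of_pos_left c4 h
      have := mul_le_mul_of_nonneg_left b4.le (sub_nonneg.2 ht.2)
      simp only at *
      linarith
  refine ⟨b1, add_mem_mfilt (smul_mem_mfilt _ b2) (smul_mem_mfilt _ c2), ?_, ?_, b5, ?_⟩
  · refine lt_of_le_of_lt (le_trans (le_of_eq ?_) (norm_convex ht le_rfl le_rfl)) hlt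
    congr 1
    simp only [mul_add, mul_sub, mul_smul_comm, smul_sub, Complex.ofReal_sub, Complex.ofReal_one, sub_smul,
      one_smul]
    abel
  · refine lt_of_le_of_lt (le_trans (le_of_eq ?_) (norm_convex ht le_rfl le_rfl)) hlt'
    congr 1
    simp only [add_mul, sub_mul, smul_mul_assoc, smul_sub, Complex.ofReal_sub, Complex.ofReal_one, sub_smul,
      one_smul]
    abel
  · refine (norm_convex ht b6 c6).trans (le_of_eq ?_)
    ring

end QAlg
end QK

set_option linter.unusedSectionVars false

namespace QK

open scoped ENNReal

namespace QAlg
variable {p : ℝ≥0∞} [Fact (1 ≤ p)] {U : Type*} [Ring U] [Algebra ℂ U] {X : QAlg p U}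

section rotation

/-- The rotation `cos(πt/2) - i sin(πt/2) P` for the permutation matrix `P` of an involution. -/
noncomputable def rotL (U : Type*) [Ring U] [Algebra ℂ U] {n : ℕ} (σ : Equiv.Perm (Fin n)) (t : ℝ) :
    Matrix (Fin n) (Fin n) U :=
  (Real.cos (Real.pi / 2 * t) : ℂ) • (1 : Matrix (Fin n) (Fin n) U) -
    (Complex.I * Real.sin (Real.pi / 2 * t)) • (1 : Matrix (Fin n) (Fin n) U).submatrix σ id

/-- The inverse rotation. -/
noncomputable def rotR (U : Type*) [Ring U] [Algebra ℂ U] {n : ℕ} (σ : Equiv.Perm (Fin n)) (t : ℝ) :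
    Matrix (Fin n) (Fin n) U :=
  (Real.cos (Real.pi / 2 * t) : ℂ) • (1 : Matrix (Fin n) (Fin n) U) +
    (Complex.I * Real.sin (Real.pi / 2 * t)) • (1 : Matrix (Fin n) (Fin n) U).submatrix σ id

variable {n : ℕ} {σ : Equiv.Perm (Fin n)}

theorem permMat_mul (x : Matrix (Fin n) (Fin n) U) :
    (1 : Matrix (Fin n) (Fin n) U).submatrix σ id * x = x.submatrix σ id := by
  ext i j
  simp [Matrix.mul_apply, Matrix.one_apply]

theorem mul_permMat (hσ : ∀ i, σ (σ i) = i) (x : Matrix (Fin n) (Fin n) U) :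
    x * (1 : Matrix (Fin n) (Fin n) U).submatrix σ id = x.submatrix id σ := by
  ext i j
  simp only [Matrix.mul_apply, Matrix.submatrix_apply, id, Matrix.one_apply]
  rw [Finset.sum_eq_single (σ j)]
  · simp [hσ]
  · intro k _ hk
    rw [if_neg, mul_zero]
    rintro rfl
    exact hk (hσ k).symm
  · simp

theorem rotR_mul_rotL (hσ : ∀ i, σ (σ i) = i) (t : ℝ) : rotR U σ t * rotL U σ t = 1 := by
  have h1 : (1 : Matrix (Fin n) (Fin n) U).submatrix σ id *
      (1 : Matrix (Fin n) (Fin n) U).submatrix σ id = 1 := by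
    rw [permMat_mul]
    ext i j
    change (1 : Matrix (Fin n) (Fin n) U) (σ (σ i)) j = (1 : Matrix (Fin n) (Fin n) U) i j
    rw [hσ]
  have h2 : ((Real.cos (Real.pi / 2 * t) : ℂ)) * (Real.cos (Real.pi / 2 * t) : ℂ) -
      (Complex.I * Real.sin (Real.pi / 2 * t)) * (Complex.I * Real.sin (Real.pi / 2 * t)) = 1 := by
    have := Real.cos_sq_add_sin_sq (Real.pi / 2 * t)
    have h3 : ((Real.cos (Real.pi / 2 * t) : ℂ)) ^ 2 + (Real.sin (Real.pi / 2 * t) : ℂ) ^ 2 = 1 := by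
      exact_mod_cast this
    linear_combination h3 - (Real.sin (Real.pi / 2 * t) : ℂ) ^ 2 * Complex.I_sq
  rw [rotR, rotL]
  generalize (Complex.I * Real.sin (Real.pi / 2 * t)) = b at *
  generalize (Real.cos (Real.pi / 2 * t) : ℂ) = a at *
  generalize (1 : Matrix (Fin n) (Fin n) U).submatrix σ id = P at *
  have : (a • (1 : Matrix (Fin n) (Fin n) U) + b • P) * (a • 1 - b • P) =
      (a * a) • (1 : Matrix (Fin n) (Fin n) U) - (b * b) • (P * P) := by
    simp only [mul_sub, add_mul, smul_mul_smul_comm, mul_one, one_mul, mul_comm b a]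
    abel
  rw [this, h1, ← sub_smul, h2, one_smul]

/-- Conjugation by the rotation. -/
noncomputable def conj (σ : Equiv.Perm (Fin n)) (t : ℝ) (x : Matrix (Fin n) (Fin n) U) :
    Matrix (Fin n) (Fin n) U := rotL U σ t * x * rotR U σ t

theorem conj_mul (hσ : ∀ i, σ (σ i) = i) (t : ℝ) (x y : Matrix (Fin n) (Fin n) U) :
    conj σ t x * conj σ t y = conj σ t (x * y) := by
  have : conj σ t x * conj σ t y = rotL U σ t * x * (rotR U σ t * rotL U σ t) * y * rotR U σ t := by
    simp only [conj, mul_assoc]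
  rw [this, rotR_mul_rotL hσ, mul_one, conj, mul_assoc (rotL U σ t) x y]

theorem conj_sub (t : ℝ) (x y : Matrix (Fin n) (Fin n) U) :
    conj σ t x - conj σ t y = conj σ t (x - y) := by
  simp only [conj, mul_sub, sub_mul]

theorem conj_apply (hσ : ∀ i, σ (σ i) = i) (t : ℝ) (x : Matrix (Fin n) (Fin n) U) :
    conj σ t x = ((Real.cos (Real.pi / 2 * t) : ℂ) ^ 2) • x +
      ((Real.sin (Real.pi / 2 * t) : ℂ) ^ 2) • x.submatrix σ σ +
      (Complex.I * Real.sin (Real.pi / 2 * t) * Real.cos (Real.pi / 2 * t)) •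
        (x.submatrix id σ - x.submatrix σ id) := by
  have e1 : (1 : Matrix (Fin n) (Fin n) U).submatrix σ id * x *
      (1 : Matrix (Fin n) (Fin n) U).submatrix σ id = x.submatrix σ σ := by
    rw [permMat_mul, mul_permMat hσ]
    rfl
  have h3 : (Real.sin (Real.pi / 2 * t) : ℂ) ^ 2 =
      -((Complex.I * Real.sin (Real.pi / 2 * t)) * (Complex.I * Real.sin (Real.pi / 2 * t))) := by
    linear_combination (Real.sin (Real.pi / 2 * t) : ℂ) ^ 2 * Complex.I_sq
  rw [h3, ← e1, ← permMat_mul x, ← mul_permMat hσ x, conj, rotL, rotR]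
  generalize (Complex.I * Real.sin (Real.pi / 2 * t)) = b at *
  generalize (Real.cos (Real.pi / 2 * t) : ℂ) = a at *
  generalize (1 : Matrix (Fin n) (Fin n) U).submatrix σ id = P at *
  simp only [sub_mul, mul_add, smul_mul_assoc, mul_smul_comm, smul_sub, smul_smul, mul_one,
    one_mul, neg_smul, pow_two, mul_comm b a]
  abel

theorem conj_zero (x : Matrix (Fin n) (Fin n) U) : conj σ 0 x = x := by
  simp [conj, rotL, rotR]

theorem conj_at_one (hσ : ∀ i, σ (σ i) = i) (x : Matrix (Fin n) (Fin n) U) :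
    conj σ 1 x = x.submatrix σ σ := by
  rw [conj_apply hσ]
  simp

theorem conj_one (hσ : ∀ i, σ (σ i) = i) (t : ℝ) :
    conj σ t (1 : Matrix (Fin n) (Fin n) U) = 1 := by
  rw [conj, mul_one]
  rw [← rotR_mul_rotL (U := U) hσ t, rotL, rotR]
  generalize (Complex.I * Real.sin (Real.pi / 2 * t)) = b at *
  generalize (Real.cos (Real.pi / 2 * t) : ℂ) = a at *
  generalize (1 : Matrix (Fin n) (Fin n) U).submatrix σ id = P at *
  simp only [mul_sub, sub_mul, mul_add, add_mul, smul_mul_smul_comm, mul_one, one_mul, mul_comm b a]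
  abel

theorem norm_conj_aux (t : ℝ) {a b d K : ℝ} (ha : a ≤ K) (hb : b ≤ K) (hd : d ≤ 2 * K)
    (hK : 0 ≤ K) {x y z : Matrix (Fin n) (Fin n) U} (hx : X.nrm n x ≤ a) (hy : X.nrm n y ≤ b)
    (hz : X.nrm n z ≤ d) :
    X.nrm n (((Real.cos (Real.pi / 2 * t) : ℂ) ^ 2) • x +
      ((Real.sin (Real.pi / 2 * t) : ℂ) ^ 2) • y +
      (Complex.I * Real.sin (Real.pi / 2 * t) * Real.cos (Real.pi / 2 * t)) • z) ≤ 2 * K := by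
  refine (map_add_le_add _ _ _).trans ((add_le_add (map_add_le_add _ _ _) le_rfl).trans ?_)
  rw [map_smul_eq_mul, map_smul_eq_mul, map_smul_eq_mul]
  simp only [norm_mul, norm_pow, Complex.norm_I, one_mul, Complex.norm_real]
  have h := Real.cos_sq_add_sin_sq (Real.pi / 2 * t)
  generalize Real.cos (Real.pi / 2 * t) = c at *
  generalize Real.sin (Real.pi / 2 * t) = s at *
  rw [← sq_abs c, ← sq_abs s] at h
  simp only [Real.norm_eq_abs]
  generalize |c| = c at *
  generalize |s| = s at *
  have h1 := mul_le_mul_of_nonneg_left (hx.trans ha) (sq_nonneg c)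
  have h2 := mul_le_mul_of_nonneg_left (hy.trans hb) (sq_nonneg s)
  have h3 : s * c * X.nrm n z ≤ K := by
    have h4 : s * c ≤ 1 / 2 := by nlinarith [sq_nonneg (s - c)]
    have h5 := mul_le_mul_of_nonneg_right h4 (apply_nonneg (X.nrm n) z)
    have := hz.trans hd
    linarith
  nlinarith

theorem norm_perm_le (σ τ : Equiv.Perm (Fin n)) (x : Matrix (Fin n) (Fin n) U) :
    X.nrm n (x.submatrix σ τ) ≤ X.nrm n x :=
  (X.perm_right τ (x.submatrix σ id)).trans (X.perm_left σ x)

theorem norm_conj_le (hσ : ∀ i, σ (σ i) = i) (t : ℝ) (x : Matrix (Fin n) (Fin n) U) :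
    X.nrm n (conj σ t x) ≤ 2 * X.nrm n x := by
  rw [conj_apply hσ]
  refine norm_conj_aux (a := X.nrm n x) (b := X.nrm n x) (d := 2 * X.nrm n x) t le_rfl le_rfl le_rfl
    (apply_nonneg _ _) le_rfl (norm_perm_le _ _ _) ?_
  refine (map_sub_le_add _ _ _).trans ?_
  have := X.perm_left σ x
  have := X.perm_right σ x
  linarith

theorem conj_mem_mfilt (hσ : ∀ i, σ (σ i) = i) (t : ℝ) {r : ℝ} {x : Matrix (Fin n) (Fin n) U}
    (hx : x ∈ X.mfilt r n) : conj σ t x ∈ X.mfilt r n := by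
  rw [conj_apply hσ]
  exact add_mem_mfilt (add_mem_mfilt (smul_mem_mfilt _ hx) (smul_mem_mfilt _ fun i j => hx _ _))
    (smul_mem_mfilt _ (sub_mem_mfilt (fun i j => hx _ _) fun i j => hx _ _))

theorem continuous_conj (x : Matrix (Fin n) (Fin n) U) :
    @Continuous _ _ _ (X.topo n) fun t : ℝ => conj σ t x := by
  letI := X.srng n
  letI : NormedSpace ℂ (Matrix (Fin n) (Fin n) U) :=
    { (inferInstance : Module ℂ (Matrix (Fin n) (Fin n) U)) with
      norm_smul_le := fun c x => (map_smul_eq_mul (X.nrm n) c x).le }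
  unfold conj rotL rotR
  fun_prop

theorem continuous_mul_path {f g : ℝ → Matrix (Fin n) (Fin n) U}
    (hf : @Continuous _ _ _ (X.topo n) f) (hg : @Continuous _ _ _ (X.topo n) g) :
    @Continuous _ _ _ (X.topo n) fun t => f t * g t := by
  letI := X.srng n
  exact Continuous.mul (M := Matrix (Fin n) (Fin n) U) hf hg

theorem conj_mem_idem (hσ : ∀ i, σ (σ i) = i) {ε r N : ℝ} (hε : 0 < ε)
    {e : Matrix (Fin n) (Fin n) U} (he : e ∈ X.Idem ε r N n) (t : ℝ) :
    conj σ t e ∈ X.Idem (4 * ε) r (4 * N) n := by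
  obtain ⟨h1, h2, h3, h4⟩ := he
  have hN : 0 ≤ N := (apply_nonneg _ _).trans h3
  refine ⟨conj_mem_mfilt hσ t h1, ?_, ?_, ?_⟩
  · rw [conj_mul hσ, conj_sub]
    have := norm_conj_le (X := X) hσ t (e * e - e)
    linarith
  · have := norm_conj_le (X := X) hσ t e
    linarith
  · rw [← conj_one hσ t, conj_sub]
    have := norm_conj_le (X := X) hσ t (1 - e)
    linarith

theorem conj_mem_invPair (hσ : ∀ i, σ (σ i) = i) {ε r N : ℝ} (hε : 0 < ε) (hr : 0 < r)
    {u v : Matrix (Fin n) (Fin n) U} (he : (u, v) ∈ X.InvPair ε r N n) (t : ℝ) :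
    (conj σ t u, conj σ t v) ∈ X.InvPair (4 * ε) (2 * r) (4 * N) n := by
  obtain ⟨h1, h2, h3, h4, h5, h6⟩ := he
  have hN : 0 ≤ N := (apply_nonneg _ _).trans h5
  have key : ∀ {x}, X.nrm n (x - 1) < ε → X.nrm n (conj σ t x - 1) < 4 * ε := by
    intro x hx
    have := norm_conj_le (X := X) hσ t (x - 1)
    rw [← conj_sub, conj_one hσ] at this
    linarith
  have key' : ∀ {x}, X.nrm n x ≤ N → X.nrm n (conj σ t x) ≤ 4 * N := by
    intro x hx
    have := norm_conj_le (X := X) hσ t x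
    linarith
  refine ⟨conj_mem_mfilt hσ t fun i j => X.filt_mono (by linarith) (h1 i j),
    conj_mem_mfilt hσ t fun i j => X.filt_mono (by linarith) (h2 i j), ?_, ?_, key' h5, key' h6⟩
  · rw [conj_mul hσ]
    exact key h3
  · rw [conj_mul hσ]
    exact key h4

end rotation

theorem swap_invol {n : ℕ} (a b i : Fin n) : Equiv.swap a b (Equiv.swap a b i) = i :=
  Equiv.swap_apply_self a b i

theorem idem_perm {ε r N : ℝ} {n : ℕ} {x : Matrix (Fin n) (Fin n) U} (σ : Equiv.Perm (Fin n))
    (hx : x ∈ X.Idem ε r N n) : x.submatrix σ σ ∈ X.Idem ε r N n := by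
  obtain ⟨h1, h2, h3, h4⟩ := hx
  refine ⟨fun i j => h1 _ _, ?_, (norm_perm_le _ _ _).trans h3, ?_⟩
  · rw [Matrix.submatrix_mul_equiv]
    exact (norm_perm_le σ σ (x * x - x)).trans_lt h2
  · have : 1 - x.submatrix σ σ = (1 - x).submatrix σ σ := by
      ext i j
      simp [Matrix.one_apply]
    rw [this]
    exact (norm_perm_le _ _ _).trans h4

theorem invPair_perm {ε r N : ℝ} {n : ℕ} {x y : Matrix (Fin n) (Fin n) U} (σ : Equiv.Perm (Fin n))
    (hx : (x, y) ∈ X.InvPair ε r N n) :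
    (x.submatrix σ σ, y.submatrix σ σ) ∈ X.InvPair ε r N n := by
  obtain ⟨h1, h2, h3, h4, h5, h6⟩ := hx
  refine ⟨fun i j => h1 _ _, fun i j => h2 _ _, ?_, ?_, (norm_perm_le _ _ _).trans h5,
    (norm_perm_le _ _ _).trans h6⟩
  · rw [Matrix.submatrix_mul_equiv, ← Matrix.submatrix_one_equiv σ]
    exact (norm_perm_le σ σ (x * y - 1)).trans_lt h3
  · rw [Matrix.submatrix_mul_equiv, ← Matrix.submatrix_one_equiv σ]
    exact (norm_perm_le σ σ (y * x - 1)).trans_lt h4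

theorem idem_htpy_perm {ε r N : ℝ} (hε : 0 < ε) {n : ℕ} (σ : Equiv.Perm (Fin n)) :
    ∀ x ∈ X.Idem ε r N n, X.IdemHtpy (4 * ε) r (4 * N) n x (x.submatrix σ σ) := by
  letI := X.topo n
  induction σ using Equiv.Perm.swap_induction_on with
  | one =>
    intro x hx
    have : x ∈ X.Idem (4 * ε) r (4 * N) n := by
      have := conj_mem_idem (σ := 1) (fun _ => rfl) hε hx 0
      rwa [conj_zero] at this
    exact JoinedIn.refl this
  | swap_mul f a b _ ih =>
    intro x hx
    have hσ := swap_invol a b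
    have h1 : JoinedIn (X.Idem (4 * ε) r (4 * N) n) x
        (x.submatrix (Equiv.swap a b) (Equiv.swap a b)) := by
      refine JoinedIn.ofLine (f := fun t => conj (Equiv.swap a b) t x)
        (continuous_conj x).continuousOn (conj_zero x) (conj_at_one hσ x) ?_
      rintro _ ⟨t, _, rfl⟩
      exact conj_mem_idem hσ hε hx t
    exact JoinedIn.trans h1 (ih _ (idem_perm _ hx))

theorem gl_htpy_perm {ε r N : ℝ} (hε : 0 < ε) (hr : 0 < r) {n : ℕ} (σ : Equiv.Perm (Fin n)) :
    ∀ x ∈ X.QInv ε r N n, X.GLHtpy (4 * ε) (2 * r) (4 * N) n x (x.submatrix σ σ) := by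
  letI := X.topo n
  induction σ using Equiv.Perm.swap_induction_on with
  | one =>
    rintro x ⟨y, hx⟩
    have : (x, y) ∈ X.InvPair (4 * ε) (2 * r) (4 * N) n := by
      have := conj_mem_invPair (σ := 1) (fun _ => rfl) hε hr hx 0
      rwa [conj_zero, conj_zero] at this
    exact ⟨y, y, JoinedIn.refl this⟩
  | swap_mul f a b _ ih =>
    rintro x ⟨y, hx⟩
    have hσ := swap_invol a b
    refine glHtpy_trans ?_ (ih _ ⟨_, invPair_perm (Equiv.swap a b) hx⟩)
    refine ⟨y, y.submatrix (Equiv.swap a b) (Equiv.swap a b), ?_⟩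
    refine JoinedIn.ofLine
      (f := fun t => (conj (Equiv.swap a b) t x, conj (Equiv.swap a b) t y))
      ((continuous_conj x).prodMk (continuous_conj y)).continuousOn
      (by simp only [conj_zero]) (by simp only [conj_at_one hσ]) ?_
    rintro _ ⟨t, _, rfl⟩
    exact conj_mem_invPair hσ hε hr hx t

end QAlg

/-- The parameters `(ε, r, N)` of quantitative `K`-theory. -/
@[ext] structure Param where
  ε : ℝ
  r : ℝ
  N : ℝ
  ε_pos : 0 < ε
  ε_lt : ε < 1 / 20
  r_pos : 0 < r
  one_le : 1 ≤ N

instance : PartialOrder Param where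
  le P Q := P.ε ≤ Q.ε ∧ P.r ≤ Q.r ∧ P.N ≤ Q.N
  le_refl P := ⟨le_rfl, le_rfl, le_rfl⟩
  le_trans _ _ _ h h' := ⟨h.1.trans h'.1, h.2.1.trans h'.2.1, h.2.2.trans h'.2.2⟩
  le_antisymm _ _ h h' := Param.ext (h.1.antisymm h'.1) (h.2.1.antisymm h'.2.1)
    (h.2.2.antisymm h'.2.2)

namespace QAlg
variable {p : ℝ≥0∞} [Fact (1 ≤ p)] {U : Type*} [Ring U] [Algebra ℂ U] (X : QAlg p U) (P : Param)

theorem four_le {N : ℝ} (h : 1 ≤ N) : N ≤ 4 * N := by linarith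

theorem le_four {ε : ℝ} (h : 0 < ε) : ε ≤ 4 * ε := by linarith

theorem le_two {ε : ℝ} (h : 0 < ε) : ε ≤ 2 * ε := by linarith

/-- `(ε, r, N)`-idempotents in `M_∞(U)`, up to `(4ε, r, 4N)`-homotopy. -/
def idemSystem : StableSystem U where
  d := 0
  S := X.Idem P.ε P.r P.N
  H := X.IdemHtpy (4 * P.ε) P.r (4 * P.N)
  refl hx := idemHtpy_refl (idem_mono (le_four P.ε_pos) le_rfl (four_le P.one_le) _ hx)
  symm {n _ _} h := letI := X.topo n; JoinedIn.symm h
  trans {n _ _ _} h h' := letI := X.topo n; JoinedIn.trans h h'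
  S_diag n := by
    rw [Matrix.diagonal_zero]
    exact idem_zero P.ε_pos P.one_le n
  S_bdiag := idem_bdiag
  H_diag n := by
    rw [Matrix.diagonal_zero]
    exact idemHtpy_refl (idem_mono (le_four P.ε_pos) le_rfl (four_le P.one_le) _
      (idem_zero P.ε_pos P.one_le n))
  H_bdiag := idemHtpy_bdiag
  S_perm := idem_perm
  H_perm σ hx := idem_htpy_perm P.ε_pos σ _ hx

theorem qInv_mono {ε r N ε' r' N' : ℝ} (h1 : ε ≤ ε') (h2 : r ≤ r') (h3 : N ≤ N') (n : ℕ) :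
    X.QInv ε r N n ⊆ X.QInv ε' r' N' n := fun _ ⟨v, hv⟩ => ⟨v, invPair_mono h1 h2 h3 n hv⟩

/-- `(ε, r, N)`-invertibles in `M_∞(U)`, up to `(4ε, 2r, 4N)`-homotopy. -/
def glSystem : StableSystem U where
  d := 1
  S := X.QInv P.ε P.r P.N
  H := X.GLHtpy (4 * P.ε) (2 * P.r) (4 * P.N)
  refl hx := glHtpy_refl (X.qInv_mono (le_four P.ε_pos) (le_two P.r_pos) (four_le P.one_le) _ hx)
  symm {n _ _} h := by
    letI := X.topo n
    obtain ⟨a, b, h⟩ := h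
    exact ⟨b, a, JoinedIn.symm h⟩
  trans := glHtpy_trans
  S_diag n := by
    rw [Matrix.diagonal_one]
    exact ⟨1, invPair_one P.ε_pos P.r_pos P.one_le n⟩
  S_bdiag := by
    rintro n m x y ⟨x', hx⟩ ⟨y', hy⟩
    exact ⟨_, invPair_bdiag hx hy⟩
  H_diag n := by
    rw [Matrix.diagonal_one]
    exact glHtpy_refl (X.qInv_mono (le_four P.ε_pos) (le_two P.r_pos) (four_le P.one_le) _
      ⟨1, invPair_one P.ε_pos P.r_pos P.one_le n⟩)
  H_bdiag := glHtpy_bdiag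
  S_perm := by
    rintro n x σ ⟨y, hy⟩
    exact ⟨_, invPair_perm σ hy⟩
  H_perm σ hx := gl_htpy_perm P.ε_pos P.r_pos σ _ hx

end QAlg
end QK

namespace QK

open scoped ENNReal

/-- The involution of `Fin (n + n)` exchanging the two halves. -/
def blockSwap (n : ℕ) : Equiv.Perm (Fin (n + n)) :=
  finSumFinEquiv.symm.trans ((Equiv.sumComm (Fin n) (Fin n)).trans finSumFinEquiv)

theorem blockSwap_castAdd {n : ℕ} (i : Fin n) : blockSwap n (Fin.castAdd n i) = Fin.natAdd n i := by
  simp [blockSwap]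

theorem blockSwap_natAdd {n : ℕ} (i : Fin n) : blockSwap n (Fin.natAdd n i) = Fin.castAdd n i := by
  simp [blockSwap, -Fin.natAdd_eq_addNat]

theorem blockSwap_invol {n : ℕ} (i : Fin (n + n)) : blockSwap n (blockSwap n i) = i := by
  refine Fin.addCases (fun i => ?_) (fun i => ?_) i <;>
    simp [blockSwap_castAdd, blockSwap_natAdd, -Fin.natAdd_eq_addNat]

theorem bdiag_blockSwap {U : Type*} [Zero U] {n : ℕ} (x y : Matrix (Fin n) (Fin n) U) :
    (bdiag x y).submatrix (blockSwap n) (blockSwap n) = bdiag y x := by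
  ext i j
  refine Fin.addCases (fun i => ?_) (fun i => ?_) i <;>
    refine Fin.addCases (fun j => ?_) (fun j => ?_) j <;>
    simp [blockSwap_castAdd, blockSwap_natAdd, -Fin.natAdd_eq_addNat]

namespace QAlg
variable {p : ℝ≥0∞} [Fact (1 ≤ p)] {U : Type*} [Ring U] [Algebra ℂ U] {X : QAlg p U}

theorem conj_bdiag_self {n : ℕ} (t : ℝ) (x : Matrix (Fin n) (Fin n) U) :
    conj (blockSwap n) t (bdiag x x) = bdiag x x := by
  have h : bdiag x x * rotR U (blockSwap n) t = rotR U (blockSwap n) t * bdiag x x := by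
    have : bdiag x x * (1 : Matrix (Fin (n + n)) (Fin (n + n)) U).submatrix (blockSwap n) id =
        (1 : Matrix (Fin (n + n)) (Fin (n + n)) U).submatrix (blockSwap n) id * bdiag x x := by
      rw [permMat_mul, mul_permMat blockSwap_invol]
      conv_rhs => rw [← bdiag_blockSwap x x]
      ext i j
      simp [blockSwap_invol]
    simp only [rotR, mul_add, add_mul, mul_smul_comm, smul_mul_assoc, mul_one, one_mul, this]
  rw [conj, mul_assoc, h, ← mul_assoc]
  have := conj_one (U := U) (blockSwap_invol (n := n)) t
  rw [conj, mul_one] at this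
  rw [this, one_mul]

theorem norm_two_le {ε N : ℝ} (hε1 : ε ≤ 1) (hN : 1 ≤ N) {n : ℕ} {x : Matrix (Fin n) (Fin n) U}
    (h : X.nrm n (x - 1) < ε) : X.nrm n x ≤ 2 * N := by
  have h1 := map_add_le_add (X.nrm n) (x - 1) 1
  rw [sub_add_cancel] at h1
  have := X.norm_one_le n
  linarith

/-- `diag(u, v)` is homotopic to the identity if `(u, v)` is a quasi-inverse pair. -/
theorem glHtpy_bdiag_inv {ε r N : ℝ} (hε : 0 < ε) (hε1 : ε ≤ 1) (hr : 0 < r) (hN : 1 ≤ N) {n : ℕ}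
    {u v : Matrix (Fin n) (Fin n) U} (huv : (u, v) ∈ X.InvPair ε r N n) :
    X.GLHtpy (4 * ε) (2 * r) (4 * N) (n + n) (bdiag u v) 1 := by
  letI := X.topo (n + n)
  obtain ⟨h1, h2, h3, h4, h5, h6⟩ := huv
  have hB := blockSwap_invol (n := n)
  have h3' : X.nrm n (u * v) ≤ 2 * N := norm_two_le hε1 hN h3
  have h4' : X.nrm n (v * u) ≤ 2 * N := norm_two_le hε1 hN h4
  have h1n : X.nrm n 1 ≤ 2 * N := (X.norm_one_le n).trans (by linarith)
  have hm1 := one_mem_mfilt (X := X) hr n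
  have hm2 := one_mem_mfilt (X := X) (show 0 < 2 * r by linarith) n
  have huvm : u * v ∈ X.mfilt (2 * r) n := by
    rw [two_mul]; exact mul_mem_mfilt hr hr h1 h2
  have hvum : v * u ∈ X.mfilt (2 * r) n := by
    rw [two_mul]; exact mul_mem_mfilt hr hr h2 h1
  have step1 : X.GLHtpy (4 * ε) (2 * r) (4 * N) (n + n) (bdiag u v) (bdiag (u * v) 1) := by
    refine ⟨bdiag v u, bdiag 1 (v * u), ?_⟩
    have e0 : bdiag u v = bdiag u 1 * bdiag 1 v := by rw [bdiag_mul, mul_one, one_mul]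
    have e0' : bdiag v u = bdiag v 1 * bdiag 1 u := by rw [bdiag_mul, mul_one, one_mul]
    have e1 : bdiag (u * v) (1 : Matrix (Fin n) (Fin n) U) = bdiag u 1 * bdiag v 1 := by rw [bdiag_mul, mul_one]
    have e1' : bdiag (1 : Matrix (Fin n) (Fin n) U) (v * u) = bdiag 1 v * bdiag 1 u := by rw [bdiag_mul, mul_one]
    refine JoinedIn.ofLine (f := fun t => (bdiag u 1 * conj (blockSwap n) t (bdiag 1 v),
      conj (blockSwap n) t (bdiag v 1) * bdiag 1 u)) ?_ ?_ ?_ ?_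
    · exact ((continuous_mul_path continuous_const (continuous_conj _)).prodMk
        (continuous_mul_path (continuous_conj _) continuous_const)).continuousOn
    · simp only [conj_zero, ← e0, ← e0']
    · simp only [conj_at_one hB, bdiag_blockSwap, ← e1, ← e1']
    rintro _ ⟨t, _, rfl⟩
    refine ⟨?_, ?_, ?_, ?_, ?_, ?_⟩
    · rw [two_mul]
      exact mul_mem_mfilt hr hr (bdiag_mem_mfilt h1 hm1)
        (conj_mem_mfilt hB t (bdiag_mem_mfilt hm1 h2))
    · rw [two_mul]
      exact mul_mem_mfilt hr hr (conj_mem_mfilt hB t (bdiag_mem_mfilt h2 hm1))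
        (bdiag_mem_mfilt hm1 h1)
    · have : bdiag u 1 * conj (blockSwap n) t (bdiag 1 v) *
          (conj (blockSwap n) t (bdiag v 1) * bdiag 1 u) =
          bdiag u 1 * (conj (blockSwap n) t (bdiag 1 v) * conj (blockSwap n) t (bdiag v 1)) *
          bdiag 1 u := by simp only [mul_assoc]
      rw [this, conj_mul hB, bdiag_mul, one_mul, mul_one, conj_bdiag_self, bdiag_mul, bdiag_mul,
        mul_one, one_mul, ← bdiag_one, bdiag_sub]
      refine (X.bdiag_le _ _).trans_lt (max_lt ?_ ?_) <;> linarith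
    · have : conj (blockSwap n) t (bdiag v 1) * bdiag 1 u *
          (bdiag u 1 * conj (blockSwap n) t (bdiag 1 v)) =
          conj (blockSwap n) t (bdiag v 1) * (bdiag 1 u * bdiag u 1) *
          conj (blockSwap n) t (bdiag 1 v) := by simp only [mul_assoc]
      rw [this, bdiag_mul, one_mul, mul_one, ← conj_bdiag_self t u, conj_mul hB, conj_mul hB,
        bdiag_mul, bdiag_mul, mul_one, one_mul, ← conj_one hB t, conj_sub, ← bdiag_one, bdiag_sub]
      refine (norm_conj_le hB _ _).trans_lt ?_
      have : X.nrm (n + n) (bdiag (v * u - 1) (u * v - 1)) < ε :=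
        (X.bdiag_le _ _).trans_lt (max_lt h4 h3)
      linarith
    · change X.nrm (n + n) (bdiag u 1 * conj (blockSwap n) t (bdiag 1 v)) ≤ 4 * N
      rw [conj_apply hB, mul_add, mul_add, mul_smul_comm, mul_smul_comm, mul_smul_comm, mul_sub,
        bdiag_blockSwap, ← e0, ← e1]
      have p1 : bdiag u 1 * (bdiag 1 v).submatrix id (blockSwap n) =
          (bdiag u v).submatrix id (blockSwap n) := by
        rw [e0, ← mul_permMat hB, ← mul_permMat hB, mul_assoc]
      have p2 : bdiag u 1 * (bdiag 1 v).submatrix (blockSwap n) id =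
          (bdiag (u * v) 1).submatrix id (blockSwap n) := by
        have : (bdiag 1 v).submatrix (blockSwap n) id =
            (bdiag v 1).submatrix id (blockSwap n) := by
          rw [← bdiag_blockSwap 1 v]
          ext i j
          simp [blockSwap_invol]
        rw [this, e1, ← mul_permMat hB, ← mul_permMat hB, mul_assoc]
      rw [p1, p2]
      have q1 : X.nrm (n + n) (bdiag u v) ≤ 2 * N :=
        (X.bdiag_le _ _).trans (max_le (by linarith) (by linarith))
      have q2 : X.nrm (n + n) (bdiag (u * v) 1) ≤ 2 * N :=
        (X.bdiag_le _ _).trans (max_le h3' h1n)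
      have q3 := (map_sub_le_add (X.nrm (n + n)) ((bdiag u v).submatrix id (blockSwap n))
        ((bdiag (u * v) 1).submatrix id (blockSwap n))).trans
        (add_le_add ((X.perm_right _ _).trans q1) ((X.perm_right _ _).trans q2))
      refine (norm_conj_aux t (K := 2 * N) le_rfl le_rfl (d := 2 * (2 * N)) le_rfl (by linarith)
        q1 q2 (q3.trans (by linarith))).trans (by linarith)
    · change X.nrm (n + n) (conj (blockSwap n) t (bdiag v 1) * bdiag 1 u) ≤ 4 * N
      rw [conj_apply hB, add_mul, add_mul, smul_mul_assoc, smul_mul_assoc, smul_mul_assoc, sub_mul,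
        bdiag_blockSwap, ← e0', ← e1']
      have p1 : (bdiag v 1).submatrix (blockSwap n) id * bdiag 1 u =
          (bdiag v u).submatrix (blockSwap n) id := by
        rw [e0', ← permMat_mul (bdiag v 1), ← permMat_mul (bdiag v 1 * bdiag 1 u), mul_assoc]
      have p2 : (bdiag v 1).submatrix id (blockSwap n) * bdiag 1 u =
          (bdiag 1 (v * u)).submatrix (blockSwap n) id := by
        have : (bdiag v 1).submatrix id (blockSwap n) =
            (bdiag 1 v).submatrix (blockSwap n) id := by
          rw [← bdiag_blockSwap 1 v]
          ext i j
          simp [blockSwap_invol]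
        rw [this, e1', ← permMat_mul (bdiag 1 v), ← permMat_mul (bdiag 1 v * bdiag 1 u), mul_assoc]
      rw [p1, p2]
      have q1 : X.nrm (n + n) (bdiag v u) ≤ 2 * N :=
        (X.bdiag_le _ _).trans (max_le (by linarith) (by linarith))
      have q2 : X.nrm (n + n) (bdiag 1 (v * u)) ≤ 2 * N :=
        (X.bdiag_le _ _).trans (max_le h1n h4')
      have q3 := (map_sub_le_add (X.nrm (n + n)) ((bdiag 1 (v * u)).submatrix (blockSwap n) id)
        ((bdiag v u).submatrix (blockSwap n) id)).trans
        (add_le_add ((X.perm_left _ _).trans q2) ((X.perm_left _ _).trans q1))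
      refine (norm_conj_aux t (K := 2 * N) le_rfl le_rfl (d := 2 * (2 * N)) le_rfl (by linarith)
        q1 q2 (q3.trans (by linarith))).trans (by linarith)
  refine glHtpy_trans step1 ⟨bdiag 1 (v * u), 1, ?_⟩
  have hmem : ∀ {a b : Matrix (Fin (n + n)) (Fin (n + n)) U}, a ∈ X.mfilt (2 * r) _ →
      b ∈ X.mfilt (2 * r) _ → ∀ t : ℝ,
      ((1 - t : ℝ) : ℂ) • a + (t : ℂ) • b ∈ X.mfilt (2 * r) (n + n) := fun ha hb t =>
    add_mem_mfilt (smul_mem_mfilt _ ha) (smul_mem_mfilt _ hb)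
  have a0 : ∀ (t : ℝ) (x y : Matrix (Fin n) (Fin n) U),
      ((1 - t : ℝ) : ℂ) • bdiag x y + (t : ℂ) • (1 : Matrix (Fin (n + n)) (Fin (n + n)) U) =
      bdiag (((1 - t : ℝ) : ℂ) • x + (t : ℂ) • 1) (((1 - t : ℝ) : ℂ) • y + (t : ℂ) • 1) := by
    intro t x y
    rw [← bdiag_one]
    ext i j
    refine Fin.addCases (fun i => ?_) (fun i => ?_) i <;>
      refine Fin.addCases (fun j => ?_) (fun j => ?_) j <;> simp [-Fin.natAdd_eq_addNat]
  have a1 : ∀ t : ℝ, ((1 - t : ℝ) : ℂ) • (1 : Matrix (Fin n) (Fin n) U) + (t : ℂ) • 1 = 1 := by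
    intro t
    rw [← add_smul, ← Complex.ofReal_add, sub_add_cancel, Complex.ofReal_one, one_smul]
  have a2 : ∀ {t : ℝ}, t ∈ Set.Icc (0 : ℝ) 1 → ∀ {x : Matrix (Fin n) (Fin n) U},
      X.nrm n (x - 1) < ε → X.nrm n (((1 - t : ℝ) : ℂ) • x + (t : ℂ) • 1 - 1) < 4 * ε := by
    intro t ht x hx
    have := norm_convex (X := X) ht hx.le (le_of_eq (map_zero (X.nrm n)))
    have e : ((1 - t : ℝ) : ℂ) • x + (t : ℂ) • 1 - 1 =
        ((1 - t : ℝ) : ℂ) • (x - 1) + (t : ℂ) • (0 : Matrix (Fin n) (Fin n) U) := by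
      nth_rewrite 2 [← a1 t]
      rw [smul_sub, smul_zero]
      abel
    rw [e]
    refine this.trans_lt ?_
    nlinarith [ht.1, ht.2]
  have a3 : X.nrm n (1 - 1) < 4 * ε := by
    rw [sub_self, map_zero]
    linarith
  have a4 : X.nrm n 1 ≤ 4 * N := h1n.trans (by linarith)
  have a5 : ∀ {t : ℝ}, t ∈ Set.Icc (0 : ℝ) 1 → ∀ {x : Matrix (Fin n) (Fin n) U},
      X.nrm n x ≤ 2 * N → X.nrm n (((1 - t : ℝ) : ℂ) • x + (t : ℂ) • 1) ≤ 4 * N := by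
    intro t ht x hx
    have := norm_convex (X := X) ht hx h1n
    linarith
  refine JoinedIn.ofLine (f := fun t =>
    (((1 - t : ℝ) : ℂ) • bdiag (u * v) 1 + (t : ℂ) • 1,
      ((1 - t : ℝ) : ℂ) • bdiag 1 (v * u) + (t : ℂ) • 1)) ?_ (by simp) (by simp) ?_
  · exact ((continuous_segment _ _).prodMk (continuous_segment _ _)).continuousOn
  rintro _ ⟨t, ht, rfl⟩
  refine ⟨hmem (bdiag_mem_mfilt huvm hm2) (one_mem_mfilt (by linarith) _) t,
    hmem (bdiag_mem_mfilt hm2 hvum) (one_mem_mfilt (by linarith) _) t, ?_, ?_, ?_, ?_⟩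
  · simp only [a0, a1]
    rw [bdiag_mul, mul_one, one_mul, ← bdiag_one, bdiag_sub]
    exact (X.bdiag_le _ _).trans_lt (max_lt (a2 ht h3) (a2 ht h4))
  · simp only [a0, a1]
    rw [bdiag_mul, mul_one, one_mul, ← bdiag_one, bdiag_sub]
    exact (X.bdiag_le _ _).trans_lt (max_lt (a2 ht h3) (a2 ht h4))
  · simp only [a0, a1]
    exact (X.bdiag_le _ _).trans (max_le (a5 ht h3') a4)
  · simp only [a0, a1]
    exact (X.bdiag_le _ _).trans (max_le a4 (a5 ht h4'))

theorem exists_neg (X : QAlg p U) (P : Param) (a : (X.glSystem P).Cls) : ∃ b, b + a = 0 := by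
  obtain ⟨⟨n, u, v, huv⟩⟩ := a
  have hvu : (v, u) ∈ X.InvPair P.ε P.r P.N n :=
    ⟨huv.2.1, huv.1, huv.2.2.2.1, huv.2.2.1, huv.2.2.2.2.2, huv.2.2.2.2.1⟩
  refine ⟨Quotient.mk _ ⟨n, v, u, hvu⟩, Quotient.sound ⟨n + n, le_rfl, Nat.zero_le _, ?_⟩⟩
  have h := glHtpy_bdiag_inv P.ε_pos (P.ε_lt.le.trans (by norm_num)) P.r_pos P.one_le hvu
  have e : pad (X.glSystem P).d (n + n) (X.glSystem P).zeroElt.2.1 = 1 := by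
    ext i j
    simp [pad, StableSystem.zeroElt, glSystem, Matrix.one_apply]
  rw [e]
  change X.GLHtpy (4 * P.ε) (2 * P.r) (4 * P.N) (n + n) (pad 1 (n + n) (bdiag v u)) 1
  rw [pad_self]
  exact h

noncomputable instance (X : QAlg p U) (P : Param) : Neg (X.glSystem P).Cls :=
  ⟨fun a => Classical.choose (exists_neg X P a)⟩

/-- The group of stable homotopy classes of `(ε, r, N)`-invertibles. -/
noncomputable instance (X : QAlg p U) (P : Param) : AddCommGroup (X.glSystem P).Cls :=
  { (inferInstance : AddCommMonoid (X.glSystem P).Cls) with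
    neg := Neg.neg
    zsmul := zsmulRec
    neg_add_cancel := fun a => Classical.choose_spec (exists_neg X P a) }

/-- The quantitative `K`-group `K_i^{ε,r,N}` of a unital algebra. For `i = 0` it is the
Grothendieck group of the monoid of homotopy classes of `(ε, r, N)`-idempotents. -/
def KU (X : QAlg p U) (i : Fin 2) (P : Param) : Type _ :=
  match i with
  | 0 => Algebra.GrothendieckAddGroup (X.idemSystem P).Cls
  | 1 => (X.glSystem P).Cls

noncomputable instance (X : QAlg p U) (i : Fin 2) (P : Param) : AddCommGroup (X.KU i P) :=
  match i with
  | 0 => inferInstanceAs (AddCommGroup (Algebra.GrothendieckAddGroup (X.idemSystem P).Cls))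
  | 1 => inferInstanceAs (AddCommGroup (X.glSystem P).Cls)

variable {V : Type*} [Ring V] [Algebra ℂ V] {Y : QAlg p V}

/-- A filtered homomorphism whose amplifications to all matrix algebras have norm at most `c`. -/
structure Bdd (X : QAlg p U) (Y : QAlg p V) (φ : U →ₐ[ℂ] V) (c : ℝ) : Prop where
  one_le : 1 ≤ c
  bound : ∀ n (x : Matrix (Fin n) (Fin n) U), Y.nrm n (x.map φ) ≤ c * X.nrm n x
  filt : ∀ r, 0 < r → ∀ a ∈ X.filt r, φ a ∈ Y.filt r

/-- `(c ε, r, c N) ≤ (ε', r', N')`. -/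
structure Scaled (c : ℝ) (P Q : Param) : Prop where
  ε_le : c * P.ε ≤ Q.ε
  r_le : P.r ≤ Q.r
  N_le : c * P.N ≤ Q.N

theorem Bdd.idem {φ : U →ₐ[ℂ] V} {c : ℝ} (h : Bdd X Y φ c) {ε r N ε' r' N' : ℝ} (hr : 0 < r)
    (h1 : c * ε ≤ ε') (h2 : r ≤ r') (h3 : c * N ≤ N') {n : ℕ} {x : Matrix (Fin n) (Fin n) U}
    (hx : x ∈ X.Idem ε r N n) : x.map φ ∈ Y.Idem ε' r' N' n := by
  have hc : 0 < c := lt_of_lt_of_le one_pos h.one_le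
  obtain ⟨a1, a2, a3, a4⟩ := hx
  refine ⟨fun i j => Y.filt_mono h2 (h.filt r hr _ (a1 i j)), ?_, ?_, ?_⟩
  · have : x.map φ * x.map φ - x.map φ = (x * x - x).map φ := by
      rw [Matrix.map_sub φ (map_sub φ), Matrix.map_mul]
    rw [this]
    exact ((h.bound n _).trans_lt (mul_lt_mul_of_pos_left a2 hc)).trans_le h1
  · exact ((h.bound n _).trans (mul_le_mul_of_nonneg_left a3 hc.le)).trans h3
  · have : 1 - x.map φ = (1 - x).map φ := by
      rw [Matrix.map_sub φ (map_sub φ), Matrix.map_one φ (map_zero φ) (map_one φ)]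
    rw [this]
    exact ((h.bound n _).trans (mul_le_mul_of_nonneg_left a4 hc.le)).trans h3

theorem Bdd.invPair {φ : U →ₐ[ℂ] V} {c : ℝ} (h : Bdd X Y φ c) {ε r N ε' r' N' : ℝ} (hr : 0 < r)
    (h1 : c * ε ≤ ε') (h2 : r ≤ r') (h3 : c * N ≤ N') {n : ℕ} {x y : Matrix (Fin n) (Fin n) U}
    (hx : (x, y) ∈ X.InvPair ε r N n) : (x.map φ, y.map φ) ∈ Y.InvPair ε' r' N' n := by
  have hc : 0 < c := lt_of_lt_of_le one_pos h.one_le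
  obtain ⟨a1, a2, a3, a4, a5, a6⟩ := hx
  have key : ∀ x y : Matrix (Fin n) (Fin n) U, x.map φ * y.map φ - 1 = (x * y - 1).map φ := by
    intro x y
    rw [Matrix.map_sub φ (map_sub φ), Matrix.map_mul, Matrix.map_one φ (map_zero φ) (map_one φ)]
  refine ⟨fun i j => Y.filt_mono h2 (h.filt r hr _ (a1 i j)),
    fun i j => Y.filt_mono h2 (h.filt r hr _ (a2 i j)), ?_, ?_, ?_, ?_⟩
  · rw [key]
    exact ((h.bound n _).trans_lt (mul_lt_mul_of_pos_left a3 hc)).trans_le h1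
  · rw [key]
    exact ((h.bound n _).trans_lt (mul_lt_mul_of_pos_left a4 hc)).trans_le h1
  · exact ((h.bound n _).trans (mul_le_mul_of_nonneg_left a5 hc.le)).trans h3
  · exact ((h.bound n _).trans (mul_le_mul_of_nonneg_left a6 hc.le)).trans h3

theorem Bdd.continuous {φ : U →ₐ[ℂ] V} {c : ℝ} (h : Bdd X Y φ c) (n : ℕ) :
    @Continuous _ _ (X.topo n) (Y.topo n) fun x : Matrix (Fin n) (Fin n) U => x.map φ :=
  cont_of_bound _ c fun x y => by
    rw [← Matrix.map_sub φ (map_sub φ)]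
    exact h.bound n _

theorem Bdd.idemHtpy {φ : U →ₐ[ℂ] V} {c : ℝ} (h : Bdd X Y φ c) {ε r N ε' r' N' : ℝ} (hr : 0 < r)
    (h1 : c * ε ≤ ε') (h2 : r ≤ r') (h3 : c * N ≤ N') {n : ℕ} {x y : Matrix (Fin n) (Fin n) U}
    (hx : X.IdemHtpy ε r N n x y) : Y.IdemHtpy ε' r' N' n (x.map φ) (y.map φ) := by
  letI := X.topo n
  letI := Y.topo n
  refine (JoinedIn.map hx (h.continuous n)).mono ?_
  rintro _ ⟨a, ha, rfl⟩
  exact h.idem hr h1 h2 h3 ha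

theorem Bdd.glHtpy {φ : U →ₐ[ℂ] V} {c : ℝ} (h : Bdd X Y φ c) {ε r N ε' r' N' : ℝ} (hr : 0 < r)
    (h1 : c * ε ≤ ε') (h2 : r ≤ r') (h3 : c * N ≤ N') {n : ℕ} {x y : Matrix (Fin n) (Fin n) U}
    (hx : X.GLHtpy ε r N n x y) : Y.GLHtpy ε' r' N' n (x.map φ) (y.map φ) := by
  letI := X.topo n
  letI := Y.topo n
  obtain ⟨x', y', hx⟩ := hx
  refine ⟨x'.map φ, y'.map φ, (JoinedIn.map hx (f := fun w => (w.1.map φ, w.2.map φ))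
    (((h.continuous n).comp continuous_fst).prodMk ((h.continuous n).comp continuous_snd))).mono ?_⟩
  rintro _ ⟨a, ha, rfl⟩
  exact h.invPair hr h1 h2 h3 ha

section maps
variable {φ : U →ₐ[ℂ] V} {c : ℝ} (h : Bdd X Y φ c) {P Q : Param} (hPQ : Scaled c P Q)

/-- The map on classes of idempotents. -/
def idemMap : (X.idemSystem P).Cls →+ (Y.idemSystem Q).Cls :=
  StableSystem.mapCls (T := X.idemSystem P) (T' := Y.idemSystem Q) (φ : U →+* V) (map_zero φ)
    (fun hx => h.idem P.r_pos hPQ.ε_le hPQ.r_le hPQ.N_le hx)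
    (fun hx => h.idemHtpy P.r_pos
      (show c * (4 * P.ε) ≤ 4 * Q.ε by have := hPQ.ε_le; linarith) hPQ.r_le
      (show c * (4 * P.N) ≤ 4 * Q.N by have := hPQ.N_le; linarith) hx)

/-- The map on classes of invertibles. -/
def glMap : (X.glSystem P).Cls →+ (Y.glSystem Q).Cls :=
  StableSystem.mapCls (T := X.glSystem P) (T' := Y.glSystem Q) (φ : U →+* V) (map_one φ)
    (fun ⟨_, hx⟩ => ⟨_, h.invPair P.r_pos hPQ.ε_le hPQ.r_le hPQ.N_le hx⟩)
    (fun hx => h.glHtpy (show 0 < 2 * P.r by have := P.r_pos; linarith)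
      (show c * (4 * P.ε) ≤ 4 * Q.ε by have := hPQ.ε_le; linarith)
      (show 2 * P.r ≤ 2 * Q.r by have := hPQ.r_le; linarith)
      (show c * (4 * P.N) ≤ 4 * Q.N by have := hPQ.N_le; linarith) hx)

/-- The map `K_i^{ε,r,N}(U) → K_i^{ε',r',N'}(V)` induced by a homomorphism of bound `c`, whenever
`c ε ≤ ε'`, `r ≤ r'` and `c N ≤ N'`: it applies the homomorphism to the entries of matrices. -/
noncomputable def kuMap (i : Fin 2) : X.KU i P →+ Y.KU i Q :=
  match i with
  | 0 => Algebra.GrothendieckAddGroup.lift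
      (Algebra.GrothendieckAddGroup.of.comp (idemMap h hPQ))
  | 1 => glMap h hPQ

end maps

theorem bdd_id (X : QAlg p U) : Bdd X X (AlgHom.id ℂ U) 1 :=
  ⟨le_rfl, fun n x => by rw [one_mul]; exact le_of_eq (congrArg _ (by ext; simp)), fun _ _ _ h => h⟩

theorem Bdd.comp {W : Type*} [Ring W] [Algebra ℂ W] {Z : QAlg p W} {φ : U →ₐ[ℂ] V} {ψ : V →ₐ[ℂ] W}
    {c d : ℝ} (h : Bdd X Y φ c) (h' : Bdd Y Z ψ d) : Bdd X Z (ψ.comp φ) (d * c) := by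
  refine ⟨one_le_mul_of_one_le_of_one_le h'.one_le h.one_le, fun n x => ?_,
    fun r hr a ha => h'.filt r hr _ (h.filt r hr _ ha)⟩
  have : x.map (ψ.comp φ) = (x.map φ).map ψ := by
    ext
    simp
  rw [this, mul_assoc]
  exact (h'.bound n _).trans (mul_le_mul_of_nonneg_left (h.bound n x)
    (zero_le_one.trans h'.one_le))

theorem kuMap_id {c : ℝ} (h : Bdd X X (AlgHom.id ℂ U) c) {P : Param} (hP : Scaled c P P)
    (i : Fin 2) (x : X.KU i P) : kuMap h hP i x = x := by
  have key : ∀ {T : StableSystem U} (hd) (hS) (hH) (x : T.Cls), StableSystem.mapCls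
      (T := T) (T' := T) ((AlgHom.id ℂ U : U →ₐ[ℂ] U) : U →+* U) hd hS hH x = x := by
    rintro T hd hS hH ⟨n, x, hx⟩
    refine congrArg (Quotient.mk _) ?_
    refine Sigma.ext rfl (heq_of_eq (Subtype.ext ?_))
    ext
    simp
  match i with
  | 0 =>
    have : kuMap h hP 0 = AddMonoidHom.id _ := by
      refine Algebra.GrothendieckAddGroup.lift.symm.injective ?_
      refine (Algebra.GrothendieckAddGroup.lift.symm_apply_apply _).trans ?_
      ext y
      exact congrArg Algebra.GrothendieckAddGroup.of (key _ _ _ y)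
    rw [this]
    rfl
  | 1 =>
    obtain ⟨n, x, hx⟩ := x
    refine congrArg (Quotient.mk _) ?_
    refine Sigma.ext rfl (heq_of_eq (Subtype.ext ?_))
    ext
    simp

theorem kuMap_comp {W : Type*} [Ring W] [Algebra ℂ W] {Z : QAlg p W} {φ : U →ₐ[ℂ] V}
    {ψ : V →ₐ[ℂ] W} {χ : U →ₐ[ℂ] W} (hχ : ∀ x, χ x = ψ (φ x)) {c d e : ℝ} (h : Bdd X Y φ c)
    (h' : Bdd Y Z ψ d) (h'' : Bdd X Z χ e) {P Q R : Param} (hP : Scaled c P Q) (hQ : Scaled d Q R)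
    (hR : Scaled e P R) (i : Fin 2) (x : X.KU i P) :
    kuMap h' hQ i (kuMap h hP i x) = kuMap h'' hR i x := by
  match i with
  | 0 =>
    have : (kuMap h' hQ 0).comp (kuMap h hP 0) = kuMap h'' hR 0 := by
      refine Algebra.GrothendieckAddGroup.lift.symm.injective ?_
      refine Eq.trans ?_ (Algebra.GrothendieckAddGroup.lift.symm_apply_apply _).symm
      ext y
      have e1 := DFunLike.congr_fun (Algebra.GrothendieckAddGroup.lift.symm_apply_apply
        (Algebra.GrothendieckAddGroup.of.comp (idemMap h hP))) y
      have e2 := fun y => DFunLike.congr_fun (Algebra.GrothendieckAddGroup.lift.symm_apply_apply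
        (Algebra.GrothendieckAddGroup.of.comp (idemMap h' hQ))) y
      refine (congrArg (kuMap h' hQ 0) e1).trans ((e2 _).trans ?_)
      refine congrArg (Algebra.GrothendieckAddGroup.of (M := (Z.idemSystem R).Cls))
        (a₁ := idemMap h' hQ (idemMap h hP y)) (a₂ := idemMap h'' hR y) ?_
      obtain ⟨n, y, hy⟩ := y
      refine congrArg (Quotient.mk _) ?_
      refine Sigma.ext rfl (heq_of_eq (Subtype.ext ?_))
      ext
      simp [hχ]
    exact DFunLike.congr_fun this x
  | 1 =>
    obtain ⟨n, x, hx⟩ := x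
    refine congrArg (Quotient.mk _) ?_
    refine Sigma.ext rfl (heq_of_eq (Subtype.ext ?_))
    ext
    simp [hχ]

end QAlg
end QK

namespace QK

open scoped ENNReal

/-- Control pairs `(λ, h)`. Only the values `lam N` and `h ε N` for `N ≥ 1` and `ε > 0` matter. -/
structure ControlPair where
  lam : ℝ → ℝ
  h : ℝ → ℝ → ℝ
  one_le_lam : ∀ N, 1 ≤ N → 1 ≤ lam N
  lam_mono : ∀ N N', 1 ≤ N → N ≤ N' → lam N ≤ lam N'
  one_le_h : ∀ ε N, 0 < ε → 1 ≤ N → 1 ≤ h ε N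
  h_anti : ∀ ε ε' N, 0 < ε → ε ≤ ε' → 1 ≤ N → h ε' N ≤ h ε N

namespace ControlPair

instance : LE ControlPair where
  le c c' := ∀ ε N, 0 < ε → ε < 1 / 20 → 1 ≤ N → c.lam N ≤ c'.lam N ∧ c.h ε N ≤ c'.h ε N

/-- The pair `(λ' · λ, h' · h)` of a composition; `c` is the pair of the map applied first. -/
def comp (c' c : ControlPair) : ControlPair where
  lam N := c'.lam (c.lam N) * c.lam N
  h ε N := c'.h (c.lam N * ε) (c.lam N) * c.h ε N
  one_le_lam N hN := one_le_mul_of_one_le_of_one_le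
    (c'.one_le_lam _ (c.one_le_lam N hN)) (c.one_le_lam N hN)
  lam_mono N N' hN h := mul_le_mul
    (c'.lam_mono _ _ (c.one_le_lam N hN) (c.lam_mono N N' hN h)) (c.lam_mono N N' hN h)
    (zero_le_one.trans (c.one_le_lam N hN))
    (zero_le_one.trans (c'.one_le_lam _ (c.one_le_lam N' (hN.trans h))))
  one_le_h ε N hε hN := one_le_mul_of_one_le_of_one_le
    (c'.one_le_h _ _ (mul_pos (zero_lt_one.trans_le (c.one_le_lam N hN)) hε) (c.one_le_lam N hN))
    (c.one_le_h ε N hε hN)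
  h_anti ε ε' N hε h hN := by
    have h1 := c.one_le_lam N hN
    have h0 : 0 < c.lam N := zero_lt_one.trans_le h1
    exact mul_le_mul (c'.h_anti _ _ _ (mul_pos h0 hε) (mul_le_mul_of_nonneg_left h h0.le) h1)
      (c.h_anti ε ε' N hε h hN) (zero_le_one.trans (c.one_le_h ε' N (hε.trans_le h) hN))
      (zero_le_one.trans (c'.one_le_h _ _ (mul_pos h0 hε) h1))

/-- The condition `ε < 1 / (20 λ_N)`. -/
def Adm (c : ControlPair) (P : Param) : Prop := P.ε < 1 / (20 * c.lam P.N)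

theorem lam_pos (c : ControlPair) (P : Param) : 0 < c.lam P.N :=
  zero_lt_one.trans_le (c.one_le_lam _ P.one_le)

theorem adm_iff (c : ControlPair) (P : Param) : c.Adm P ↔ c.lam P.N * P.ε < 1 / 20 := by
  have := c.lam_pos P
  rw [Adm, lt_div_iff₀ (by linarith), lt_div_iff₀ (by norm_num)]
  constructor <;> intro h <;> linarith

/-- The parameters `(λ_N ε, h_{ε,N} r, λ_N)`. -/
def act (c : ControlPair) (P : Param) (hP : c.Adm P) : Param where
  ε := c.lam P.N * P.ε
  r := c.h P.ε P.N * P.r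
  N := c.lam P.N
  ε_pos := mul_pos (c.lam_pos P) P.ε_pos
  ε_lt := (c.adm_iff P).1 hP
  r_pos := mul_pos (zero_lt_one.trans_le (c.one_le_h _ _ P.ε_pos P.one_le)) P.r_pos
  one_le := c.one_le_lam _ P.one_le

theorem act_le_act (c : ControlPair) {P Q : Param} (hP : c.Adm P) (hQ : c.Adm Q) (hPQ : P ≤ Q)
    (hr : c.h P.ε P.N * P.r ≤ c.h Q.ε Q.N * Q.r) : c.act P hP ≤ c.act Q hQ := by
  have := c.lam_mono _ _ P.one_le hPQ.2.2
  exact ⟨mul_le_mul this hPQ.1 P.ε_pos.le (c.lam_pos Q).le, hr, this⟩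

theorem adm_of_le {c c' : ControlPair} (hc : c ≤ c') {P : Param} (hP : c'.Adm P) : c.Adm P := by
  rw [adm_iff] at *
  exact (mul_le_mul_of_nonneg_right (hc _ _ P.ε_pos P.ε_lt P.one_le).1 P.ε_pos.le).trans_lt hP

theorem act_le_of_le {c c' : ControlPair} (hc : c ≤ c') {P : Param} (hP : c'.Adm P) :
    c.act P (adm_of_le hc hP) ≤ c'.act P hP := by
  have := hc _ _ P.ε_pos P.ε_lt P.one_le
  exact ⟨mul_le_mul_of_nonneg_right this.1 P.ε_pos.le,
    mul_le_mul_of_nonneg_right this.2 P.r_pos.le, this.1⟩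

theorem adm_of_comp {c' c : ControlPair} {P : Param} (hP : (c'.comp c).Adm P) : c.Adm P := by
  rw [adm_iff] at *
  have h1 := c'.one_le_lam _ (c.one_le_lam _ P.one_le)
  have h2 := mul_pos (c.lam_pos P) P.ε_pos
  have : c'.lam (c.lam P.N) * (c.lam P.N * P.ε) < 1 / 20 := by
    rw [← mul_assoc]
    exact hP
  nlinarith

theorem adm_act_of_comp {c' c : ControlPair} {P : Param} (hP : (c'.comp c).Adm P) :
    c'.Adm (c.act P (adm_of_comp hP)) := by
  rw [adm_iff] at *
  have : c'.lam (c.lam P.N) * (c.lam P.N * P.ε) < 1 / 20 := by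
    rw [← mul_assoc]
    exact hP
  exact this

theorem act_act_le {c' c : ControlPair} {P : Param} (hP : (c'.comp c).Adm P) :
    c'.act (c.act P (adm_of_comp hP)) (adm_act_of_comp hP) ≤ (c'.comp c).act P hP := by
  refine ⟨(mul_assoc _ _ _).ge, (mul_assoc _ _ _).ge, ?_⟩
  exact le_mul_of_one_le_right (zero_le_one.trans (c'.one_le_lam _ (c.one_le_lam _ P.one_le)))
    (c.one_le_lam _ P.one_le)

/-- The constant control pair `(1, 1)`. -/
def one : ControlPair where
  lam _ := 1
  h _ _ := 1
  one_le_lam _ _ := le_rfl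
  lam_mono _ _ _ _ := le_rfl
  one_le_h _ _ _ _ := le_rfl
  h_anti _ _ _ _ _ _ := le_rfl

/-- The control pair `(C N, 1)`. -/
def scal (C : ℝ) (hC : 1 ≤ C) : ControlPair where
  lam N := C * N
  h _ _ := 1
  one_le_lam _ hN := one_le_mul_of_one_le_of_one_le hC hN
  lam_mono _ _ _ h := mul_le_mul_of_nonneg_left h (zero_le_one.trans hC)
  one_le_h _ _ _ _ := le_rfl
  h_anti _ _ _ _ _ _ := le_rfl

end ControlPair

universe u v w

/-- A family of abelian groups indexed by the parameters `(ε, r, N)`, with relaxation maps. -/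
structure QFam where
  G : Param → Type u
  grp : ∀ P, AddCommGroup (G P)
  relax : ∀ {P Q : Param}, P ≤ Q → G P →+ G Q
  relax_refl : ∀ {P} (h : P ≤ P) (x : G P), relax h x = x
  relax_trans : ∀ {P Q R} (h : P ≤ Q) (h' : Q ≤ R) (h'' : P ≤ R) (x : G P),
    relax h' (relax h x) = relax h'' x

attribute [instance] QFam.grp

namespace QFam

/-- The zero family. -/
def zero : QFam.{0} where
  G _ := Unit
  grp _ := inferInstance
  relax _ := 0
  relax_refl _ _ := rfl
  relax_trans _ _ _ _ := rfl

/-- The direct sum of two families. -/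
def prod (F : QFam.{u}) (G : QFam.{v}) : QFam.{max u v} where
  G P := F.G P × G.G P
  grp _ := inferInstance
  relax h := (F.relax h).prodMap (G.relax h)
  relax_refl h _ := Prod.ext (F.relax_refl h _) (G.relax_refl h _)
  relax_trans h h' h'' _ := Prod.ext (F.relax_trans h h' h'' _) (G.relax_trans h h' h'' _)

end QFam

/-- A family of homomorphisms `F^{ε,r,N} → G^{λ_N ε, h_{ε,N} r, λ_N}` for `ε < 1 / (20 λ_N)`. -/
structure CFam (c : ControlPair) (F : QFam.{u}) (G : QFam.{v}) where
  map : ∀ P (hP : c.Adm P), F.G P →+ G.G (c.act P hP)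

/-- A controlled morphism: a family as above which is compatible with the relaxation maps. -/
structure CMor (c : ControlPair) (F : QFam.{u}) (G : QFam.{v}) extends CFam c F G where
  comm : ∀ P Q (hP : c.Adm P) (hQ : c.Adm Q) (hPQ : P ≤ Q)
    (hr : c.h P.ε P.N * P.r ≤ c.h Q.ε Q.N * Q.r) (x : F.G P),
    G.relax (c.act_le_act hP hQ hPQ hr) (map P hP x) = map Q hQ (F.relax hPQ x)

section morphisms

variable {F : QFam.{u}} {G : QFam.{v}} {H : QFam.{w}}

/-- Composition of families. The composite of the maps takes values in
`H^{λ'_{λ_N} λ_N ε, h'_{λ_N ε, λ_N} h_{ε,N} r, λ'_{λ_N}}`, which is relaxed to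
`H^{(λ'·λ)_N ε, (h'·h)_{ε,N} r, (λ'·λ)_N}`. -/
def CFam.comp {c' c : ControlPair} (B : CFam c' G H) (A : CFam c F G) : CFam (c'.comp c) F H where
  map P hP := (H.relax (ControlPair.act_act_le hP)).comp
    ((B.map _ (ControlPair.adm_act_of_comp hP)).comp (A.map P (ControlPair.adm_of_comp hP)))

/-- The relation `A ∼ B` with respect to the control pair `c`. -/
def CFam.Equiv (c : ControlPair) {c₁ c₂ : ControlPair} (A : CFam c₁ F G) (B : CFam c₂ F G) :
    Prop :=
  ∃ (h₁ : c₁ ≤ c) (h₂ : c₂ ≤ c), ∀ P (hP : c.Adm P) (x : F.G P),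
    G.relax (ControlPair.act_le_of_le h₁ hP) (A.map P (ControlPair.adm_of_le h₁ hP) x) =
      G.relax (ControlPair.act_le_of_le h₂ hP) (B.map P (ControlPair.adm_of_le h₂ hP) x)

namespace CMor

theorem id_le (P : Param) (hP : (ControlPair.scal 1 le_rfl).Adm P) :
    P ≤ (ControlPair.scal 1 le_rfl).act P hP := by
  refine ⟨?_, (one_mul P.r).ge, (one_mul P.N).ge⟩
  change P.ε ≤ 1 * P.N * P.ε
  have := mul_le_mul_of_nonneg_right P.one_le P.ε_pos.le
  linarith

/-- The identity morphism. Its control pair is `λ_N = N`, `h = 1`, so that in degree `(ε, r, N)` it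
is the relaxation map to degree `(N ε, r, N)`. -/
def idMor (F : QFam.{u}) : CMor (ControlPair.scal 1 le_rfl) F F where
  map P hP := F.relax (id_le P hP)
  comm P Q hP hQ hPQ _ _ := by
    rw [F.relax_trans _ _ (hPQ.trans (id_le Q hQ)), F.relax_trans]

/-- The zero morphism. -/
def zeroMor (F : QFam.{u}) (G : QFam.{v}) : CMor ControlPair.one F G where
  map _ _ := 0
  comm _ _ _ _ _ _ _ := by simp

/-- The morphism `(x, y) ↦ A x + B y`. -/
def coprod {c : ControlPair} (A : CMor c F H) (B : CMor c G H) : CMor c (F.prod G) H where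
  map P hP := (A.map P hP).coprod (B.map P hP)
  comm P Q hP hQ hPQ hr x := by
    have h1 := A.comm P Q hP hQ hPQ hr x.1
    have h2 := B.comm P Q hP hQ hPQ hr x.2
    change H.relax _ (A.map P hP x.1 + B.map P hP x.2) = _
    rw [map_add, h1, h2]
    rfl

/-- `A` is a `c`-isomorphism: it has a two-sided inverse up to the control pair `c`. -/
def IsIso (c : ControlPair) {c₁ : ControlPair} (A : CMor c₁ F G) : Prop :=
  c₁ ≤ c ∧ ∃ (c₂ : ControlPair) (B : CMor c₂ G F),
    CFam.Equiv c (B.toCFam.comp A.toCFam) (idMor F).toCFam ∧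
    CFam.Equiv c (A.toCFam.comp B.toCFam) (idMor G).toCFam

/-- The composition `F → G → H` of `A` and `B` is `c`-exact at `G`: the composite of `A` and `B` is
zero, and every `y` with `B y = 0` comes from `F` after relaxing control by `c`. -/
def Exact (c : ControlPair) {c₁ c₂ : ControlPair} (A : CMor c₁ F G) (B : CMor c₂ G H) : Prop :=
  (∀ P (hP : (c₂.comp c₁).Adm P) (x : F.G P),
    B.map _ (ControlPair.adm_act_of_comp hP) (A.map P (ControlPair.adm_of_comp hP) x) = 0) ∧
  ∀ P (h₁ : (c₁.comp c).Adm P) (h₂ : c₂.Adm P) (y : G.G P), B.map P h₂ y = 0 →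
    ∃ (x : F.G (c.act P (ControlPair.adm_of_comp h₁))) (hle : P ≤ (c₁.comp c).act P h₁),
      G.relax (ControlPair.act_act_le h₁) (A.map _ (ControlPair.adm_act_of_comp h₁) x) =
        G.relax hle y

end CMor
end morphisms

/-! ### Quantitative K-theory of a filtered algebra through its unitization -/

theorem cNorm_add_le (p : ℝ≥0∞) [Fact (1 ≤ p)] {n : ℕ} (z w : Matrix (Fin n) (Fin n) ℂ) :
    cNorm p (z + w) ≤ cNorm p z + cNorm p w := by
  rw [cNorm, cNorm, cNorm, opNorm, opNorm, opNorm]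
  refine le_trans (le_of_eq (congrArg _ ?_)) (norm_add_le _ _)
  refine Eq.trans (congrArg _ ?_) (map_add (matCLMₗ p) _ _)
  ext
  simp

theorem cNorm_smul (p : ℝ≥0∞) [Fact (1 ≤ p)] {n : ℕ} (c : ℂ) (z : Matrix (Fin n) (Fin n) ℂ) :
    cNorm p (c • z) = ‖c‖ * cNorm p z := by
  rw [cNorm, cNorm, opNorm, opNorm, ← norm_smul]
  refine congrArg _ (Eq.trans (congrArg _ ?_) (map_smul (matCLMₗ p) _ _))
  ext
  simp

theorem cNorm_mul_le (p : ℝ≥0∞) [Fact (1 ≤ p)] {n : ℕ} (z w : Matrix (Fin n) (Fin n) ℂ) :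
    cNorm p (z * w) ≤ cNorm p z * cNorm p w := by
  rw [cNorm, cNorm, cNorm]
  refine le_trans (le_of_eq (congrArg _ ?_)) (opNorm_mul_le p _ _)
  ext
  simp [Matrix.mul_apply, mul_comm]

theorem cNorm_bdiag_le (p : ℝ≥0∞) [Fact (1 ≤ p)] (hp : p ≠ ⊤) {n m : ℕ}
    (z : Matrix (Fin n) (Fin n) ℂ) (w : Matrix (Fin m) (Fin m) ℂ) :
    cNorm p (bdiag z w) ≤ max (cNorm p z) (cNorm p w) := by
  rw [cNorm, cNorm, cNorm]
  refine le_trans (le_of_eq (congrArg _ ?_)) (opNorm_bdiag_le p hp _ _)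
  ext i j
  refine Fin.addCases (fun i => ?_) (fun i => ?_) i <;>
    refine Fin.addCases (fun j => ?_) (fun j => ?_) j <;> simp

/-- `ℂ` with the norms `M_n(ℂ) = B(ℓ_p^n)`. -/
noncomputable def cAlg (p : ℝ≥0∞) [Fact (1 ≤ p)] [Fact (p ≠ ⊤)] : QAlg p ℂ where
  nrm n := Seminorm.of (cNorm p (n := n)) (cNorm_add_le p) (cNorm_smul p)
  mul_le z w := cNorm_mul_le p z w
  perm_left σ z := opNorm_perm_left p σ (z.map fun c => c • ContinuousLinearMap.id ℂ ℂ)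
  perm_right σ z := opNorm_perm_right p σ (z.map fun c => c • ContinuousLinearMap.id ℂ ℂ)
  bdiag_le z w := cNorm_bdiag_le p Fact.out z w
  scalar_le z := le_of_eq (congrArg (cNorm p) (by ext; simp))
  filt _ := ⊤
  filt_mono _ := le_rfl
  filt_mul _ _ _ _ _ _ := trivial
  filt_one _ := trivial

section FAlg

variable (p : ℝ≥0∞) [Fact (1 ≤ p)] [Fact (p ≠ ⊤)]

/-- A complex algebra `A` (with or without unit) together with norms on the matrix algebras over
its unitization `A⁺` and a filtration of `A⁺`, such that the augmentation `A⁺ → ℂ` is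
`p`-completely contractive. -/
structure FAlg (A : Type*) [NonUnitalRing A] [Module ℂ A] [IsScalarTower ℂ A A]
    [SMulCommClass ℂ A A] where
  toQ : QAlg p (Unitization ℂ A)
  aug : QAlg.Bdd toQ (cAlg p) (Unitization.fstHom ℂ A) 1

variable {p}
variable {A : Type*} [NonUnitalRing A] [Module ℂ A] [IsScalarTower ℂ A A] [SMulCommClass ℂ A A]
variable {B : Type*} [NonUnitalRing B] [Module ℂ B] [IsScalarTower ℂ B B] [SMulCommClass ℂ B B]

theorem scaled_one {P Q : Param} (h : P ≤ Q) : QAlg.Scaled 1 P Q :=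
  ⟨by rw [one_mul]; exact h.1, h.2.1, by rw [one_mul]; exact h.2.2⟩

namespace FAlg

/-- `K_i^{ε,r,N}(A)`, the kernel of `K_i^{ε,r,N}(A⁺) → K_i^{ε,r,N}(ℂ)`. -/
noncomputable def K (X : FAlg p A) (i : Fin 2) (P : Param) : AddSubgroup (X.toQ.KU i P) :=
  (QAlg.kuMap X.aug (scaled_one (le_refl P)) i).ker

variable {X : FAlg p A} {Y : FAlg p B}

theorem mem_K_of_bdd {φ : Unitization ℂ A →ₐ[ℂ] Unitization ℂ B}
    (hφ : ∀ x, (φ x).fst = x.fst) {c : ℝ} (h : QAlg.Bdd X.toQ Y.toQ φ c) {P Q : Param}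
    (hPQ : QAlg.Scaled c P Q) {i : Fin 2} {x : X.toQ.KU i P} (hx : x ∈ X.K i P) :
    QAlg.kuMap h hPQ i x ∈ Y.K i Q := by
  have hPQ' : P ≤ Q := by
    have h1 := mul_le_mul_of_nonneg_right h.one_le P.ε_pos.le
    have h2 := mul_le_mul_of_nonneg_right h.one_le (zero_le_one.trans P.one_le)
    have h3 := hPQ.ε_le
    have h4 := hPQ.N_le
    exact ⟨by linarith, hPQ.r_le, by linarith⟩
  have hid := QAlg.bdd_id (cAlg p)
  have hx' : QAlg.kuMap X.aug (scaled_one (le_refl P)) i x = 0 := hx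
  have hb : QAlg.Bdd X.toQ (cAlg p) (Unitization.fstHom ℂ A) 1 := X.aug
  change QAlg.kuMap Y.aug (scaled_one (le_refl Q)) i (QAlg.kuMap h hPQ i x) = 0
  have e1 := QAlg.kuMap_comp (χ := (Unitization.fstHom ℂ B).comp φ) (fun _ => rfl) h Y.aug
    (h.comp Y.aug) hPQ (scaled_one (le_refl Q))
    ⟨by rw [one_mul]; exact hPQ.ε_le, hPQ.r_le, by rw [one_mul]; exact hPQ.N_le⟩ i x
  have e2 := QAlg.kuMap_comp (χ := (Unitization.fstHom ℂ B).comp φ)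
    (ψ := AlgHom.id ℂ ℂ) (φ := Unitization.fstHom ℂ A) (fun y => hφ y) hb hid
    (h.comp Y.aug) (scaled_one (le_refl P)) (scaled_one hPQ')
    ⟨by rw [one_mul]; exact hPQ.ε_le, hPQ.r_le, by rw [one_mul]; exact hPQ.N_le⟩ i x
  rw [e1, ← e2, hx', map_zero]

/-- The map `K_i^{ε,r,N}(A) → K_i^{ε',r',N'}(B)` induced by a homomorphism `A⁺ → B⁺`. -/
noncomputable def kMap {φ : Unitization ℂ A →ₐ[ℂ] Unitization ℂ B}
    (hφ : ∀ x, (φ x).fst = x.fst) {c : ℝ} (h : QAlg.Bdd X.toQ Y.toQ φ c) {P Q : Param}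
    (hPQ : QAlg.Scaled c P Q) (i : Fin 2) : X.K i P →+ Y.K i Q :=
  ((QAlg.kuMap h hPQ i).comp (X.K i P).subtype).codRestrict _ fun x => mem_K_of_bdd hφ h hPQ x.2

/-- The family `𝒦_i(A) = (K_i^{ε,r,N}(A))`; the relaxation maps are induced by the identity. -/
noncomputable def fam (X : FAlg p A) (i : Fin 2) : QFam where
  G P := X.K i P
  grp _ := inferInstance
  relax h := kMap (fun _ => rfl) (QAlg.bdd_id X.toQ) (scaled_one h) i
  relax_refl _ x := Subtype.ext (QAlg.kuMap_id _ _ i x.1)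
  relax_trans _ _ _ x := Subtype.ext (QAlg.kuMap_comp (fun _ => rfl) _ _ _ _ _ _ i x.1)

/-- The unital extension `φ⁺ : A⁺ → B⁺` of a homomorphism. -/
def plus (φ : A →ₙₐ[ℂ] B) : Unitization ℂ A →ₐ[ℂ] Unitization ℂ B :=
  Unitization.lift ((Unitization.inrNonUnitalAlgHom ℂ B).comp φ)

theorem plus_apply (φ : A →ₙₐ[ℂ] B) (x : Unitization ℂ A) :
    plus φ x = Unitization.inl x.fst + Unitization.inr (φ x.snd) := by
  rfl

theorem plus_fst (φ : A →ₙₐ[ℂ] B) (x : Unitization ℂ A) : (plus φ x).fst = x.fst := by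
  rw [plus_apply]
  simp

theorem scaled_act {C : ℝ} (hC : 1 ≤ C) {P : Param} (hP : (ControlPair.scal C hC).Adm P) :
    QAlg.Scaled C P ((ControlPair.scal C hC).act P hP) := by
  refine ⟨?_, (one_mul P.r).ge, le_refl (C * P.N)⟩
  change C * P.ε ≤ C * P.N * P.ε
  have h1 := mul_le_mul_of_nonneg_right P.one_le P.ε_pos.le
  have := mul_le_mul_of_nonneg_left h1 (zero_le_one.trans hC)
  linarith

/-- The controlled morphism `φ_* : 𝒦_i(A) → 𝒦_i(B)`, for a homomorphism `φ` such that `φ⁺` is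
filtered and its amplifications to matrices are bounded by `C`. -/
noncomputable def induced (φ : A →ₙₐ[ℂ] B) {C : ℝ} (h : QAlg.Bdd X.toQ Y.toQ (plus φ) C)
    (i : Fin 2) : CMor (ControlPair.scal C h.one_le) (X.fam i) (Y.fam i) where
  map _ hP := kMap (plus_fst φ) h (scaled_act h.one_le hP) i
  comm P Q hP hQ hPQ hr x := by
    have hs : QAlg.Scaled C P ((ControlPair.scal C h.one_le).act Q hQ) := by
      have h1 := scaled_act h.one_le hP
      have h2 := (ControlPair.scal C h.one_le).act_le_act hP hQ hPQ hr
      exact ⟨h1.ε_le.trans h2.1, h1.r_le.trans h2.2.1, h1.N_le.trans h2.2.2⟩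
    refine Subtype.ext ?_
    exact (QAlg.kuMap_comp (χ := plus φ) (fun _ => rfl) _ _ h _ _ hs i x.1).trans
      (QAlg.kuMap_comp (χ := plus φ) (fun _ => rfl) _ _ h _ _ hs i x.1).symm

end FAlg
end FAlg
end QK

namespace QK

open scoped ENNReal

universe u v

section SQp

variable (p : ℝ≥0∞) [Fact (1 ≤ p)]

/-- The class `SQ_p`: Banach spaces isometric to a subspace of a quotient of some space
`L_p(Ω, μ)`. -/
def IsSQp (E : Type u) [NormedAddCommGroup E] [NormedSpace ℂ E] : Prop :=
  ∃ (Ω : Type u) (_ : MeasurableSpace Ω) (μ : MeasureTheory.Measure Ω)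
    (S : Submodule ℂ (MeasureTheory.Lp ℂ p μ)),
    IsClosed (S : Set (MeasureTheory.Lp ℂ p μ)) ∧
      Nonempty (E →ₗᵢ[ℂ] (MeasureTheory.Lp ℂ p μ ⧸ S))

/-- Complex matrices act on `ℓ_p^n(E)` with norm at most their norm on `ℓ_p^n`. -/
def ScalarBound (E : Type*) [SeminormedAddCommGroup E] [NormedSpace ℂ E] : Prop :=
  ∀ (n : ℕ) (z : Matrix (Fin n) (Fin n) ℂ) (v : Fin n → E),
    ∑ i, ‖∑ j, z i j • v j‖ ^ p.toReal ≤ cNorm p z ^ p.toReal * ∑ i, ‖v i‖ ^ p.toReal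

theorem cNorm_nonneg {n : ℕ} (z : Matrix (Fin n) (Fin n) ℂ) : 0 ≤ cNorm p z := norm_nonneg _

theorem toReal_pos [Fact (p ≠ ⊤)] : 0 < p.toReal :=
  ENNReal.toReal_pos (zero_lt_one.trans_le (Fact.out : 1 ≤ p)).ne' Fact.out

theorem lp_enorm_rpow [Fact (p ≠ ⊤)] {Ω : Type*} [MeasurableSpace Ω] (μ : MeasureTheory.Measure Ω)
    (f : MeasureTheory.Lp ℂ p μ) : ‖f‖ₑ ^ p.toReal = ∫⁻ a, ‖f a‖ₑ ^ p.toReal ∂μ := by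
  rw [MeasureTheory.Lp.enorm_def, MeasureTheory.eLpNorm_eq_lintegral_rpow_enorm_toReal
    (zero_lt_one.trans_le (Fact.out : 1 ≤ p)).ne' Fact.out, ← ENNReal.rpow_mul,
    one_div_mul_cancel (toReal_pos p).ne', ENNReal.rpow_one]

theorem lp_coeFn_sum {Ω : Type*} [MeasurableSpace Ω] (μ : MeasureTheory.Measure Ω) {n : ℕ}
    (c : Fin n → ℂ) (v : Fin n → MeasureTheory.Lp ℂ p μ) (s : Finset (Fin n)) :
    (∑ j ∈ s, c j • v j : MeasureTheory.Lp ℂ p μ) =ᵐ[μ] fun a => ∑ j ∈ s, c j * v j a := by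
  induction s using Finset.induction_on with
  | empty =>
    simp only [Finset.sum_empty]
    exact MeasureTheory.Lp.coeFn_zero _ _ _
  | insert i s hi ih =>
    simp only [Finset.sum_insert hi]
    filter_upwards [ih, MeasureTheory.Lp.coeFn_add (c i • v i) (∑ j ∈ s, c j • v j),
      MeasureTheory.Lp.coeFn_smul (c i) (v i)] with a h1 h2 h3
    rw [h2, Pi.add_apply, h1, h3]
    rfl

theorem ofReal_norm_rpow [Fact (p ≠ ⊤)] {E : Type*} [SeminormedAddCommGroup E] (x : E) :
    ENNReal.ofReal (‖x‖ ^ p.toReal) = ‖x‖ₑ ^ p.toReal := by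
  rw [← ENNReal.ofReal_rpow_of_nonneg (norm_nonneg _) (toReal_pos p).le, ofReal_norm]

theorem scalarBound_lp [Fact (p ≠ ⊤)] {Ω : Type*} [MeasurableSpace Ω]
    (μ : MeasureTheory.Measure Ω) : ScalarBound p (MeasureTheory.Lp ℂ p μ) := by
  intro n z v
  have hC := cNorm_nonneg p z
  have h0 : ∀ x : ℝ, 0 ≤ x → 0 ≤ x ^ p.toReal := fun x hx => Real.rpow_nonneg hx _
  rw [← ENNReal.ofReal_le_ofReal_iff (mul_nonneg (h0 _ hC)
    (Finset.sum_nonneg fun i _ => h0 _ (norm_nonneg _))), ENNReal.ofReal_mul (h0 _ hC),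
    ENNReal.ofReal_sum_of_nonneg (fun i _ => h0 _ (norm_nonneg _)),
    ENNReal.ofReal_sum_of_nonneg (fun i _ => h0 _ (norm_nonneg _))]
  simp only [ofReal_norm_rpow, lp_enorm_rpow]
  have hm : ∀ f : MeasureTheory.Lp ℂ p μ, AEMeasurable (fun a => ‖f a‖ₑ ^ p.toReal) μ := fun f =>
    (MeasureTheory.Lp.aestronglyMeasurable f).enorm.pow_const _
  rw [← MeasureTheory.lintegral_finsetSum' _ (fun i _ => hm _),
    ← MeasureTheory.lintegral_finsetSum' _ (fun i _ => hm _),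
    ← MeasureTheory.lintegral_const_mul' _ _ ENNReal.ofReal_ne_top]
  refine MeasureTheory.lintegral_mono_ae ?_
  have hae : ∀ᵐ a ∂μ, ∀ i, (∑ j, z i j • v j : MeasureTheory.Lp ℂ p μ) a = ∑ j, z i j * v j a :=
    MeasureTheory.ae_all_iff.2 fun i => lp_coeFn_sum p μ (z i) v Finset.univ
  filter_upwards [hae] with a ha
  simp only [ha]
  have := (cNorm_le_iff p Fact.out z hC).1 le_rfl fun j => v j a
  have := ENNReal.ofReal_le_ofReal this
  rw [ENNReal.ofReal_mul (h0 _ hC),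
    ENNReal.ofReal_sum_of_nonneg (fun i _ => h0 _ (norm_nonneg _)),
    ENNReal.ofReal_sum_of_nonneg (fun i _ => h0 _ (norm_nonneg _))] at this
  simpa only [ofReal_norm_rpow] using this

theorem scalarBound_quotient [Fact (p ≠ ⊤)] {L : Type*} [NormedAddCommGroup L] [NormedSpace ℂ L]
    (hL : ScalarBound p L) (S : Submodule ℂ L) : ScalarBound p (L ⧸ S) := by
  intro n z v
  have hC := cNorm_nonneg p z
  have hcont : Filter.Tendsto (fun δ : ℝ => cNorm p z ^ p.toReal * ∑ i, (‖v i‖ + δ) ^ p.toReal)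
      (nhdsWithin 0 (Set.Ioi 0)) (nhds (cNorm p z ^ p.toReal * ∑ i, ‖v i‖ ^ p.toReal)) := by
    have : Continuous fun δ : ℝ => cNorm p z ^ p.toReal * ∑ i, (‖v i‖ + δ) ^ p.toReal :=
      continuous_const.mul (continuous_finsetSum _ fun i _ =>
        (continuous_const.add continuous_id).rpow_const fun _ => Or.inr (toReal_pos p).le)
    have h := this.tendsto 0
    simp only [add_zero] at h
    exact h.mono_left nhdsWithin_le_nhds
  refine ge_of_tendsto hcont ?_
  filter_upwards [self_mem_nhdsWithin] with δ hδ
  choose f hf1 hf2 using fun i => Submodule.Quotient.norm_mk_lt (v i) hδ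
  refine le_trans ?_ ((hL n z f).trans ?_)
  · refine Finset.sum_le_sum fun i _ => Real.rpow_le_rpow (norm_nonneg _) ?_ (toReal_pos p).le
    have : ∑ j, z i j • v j = Submodule.Quotient.mk (p := S) (∑ j, z i j • f j) := by
      rw [← Submodule.mkQ_apply, map_sum]
      refine Finset.sum_congr rfl fun j _ => ?_
      rw [map_smul, Submodule.mkQ_apply, hf1]
    rw [this]
    exact Submodule.Quotient.norm_mk_le S _
  · refine mul_le_mul_of_nonneg_left ?_ (Real.rpow_nonneg hC _)
    exact Finset.sum_le_sum fun i _ =>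
      Real.rpow_le_rpow (norm_nonneg _) (hf2 i).le (toReal_pos p).le

variable {p}

theorem IsSQp.scalarBound [Fact (p ≠ ⊤)] {E : Type u} [NormedAddCommGroup E] [NormedSpace ℂ E]
    (h : IsSQp p E) : ScalarBound p E := by
  obtain ⟨Ω, _, μ, S, _, ⟨f⟩⟩ := h
  intro n z v
  have := scalarBound_quotient p (scalarBound_lp p μ) S n z fun i => f (v i)
  simpa only [← map_smul, ← map_sum, f.norm_map] using this

theorem IsSQp.opNorm_scalar_le [Fact (p ≠ ⊤)] {E : Type u} [NormedAddCommGroup E]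
    [NormedSpace ℂ E] (h : IsSQp p E) {n : ℕ} (z : Matrix (Fin n) (Fin n) ℂ) :
    opNorm p (z.map fun c => c • ContinuousLinearMap.id ℂ E) ≤ cNorm p z := by
  rw [opNorm_le_iff p Fact.out _ (cNorm_nonneg p z)]
  intro v
  simpa using h.scalarBound n z v

end SQp

end QK

namespace QK

open scoped ENNReal

universe u v

section Filtered

variable (p : ℝ≥0∞) [Fact (1 ≤ p)]

/-- The seminorm `opNorm` on `M_n(B(E))`. -/
noncomputable def opSem (E : Type*) [NormedAddCommGroup E] [NormedSpace ℂ E] (n : ℕ) :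
    Seminorm ℂ (Matrix (Fin n) (Fin n) (E →L[ℂ] E)) :=
  (normSeminorm ℂ _).comp (matCLMₗ p)

theorem opSem_apply {E : Type*} [NormedAddCommGroup E] [NormedSpace ℂ E] {n : ℕ}
    (x : Matrix (Fin n) (Fin n) (E →L[ℂ] E)) : opSem p E n x = opNorm p x := rfl

/-- A filtered `SQ_p` algebra: a norm closed subalgebra `A` of `B(E)`, where `E` is an `SQ_p` space,
with a filtration `(A_r)_{r > 0}`. If `A` has a unit, the unit is in every `A_r` and has norm `1`
(norm `0` is allowed for the zero algebra). The values `filt r` for `r ≤ 0` play no role. -/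
structure FilteredSQpAlgebra (E : Type u) [NormedAddCommGroup E] [NormedSpace ℂ E]
    [CompleteSpace E] where
  alg : NonUnitalSubalgebra ℂ (E →L[ℂ] E)
  isClosed_alg : IsClosed (alg : Set (E →L[ℂ] E))
  isSQp : IsSQp p E
  filt : ℝ → Submodule ℂ (E →L[ℂ] E)
  filt_le : ∀ r, ∀ a ∈ filt r, a ∈ alg
  isClosed_filt : ∀ r, 0 < r → IsClosed (filt r : Set (E →L[ℂ] E))
  filt_mono : ∀ r s, r ≤ s → filt r ≤ filt s
  filt_mul : ∀ r s, 0 < r → 0 < s → ∀ a ∈ filt r, ∀ b ∈ filt s, a * b ∈ filt (r + s)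
  filt_dense : ∀ a ∈ alg, a ∈ closure {b | ∃ r, 0 < r ∧ b ∈ filt r}
  unit_mem : ∀ e ∈ alg, (∀ a ∈ alg, e * a = a ∧ a * e = a) → ∀ r, 0 < r → e ∈ filt r
  unit_norm : ∀ e ∈ alg, (∀ a ∈ alg, e * a = a ∧ a * e = a) → ‖e‖ ≤ 1

variable {p}

namespace FilteredSQpAlgebra

section
variable {E : Type u} [NormedAddCommGroup E] [NormedSpace ℂ E] [CompleteSpace E]
  (A : FilteredSQpAlgebra p E)

instance : NonUnitalRing A.alg := inferInstance
instance : Module ℂ A.alg := inferInstance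
instance : IsScalarTower ℂ A.alg A.alg := inferInstance
instance : SMulCommClass ℂ A.alg A.alg := inferInstance
instance : Ring (Unitization ℂ A.alg) := inferInstance
instance : Semiring (Unitization ℂ A.alg) := inferInstance
instance : AddCommGroup (Unitization ℂ A.alg) := inferInstance
instance : AddCommMonoid (Unitization ℂ A.alg) := inferInstance
instance : Module ℂ (Unitization ℂ A.alg) := inferInstance
instance : Algebra ℂ (Unitization ℂ A.alg) := inferInstance

/-- `A` has a unit. -/
def IsUnital : Prop := ∃ e ∈ A.alg, ∀ a ∈ A.alg, e * a = a ∧ a * e = a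

open scoped Classical in
/-- The unit of `Ã`: the unit of `A` if `A` is unital, and the identity of `E` otherwise. -/
noncomputable def one : E →L[ℂ] E := if h : A.IsUnital then Classical.choose h else 1

theorem one_mul_mem {a : E →L[ℂ] E} (ha : a ∈ A.alg) : A.one * a = a := by
  by_cases h : A.IsUnital
  · rw [one, dif_pos h]
    exact ((Classical.choose_spec h).2 a ha).1
  · rw [one, dif_neg h, one_mul]

theorem mul_one_mem {a : E →L[ℂ] E} (ha : a ∈ A.alg) : a * A.one = a := by
  by_cases h : A.IsUnital
  · rw [one, dif_pos h]
    exact ((Classical.choose_spec h).2 a ha).2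
  · rw [one, dif_neg h, mul_one]

theorem one_mul_one : A.one * A.one = A.one := by
  by_cases h : A.IsUnital
  · refine A.one_mul_mem ?_
    rw [one, dif_pos h]
    exact (Classical.choose_spec h).1
  · rw [one, dif_neg h, one_mul]

theorem norm_one_le : ‖A.one‖ ≤ 1 := by
  by_cases h : A.IsUnital
  · rw [one, dif_pos h]
    exact A.unit_norm _ (Classical.choose_spec h).1 (Classical.choose_spec h).2
  · rw [one, dif_neg h]
    exact ContinuousLinearMap.norm_id_le

/-- The map `A⁺ → Ã ⊆ B(E)`, `(a, z) ↦ a + z 1`. -/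
noncomputable def rep : Unitization ℂ A.alg →ₗ[ℂ] (E →L[ℂ] E) where
  toFun x := (x.snd : E →L[ℂ] E) + x.fst • A.one
  map_add' x y := by
    simp only [Unitization.snd_add, Unitization.fst_add, NonUnitalSubalgebra.coe_add, add_smul]
    abel
  map_smul' c x := by
    simp [smul_smul]

theorem rep_apply (x : Unitization ℂ A.alg) :
    A.rep x = (x.snd : E →L[ℂ] E) + x.fst • A.one := rfl

theorem rep_mul (x y : Unitization ℂ A.alg) : A.rep (x * y) = A.rep x * A.rep y := by
  simp only [rep_apply, Unitization.snd_mul, Unitization.fst_mul, NonUnitalSubalgebra.coe_add,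
    NonUnitalSubalgebra.coe_smul, NonUnitalSubalgebra.coe_mul, add_mul, mul_add, smul_mul_assoc,
    mul_smul_comm, A.one_mul_mem y.snd.2, A.mul_one_mem x.snd.2, A.one_mul_one, smul_smul, smul_add]
  rw [mul_comm y.fst x.fst]
  abel

variable [Fact (p ≠ ⊤)]

/-- The norm on `M_n(A⁺)`. If `A` is unital then `A⁺ = A ⊕ ℂ` via `(a, z) ↦ (a + z 1, z)`, and
`M_n(A⁺) = M_n(A) ⊕ M_n(ℂ)` has the maximum norm. If `A` is not unital then `A⁺ = A + ℂ 1 ⊆ B(E)`,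
and the second term in the maximum may be omitted (see `nrm_eq_of_not_isUnital`). -/
noncomputable def nrm (n : ℕ) : Seminorm ℂ (Matrix (Fin n) (Fin n) (Unitization ℂ A.alg)) :=
  (opSem p E n).comp A.rep.mapMatrix ⊔
    ((cAlg p).nrm n).comp ((Unitization.fstHom ℂ A.alg).toLinearMap.mapMatrix)

theorem nrm_apply {n : ℕ} (x : Matrix (Fin n) (Fin n) (Unitization ℂ A.alg)) :
    A.nrm n x = max (opNorm p (x.map A.rep)) (cNorm p (x.map fun a => a.fst)) := rfl

theorem opNorm_le_nrm {n : ℕ} (x : Matrix (Fin n) (Fin n) (Unitization ℂ A.alg)) :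
    opNorm p (x.map A.rep) ≤ A.nrm n x := le_max_left _ _

theorem cNorm_le_nrm {n : ℕ} (x : Matrix (Fin n) (Fin n) (Unitization ℂ A.alg)) :
    cNorm p (x.map fun a => a.fst) ≤ A.nrm n x := le_max_right _ _

theorem rep_bdiag {n m : ℕ} (x : Matrix (Fin n) (Fin n) (Unitization ℂ A.alg))
    (y : Matrix (Fin m) (Fin m) (Unitization ℂ A.alg)) :
    (bdiag x y).map A.rep = bdiag (x.map A.rep) (y.map A.rep) := by
  have h0 : A.rep 0 = 0 := map_zero _
  ext1 i j
  refine Fin.addCases (fun i => ?_) (fun i => ?_) i <;>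
    refine Fin.addCases (fun j => ?_) (fun j => ?_) j <;>
    simp only [Matrix.map_apply, bdiag_ll, bdiag_lr, bdiag_rl, bdiag_rr, h0]

theorem norm_fst_le_norm_rep (hA : ¬ A.IsUnital) (u : Unitization ℂ A.alg) :
    ‖u.fst‖ ≤ ‖A.rep u‖ := by
  by_contra! hlt
  have hz : u.fst ≠ 0 := by
    intro h
    rw [h, norm_zero] at hlt
    exact absurd hlt (norm_nonneg _).not_gt
  have hone : A.one = 1 := by rw [one, dif_neg hA]
  set a : E →L[ℂ] E := (u.snd : E →L[ℂ] E) with ha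
  have haA : a ∈ A.alg := u.snd.2
  set t : E →L[ℂ] E := u.fst⁻¹ • A.rep u with ht
  have ht1 : ‖t‖ < 1 := by
    rw [ht, norm_smul, norm_inv, inv_mul_lt_iff₀ (norm_pos_iff.2 hz), mul_one]
    exact hlt
  have ht2 : t = u.fst⁻¹ • a + 1 := by
    rw [ht, rep_apply, hone, smul_add, smul_smul, inv_mul_cancel₀ hz, one_smul]
  have hb : (1 - t) ∈ A.alg := by
    have : 1 - t = -(u.fst⁻¹ • a) := by
      rw [ht2]
      abel
    rw [this]
    exact neg_mem (SMulMemClass.smul_mem _ haA)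
  have hpow : ∀ k : ℕ, (1 - t) * t ^ k ∈ A.alg := by
    intro k
    induction k with
    | zero => simpa using hb
    | succ k ih =>
      have : (1 - t) * t ^ (k + 1) =
          (1 - t) * t ^ k * (u.fst⁻¹ • a) + (1 - t) * t ^ k := by
        rw [pow_succ, ← mul_assoc]
        nth_rewrite 3 [ht2]
        rw [mul_add, mul_one]
      rw [this]
      exact add_mem (mul_mem ih (SMulMemClass.smul_mem _ haA)) ih
  have hmem : ∀ k : ℕ, 1 - t ^ k ∈ A.alg := by
    intro k
    rw [← mul_neg_geom_sum, Finset.mul_sum]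
    exact sum_mem fun i _ => hpow i
  have hlim : Filter.Tendsto (fun k : ℕ => 1 - t ^ k) Filter.atTop (nhds (1 - 0)) :=
    tendsto_const_nhds.sub (tendsto_pow_atTop_nhds_zero_of_norm_lt_one ht1)
  rw [sub_zero] at hlim
  have h1 : (1 : E →L[ℂ] E) ∈ A.alg :=
    A.isClosed_alg.mem_of_tendsto hlim (Filter.Eventually.of_forall hmem)
  exact hA ⟨1, h1, fun a _ => ⟨one_mul a, mul_one a⟩⟩

/-- For a non-unital algebra the norm on `M_n(A⁺)` is that of `M_n(A + ℂ 1) ⊆ M_n(B(E))`. -/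
theorem nrm_eq_of_not_isUnital (hA : ¬ A.IsUnital) {n : ℕ}
    (x : Matrix (Fin n) (Fin n) (Unitization ℂ A.alg)) :
    A.nrm n x = opNorm p (x.map A.rep) := by
  rw [nrm_apply]
  refine max_eq_left ?_
  have hM : 0 ≤ opNorm p (x.map A.rep) := norm_nonneg _
  refine ContinuousLinearMap.opNorm_le_bound _ hM fun v => ?_
  set w := matCLM p ((x.map fun a => a.fst).map fun c => c • ContinuousLinearMap.id ℂ ℂ) v with hw
  obtain ⟨f, hf1, hf2⟩ := exists_dual_vector'' ℂ w
  set η : Fin n → ℂ := fun i => f (PiLp.single p i 1) with hη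
  have hf : ∀ y : PiLp p (fun _ : Fin n => ℂ), f y = ∑ i, η i * y i := by
    intro y
    have : y = ∑ i, y i • PiLp.single p i (1 : ℂ) := by
      ext i
      rw [WithLp.ofLp_sum, Finset.sum_apply, Finset.sum_eq_single i]
      · simp
      · intro j _ hj
        simp [hj.symm]
      · simp
    conv_lhs => rw [this]
    simp only [map_sum, map_smul, smul_eq_mul, hη, mul_comm]
  have hp := toReal_pos p
  have hkey : ∀ y : PiLp p (fun _ : Fin n => E), ‖∑ i, η i • y i‖ ≤ ‖y‖ := by
    intro y
    set c : PiLp p (fun _ : Fin n => ℂ) := WithLp.toLp p fun i =>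
      (‖y i‖ : ℂ) * ((starRingEnd ℂ) (η i) / ‖η i‖) with hc
    have hcy : ‖c‖ ≤ ‖y‖ := by
      rw [← Real.rpow_le_rpow_iff (norm_nonneg _) (norm_nonneg _) hp,
        norm_rpow_piLp p Fact.out, norm_rpow_piLp p Fact.out]
      refine Finset.sum_le_sum fun i _ => Real.rpow_le_rpow (norm_nonneg _) ?_ hp.le
      rw [hc]
      simp only [norm_mul, norm_div, RCLike.norm_conj, Complex.norm_real, norm_norm]
      exact mul_le_of_le_one_right (norm_nonneg _) (div_self_le_one _)
    have hfc : f c = ((∑ i, ‖η i • y i‖ : ℝ) : ℂ) := by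
      rw [hf, Complex.ofReal_sum]
      refine Finset.sum_congr rfl fun i _ => ?_
      rw [hc, norm_smul]
      simp only [Complex.ofReal_mul]
      by_cases h : η i = 0
      · simp [h]
      have h' : (‖η i‖ : ℂ) ≠ 0 := by simpa using h
      have := Complex.mul_conj' (η i)
      field_simp
      linear_combination (‖y i‖ : ℂ) * this
    calc ‖∑ i, η i • y i‖ ≤ ∑ i, ‖η i • y i‖ := norm_sum_le _ _
      _ ≤ ‖f c‖ := by
        rw [hfc, Complex.norm_real]
        exact Real.le_norm_self _
      _ ≤ ‖f‖ * ‖c‖ := f.le_opNorm c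
      _ ≤ 1 * ‖y‖ := mul_le_mul hf1 hcy (norm_nonneg _) zero_le_one
      _ = ‖y‖ := one_mul _
  set u : Unitization ℂ A.alg := ∑ i, ∑ j, (η i * v j) • x i j with hu
  have hfst : u.fst = f w := by
    have : u.fst = Unitization.fstHom ℂ A.alg u := rfl
    rw [this, hu, hf, map_sum]
    refine Finset.sum_congr rfl fun i _ => ?_
    rw [map_sum, hw, matCLM_apply, Finset.mul_sum]
    refine Finset.sum_congr rfl fun j _ => ?_
    rw [map_smul]
    simp only [Unitization.fstHom_apply, smul_eq_mul, Matrix.map_apply,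
      smul_apply, ContinuousLinearMap.id_apply]
    ring
  have hrep : ‖A.rep u‖ ≤ opNorm p (x.map A.rep) * ‖v‖ := by
    refine ContinuousLinearMap.opNorm_le_bound _ (mul_nonneg hM (norm_nonneg _)) fun e => ?_
    set ve : PiLp p (fun _ : Fin n => E) := WithLp.toLp p fun j => v j • e with hve
    have hnve : ‖ve‖ = ‖v‖ * ‖e‖ := by
      rw [← Real.rpow_left_inj (norm_nonneg _) (mul_nonneg (norm_nonneg _) (norm_nonneg _)) hp.ne',
        Real.mul_rpow (norm_nonneg _) (norm_nonneg _), norm_rpow_piLp p Fact.out,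
        norm_rpow_piLp p Fact.out, Finset.sum_mul]
      refine Finset.sum_congr rfl fun j _ => ?_
      rw [hve]
      simp only [norm_smul]
      exact Real.mul_rpow (norm_nonneg _) (norm_nonneg _)
    have : A.rep u e = ∑ i, η i • matCLM p (x.map A.rep) ve i := by
      rw [hu, map_sum, _root_.sum_apply]
      refine Finset.sum_congr rfl fun i _ => ?_
      rw [map_sum, _root_.sum_apply, matCLM_apply, Finset.smul_sum]
      refine Finset.sum_congr rfl fun j _ => ?_
      rw [map_smul, hve]
      simp only [smul_apply, Matrix.map_apply, map_smul, smul_smul]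
    rw [this, mul_assoc, ← hnve]
    exact (hkey _).trans (ContinuousLinearMap.le_opNorm _ _)
  have := A.norm_fst_le_norm_rep hA u
  rw [hfst, hf2, RCLike.norm_ofReal, abs_norm] at this
  exact this.trans hrep

/-- `A⁺` with the norms above and the filtration `(A_r + ℂ 1)_{r > 0}`. -/
noncomputable def toQ : QAlg p (Unitization ℂ A.alg) where
  nrm := A.nrm
  mul_le {n} x y := by
    have h0 : ∀ z : Matrix (Fin n) (Fin n) (Unitization ℂ A.alg), 0 ≤ opNorm p (z.map A.rep) :=
      fun z => norm_nonneg _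
    rw [nrm_apply]
    refine max_le ?_ ?_
    · have : (x * y).map A.rep = x.map A.rep * y.map A.rep := by
        ext1 i j
        simp only [Matrix.map_apply, Matrix.mul_apply, map_sum, rep_mul]
      rw [this]
      exact (opNorm_mul_le p _ _).trans (mul_le_mul (A.opNorm_le_nrm x) (A.opNorm_le_nrm y)
        (h0 y) (apply_nonneg (A.nrm n) x))
    · have : (x * y).map (fun a => a.fst) = (x.map fun a => a.fst) * y.map fun a => a.fst := by
        ext1 i j
        simp only [Matrix.map_apply, Matrix.mul_apply]
        exact map_sum (Unitization.fstHom ℂ A.alg) _ _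
      rw [this]
      exact (cNorm_mul_le p _ _).trans (mul_le_mul (A.cNorm_le_nrm x) (A.cNorm_le_nrm y)
        (cNorm_nonneg p _) (apply_nonneg (A.nrm n) x))
  perm_left σ x := by
    rw [nrm_apply]
    exact max_le ((opNorm_perm_left p σ (x.map A.rep)).trans (A.opNorm_le_nrm x))
      (((cAlg p).perm_left σ (x.map fun a => a.fst)).trans (A.cNorm_le_nrm x))
  perm_right σ x := by
    rw [nrm_apply]
    exact max_le ((opNorm_perm_right p σ (x.map A.rep)).trans (A.opNorm_le_nrm x))
      (((cAlg p).perm_right σ (x.map fun a => a.fst)).trans (A.cNorm_le_nrm x))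
  bdiag_le {n m} x y := by
    rw [nrm_apply]
    refine max_le ?_ ?_
    · rw [A.rep_bdiag]
      exact (opNorm_bdiag_le p Fact.out _ _).trans
        (max_le_max (A.opNorm_le_nrm x) (A.opNorm_le_nrm y))
    · have : (bdiag x y).map (fun a => a.fst) =
          bdiag (x.map fun a => a.fst) (y.map fun a => a.fst) := by
        ext1 i j
        refine Fin.addCases (fun i => ?_) (fun i => ?_) i <;>
          refine Fin.addCases (fun j => ?_) (fun j => ?_) j <;>
          simp only [Matrix.map_apply, bdiag_ll, bdiag_lr, bdiag_rl, bdiag_rr, Unitization.fst_zero]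
      rw [this]
      exact (cNorm_bdiag_le p Fact.out _ _).trans
        (max_le_max (A.cNorm_le_nrm x) (A.cNorm_le_nrm y))
  scalar_le {n} z := by
    rw [nrm_apply]
    refine max_le ?_ (le_of_eq (congrArg (cNorm p) (by
      ext i j
      simp only [Matrix.map_apply, Unitization.algebraMap_eq_inl, Unitization.fst_inl])))
    have : (z.map (algebraMap ℂ (Unitization ℂ A.alg))).map A.rep =
        (z.map fun c => c • ContinuousLinearMap.id ℂ E) * Matrix.diagonal fun _ => A.one := by
      ext1 i j
      rw [Matrix.mul_diagonal]
      simp only [Matrix.map_apply, rep_apply, Unitization.algebraMap_eq_inl, Unitization.snd_inl,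
        Unitization.fst_inl, NonUnitalSubalgebra.coe_zero, zero_add, smul_mul_assoc]
      exact congrArg _ (one_mul A.one).symm
    rw [this]
    refine (opNorm_mul_le p _ _).trans ?_
    have h1 := A.isSQp.opNorm_scalar_le z
    have h2 := (opNorm_diagonal_le p Fact.out (n := n) A.one).trans A.norm_one_le
    have := mul_le_mul h1 h2 (norm_nonneg _) (cNorm_nonneg p z)
    rwa [mul_one] at this
  filt r :=
    { carrier := {x | (x.snd : E →L[ℂ] E) ∈ A.filt r}
      add_mem' := fun {x y} hx hy => add_mem (S := Submodule ℂ (E →L[ℂ] E)) hx hy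
      zero_mem' := zero_mem (A.filt r)
      smul_mem' := fun c x hx => Submodule.smul_mem (A.filt r) c hx }
  filt_mono h _ hx := A.filt_mono _ _ h hx
  filt_mul {r s} hr hs {x y} hx hy := by
    change ((x * y).snd : E →L[ℂ] E) ∈ A.filt (r + s)
    rw [Unitization.snd_mul]
    exact add_mem (add_mem
      (Submodule.smul_mem _ _ (A.filt_mono s (r + s) (by linarith) hy))
      (Submodule.smul_mem _ _ (A.filt_mono r (r + s) (by linarith) hx)))
      (A.filt_mul r s hr hs _ hx _ hy)
  filt_one {r} _ := zero_mem (A.filt r)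

/-- The filtered `SQ_p` algebra `A` through its unitization. -/
noncomputable def toFAlg : FAlg p A.alg where
  toQ := A.toQ
  aug := ⟨le_rfl, fun n x => by rw [one_mul]; exact A.cNorm_le_nrm x, fun _ _ _ _ => trivial⟩

end
end FilteredSQpAlgebra
end Filtered
end QK

namespace QK

open scoped ENNReal

universe u v

section quot

variable {p : ℝ≥0∞} [Fact (1 ≤ p)] [Fact (p ≠ ⊤)]
variable {A : Type*} [NonUnitalRing A] [Module ℂ A] [IsScalarTower ℂ A A] [SMulCommClass ℂ A A]
variable {B : Type*} [NonUnitalRing B] [Module ℂ B] [IsScalarTower ℂ B B] [SMulCommClass ℂ B B]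

namespace FAlg

theorem plus_surjective {q : A →ₙₐ[ℂ] B} (hq : Function.Surjective q) :
    Function.Surjective (plus q) := by
  intro y
  obtain ⟨a, ha⟩ := hq y.snd
  refine ⟨Unitization.inl y.fst + Unitization.inr a, ?_⟩
  rw [plus_apply]
  ext <;> simp [ha]

variable (X : FAlg p A) {q : A →ₙₐ[ℂ] B}

/-- The quotient norm on `M_n(B⁺)`, for a surjective homomorphism `q : A → B`: the infimum of the
norms of all lifts to `M_n(A⁺)`. -/
noncomputable def quotNrm (q : A →ₙₐ[ℂ] B) {n : ℕ} (y : Matrix (Fin n) (Fin n) (Unitization ℂ B)) :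
    ℝ :=
  sInf {c | ∃ x : Matrix (Fin n) (Fin n) (Unitization ℂ A), x.map (plus q) = y ∧
    X.toQ.nrm n x = c}

variable {X}

theorem quotNrm_le {n : ℕ} {x : Matrix (Fin n) (Fin n) (Unitization ℂ A)}
    {y : Matrix (Fin n) (Fin n) (Unitization ℂ B)} (h : x.map (plus q) = y) :
    X.quotNrm q y ≤ X.toQ.nrm n x :=
  csInf_le ⟨0, by rintro _ ⟨x, _, rfl⟩; exact apply_nonneg (X.toQ.nrm n) x⟩ ⟨x, h, rfl⟩

theorem exists_lift (hq : Function.Surjective q) {n : ℕ}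
    (y : Matrix (Fin n) (Fin n) (Unitization ℂ B)) :
    ∃ x : Matrix (Fin n) (Fin n) (Unitization ℂ A), x.map (plus q) = y := by
  choose f hf using plus_surjective hq
  exact ⟨y.map f, by ext1 i j; simp only [Matrix.map_apply, hf]⟩

theorem le_quotNrm (hq : Function.Surjective q) {n : ℕ}
    {y : Matrix (Fin n) (Fin n) (Unitization ℂ B)} {c : ℝ}
    (h : ∀ x : Matrix (Fin n) (Fin n) (Unitization ℂ A), x.map (plus q) = y →
      c ≤ X.toQ.nrm n x) : c ≤ X.quotNrm q y := by
  obtain ⟨x, hx⟩ := exists_lift hq y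
  refine le_csInf ⟨_, x, hx, rfl⟩ ?_
  rintro _ ⟨x, hx, rfl⟩
  exact h x hx

theorem quotNrm_nonneg (hq : Function.Surjective q) {n : ℕ}
    (y : Matrix (Fin n) (Fin n) (Unitization ℂ B)) : 0 ≤ X.quotNrm q y :=
  le_quotNrm hq fun x _ => apply_nonneg (X.toQ.nrm n) x

theorem exists_lift_lt (hq : Function.Surjective q) {n : ℕ}
    {y : Matrix (Fin n) (Fin n) (Unitization ℂ B)} {c : ℝ} (h : X.quotNrm q y < c) :
    ∃ x : Matrix (Fin n) (Fin n) (Unitization ℂ A), x.map (plus q) = y ∧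
      X.toQ.nrm n x < c := by
  by_contra! hc
  exact absurd (le_quotNrm hq hc) h.not_ge

/-- The algebra `B = A/J`, for a surjective homomorphism `q : A → B` with kernel `J`. The norms on
`M_n(B⁺) = M_n(A⁺)/M_n(J)` are the quotient norms, and the filtration is `(q⁺((A⁺)_r))_{r > 0}`. -/
noncomputable def quot (X : FAlg p A) (q : A →ₙₐ[ℂ] B) (hq : Function.Surjective q) :
    FAlg p B where
  toQ :=
    { nrm := fun n => Seminorm.ofSMulLE (X.quotNrm q)
        (le_antisymm ((quotNrm_le (x := 0) (by ext1; simp)).trans (map_zero _).le)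
          (quotNrm_nonneg hq _))
        (by
          intro y z
          refine le_of_forall_pos_le_add fun δ hδ => ?_
          obtain ⟨a, ha, ha'⟩ := exists_lift_lt (X := X) hq (y := y) (lt_add_of_pos_right _ (half_pos hδ))
          obtain ⟨b, hb, hb'⟩ := exists_lift_lt (X := X) hq (y := z) (lt_add_of_pos_right _ (half_pos hδ))
          refine (quotNrm_le (x := a + b) ?_).trans ((map_add_le_add (X.toQ.nrm n) a b).trans
            (by linarith))
          rw [Matrix.map_add _ (map_add _), ha, hb])
        (by
          intro c y
          refine le_of_forall_pos_le_add fun δ hδ => ?_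
          obtain ⟨a, ha, ha'⟩ := exists_lift_lt (X := X) hq (y := y)
            (lt_add_of_pos_right _ (div_pos hδ (by positivity : 0 < ‖c‖ + 1)))
          refine (quotNrm_le (x := c • a) ?_).trans ?_
          · rw [← ha]
            ext1 i j
            simp only [Matrix.map_apply, Matrix.smul_apply, map_smul]
          · rw [map_smul_eq_mul]
            have h1 := mul_le_mul_of_nonneg_left ha'.le (norm_nonneg c)
            have h2 : ‖c‖ * (δ / (‖c‖ + 1)) ≤ δ := by
              rw [← mul_div_assoc, div_le_iff₀ (by positivity)]
              nlinarith [norm_nonneg c]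
            linarith)
      mul_le := fun {n} y z => by
        change X.quotNrm q (y * z) ≤ X.quotNrm q y * X.quotNrm q z
        refine le_mul_of_forall_lt₀ fun a ha b hb => ?_
        obtain ⟨c, hc, hc'⟩ := exists_lift_lt hq ha
        obtain ⟨d, hd, hd'⟩ := exists_lift_lt hq hb
        refine (quotNrm_le (x := c * d) ?_).trans ((X.toQ.mul_le c d).trans
          (mul_le_mul hc'.le hd'.le (apply_nonneg _ _)
            ((apply_nonneg (X.toQ.nrm n) c).trans hc'.le)))
        rw [← hc, ← hd]
        exact Matrix.map_mul
      perm_left := fun {n} σ y => le_quotNrm hq fun x hx =>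
        (quotNrm_le (by rw [← hx]; rfl)).trans (X.toQ.perm_left σ x)
      perm_right := fun {n} σ y => le_quotNrm hq fun x hx =>
        (quotNrm_le (by rw [← hx]; rfl)).trans (X.toQ.perm_right σ x)
      bdiag_le := fun {n m} y z => by
        refine le_of_forall_gt_imp_ge_of_dense fun c hc => ?_
        obtain ⟨a, ha, ha'⟩ := exists_lift_lt hq (max_lt_iff.1 hc).1
        obtain ⟨b, hb, hb'⟩ := exists_lift_lt hq (max_lt_iff.1 hc).2
        refine (quotNrm_le (x := bdiag a b) ?_).trans
          ((X.toQ.bdiag_le a b).trans (max_le ha'.le hb'.le))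
        rw [← ha, ← hb]
        ext1 i j
        refine Fin.addCases (fun i => ?_) (fun i => ?_) i <;>
          refine Fin.addCases (fun j => ?_) (fun j => ?_) j <;>
          simp only [Matrix.map_apply, bdiag_ll, bdiag_lr, bdiag_rl, bdiag_rr, map_zero]
      scalar_le := fun {n} z => by
        refine (quotNrm_le (x := z.map (algebraMap ℂ _)) ?_).trans (X.toQ.scalar_le z)
        ext1 i j
        simp only [Matrix.map_apply, AlgHom.commutes]
      filt := fun r => (X.toQ.filt r).map (plus q).toLinearMap
      filt_mono := fun h => Submodule.map_mono (X.toQ.filt_mono h)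
      filt_mul := by
        rintro r s hr hs _ _ ⟨a, ha, rfl⟩ ⟨b, hb, rfl⟩
        exact ⟨a * b, X.toQ.filt_mul hr hs ha hb, map_mul (plus q) a b⟩
      filt_one := fun hr => ⟨1, X.toQ.filt_one hr, map_one (plus q)⟩ }
  aug := by
    refine ⟨le_rfl, fun n y => ?_, fun _ _ _ _ => trivial⟩
    rw [one_mul]
    refine le_quotNrm hq fun x hx => ?_
    have := X.aug.bound n x
    rw [one_mul] at this
    refine le_trans (le_of_eq (congrArg (cNorm p) ?_)) this
    rw [← hx]
    ext1 i j
    exact plus_fst q (x i j)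

end FAlg

/-- Filtered homomorphisms: `p`-completely bounded algebra homomorphisms `φ : A → B` with
`φ(A_r) ⊆ B_r` for all `r > 0`. -/
structure FilteredHom (X : FAlg p A) (Y : FAlg p B) (φ : A →ₙₐ[ℂ] B) : Prop where
  pcb : ∃ C : ℝ, ∀ n (x : Matrix (Fin n) (Fin n) A),
    Y.toQ.nrm n (x.map fun a => Unitization.inr (φ a)) ≤
      C * X.toQ.nrm n (x.map fun a => Unitization.inr a)
  filt : ∀ r, 0 < r → ∀ a : A, Unitization.inr a ∈ X.toQ.filt r →
    Unitization.inr (φ a) ∈ Y.toQ.filt r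

namespace QAlg
variable {U V : Type*} [Ring U] [Algebra ℂ U] [Ring V] [Algebra ℂ V] {X : QAlg p U} {Y : QAlg p V}

theorem Bdd.mono {φ : U →ₐ[ℂ] V} {c c' : ℝ} (h : Bdd X Y φ c) (hc : c ≤ c') : Bdd X Y φ c' :=
  ⟨h.one_le.trans hc, fun n x => (h.bound n x).trans
    (mul_le_mul_of_nonneg_right hc (apply_nonneg _ _)), h.filt⟩

end QAlg

namespace FilteredHom

variable {X : FAlg p A} {Y : FAlg p B} {φ : A →ₙₐ[ℂ] B}

theorem exists_bdd (h : FilteredHom X Y φ) : ∃ C, QAlg.Bdd X.toQ Y.toQ (FAlg.plus φ) C := by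
  obtain ⟨C, hC⟩ := h.pcb
  refine ⟨2 * max C 0 + 1, by linarith [le_max_right C 0], fun n x => ?_, fun r hr x hx => ?_⟩
  · set a : Matrix (Fin n) (Fin n) (Unitization ℂ A) :=
      (x.map fun y => y.snd).map fun y => Unitization.inr y with ha
    set z : Matrix (Fin n) (Fin n) ℂ := x.map fun y => y.fst with hz
    have h1 : x = a + z.map (algebraMap ℂ (Unitization ℂ A)) := by
      ext1 i j
      simp only [ha, hz, Matrix.map_apply, Matrix.add_apply, Unitization.algebraMap_eq_inl]
      ext <;> simp
    have h2 : x.map (FAlg.plus φ) = ((x.map fun y => y.snd).map fun y => Unitization.inr (φ y)) +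
        z.map (algebraMap ℂ (Unitization ℂ B)) := by
      ext1 i j
      simp only [hz, Matrix.map_apply, Matrix.add_apply, Unitization.algebraMap_eq_inl,
        FAlg.plus_apply, add_comm]
    have h3 : cNorm p z ≤ X.toQ.nrm n x := by
      have := X.aug.bound n x
      rwa [one_mul] at this
    have h4 : X.toQ.nrm n a ≤ 2 * X.toQ.nrm n x := by
      have : a = x - z.map (algebraMap ℂ (Unitization ℂ A)) := eq_sub_of_add_eq h1.symm
      rw [this]
      refine (map_sub_le_add (X.toQ.nrm n) _ _).trans ?_
      have := X.toQ.scalar_le z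
      linarith
    have h5 := hC n (x.map fun y => y.snd)
    have h6 := Y.toQ.scalar_le z
    have h7 := apply_nonneg (X.toQ.nrm n) a
    have h8 := mul_le_mul_of_nonneg_right (le_max_left C 0) h7
    have h9 := mul_le_mul_of_nonneg_left h4 (le_max_right C 0)
    rw [h2]
    refine (map_add_le_add (Y.toQ.nrm n) _ _).trans ?_
    have h5' := h5.trans h8
    linarith
  · have hone : ∀ c : ℂ, (Unitization.inl c : Unitization ℂ A) ∈ X.toQ.filt r := by
      intro c
      rw [← Unitization.algebraMap_eq_inl, Algebra.algebraMap_eq_smul_one]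
      exact Submodule.smul_mem _ c (X.toQ.filt_one hr)
    have hone' : ∀ c : ℂ, (Unitization.inl c : Unitization ℂ B) ∈ Y.toQ.filt r := by
      intro c
      rw [← Unitization.algebraMap_eq_inl, Algebra.algebraMap_eq_smul_one]
      exact Submodule.smul_mem _ c (Y.toQ.filt_one hr)
    rw [FAlg.plus_apply]
    refine add_mem (hone' _) (h.filt r hr _ ?_)
    have : (Unitization.inr x.snd : Unitization ℂ A) = x - Unitization.inl x.fst :=
      eq_sub_of_add_eq (by ext <;> simp)
    rw [this]
    exact sub_mem hx (hone _)

/-- The number `‖φ⁺‖_pcb`. It is at least `1` because `φ⁺` is unital and units have norm `1`. -/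
noncomputable def plusNorm (_ : FilteredHom X Y φ) : ℝ :=
  sInf {C | 1 ≤ C ∧ ∀ n (x : Matrix (Fin n) (Fin n) (Unitization ℂ A)),
    Y.toQ.nrm n (x.map (FAlg.plus φ)) ≤ C * X.toQ.nrm n x}

theorem bdd (h : FilteredHom X Y φ) : QAlg.Bdd X.toQ Y.toQ (FAlg.plus φ) h.plusNorm := by
  obtain ⟨C, hC⟩ := h.exists_bdd
  have hne : {C | 1 ≤ C ∧ ∀ n (x : Matrix (Fin n) (Fin n) (Unitization ℂ A)),
      Y.toQ.nrm n (x.map (FAlg.plus φ)) ≤ C * X.toQ.nrm n x}.Nonempty := ⟨C, hC.one_le, hC.bound⟩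
  refine ⟨le_csInf hne fun C hC => hC.1, fun n x => ?_, hC.filt⟩
  rcases (apply_nonneg (X.toQ.nrm n) x).eq_or_lt with h0 | h0
  · have := hC.bound n x
    rwa [← h0, mul_zero] at this ⊢
  · rw [← div_le_iff₀ h0]
    exact le_csInf hne fun C hC => (div_le_iff₀ h0).2 (hC.2 n x)

/-- The controlled morphism `φ_* : 𝒦_i(A) → 𝒦_i(B)` with control pair `(‖φ⁺‖_pcb N, 1)`. -/
noncomputable def kHom (h : FilteredHom X Y φ) (i : Fin 2) :
    CMor (ControlPair.scal h.plusNorm h.bdd.one_le) (X.fam i) (Y.fam i) :=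
  FAlg.induced φ h.bdd i

end FilteredHom

/-- The controlled morphism `(x, y) ↦ φ_*(x) + ψ_*(y)` on `𝒦_i(A) ⊕ 𝒦_i(A')`, where both `φ_*` and
`ψ_*` are taken with the control pair `(C N, 1)`, `C = max (‖φ⁺‖_pcb, ‖ψ⁺‖_pcb)`. -/
noncomputable def sumHom {A' : Type*} [NonUnitalRing A'] [Module ℂ A'] [IsScalarTower ℂ A' A']
    [SMulCommClass ℂ A' A'] {X : FAlg p A} {X' : FAlg p A'} {Y : FAlg p B} {φ : A →ₙₐ[ℂ] B}
    {ψ : A' →ₙₐ[ℂ] B} (hφ : FilteredHom X Y φ) (hψ : FilteredHom X' Y ψ) (i : Fin 2) :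
    CMor (ControlPair.scal (max hφ.plusNorm hψ.plusNorm)
      (hφ.bdd.one_le.trans (le_max_left _ _))) ((X.fam i).prod (X'.fam i)) (Y.fam i) :=
  CMor.coprod (FAlg.induced φ (hφ.bdd.mono (le_max_left _ _)) i)
    (FAlg.induced ψ (hψ.bdd.mono (le_max_right _ _)) i)

end quot
end QK

namespace QK

open scoped ENNReal

universe u v

section ext

variable {p : ℝ≥0∞} [Fact (1 ≤ p)] [Fact (p ≠ ⊤)]
variable {E : Type u} [NormedAddCommGroup E] [NormedSpace ℂ E] [CompleteSpace E]
variable {B : Type v} [NonUnitalRing B] [Module ℂ B] [IsScalarTower ℂ B B] [SMulCommClass ℂ B B]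

/-- On `M_n(A) ⊆ M_n(A⁺)` the norm is the one inherited from `M_n(B(E))`. -/
theorem FilteredSQpAlgebra.nrm_inr (A : FilteredSQpAlgebra p E) {n : ℕ}
    (x : Matrix (Fin n) (Fin n) A.alg) :
    A.toFAlg.toQ.nrm n (x.map fun a => Unitization.inr a) =
      opNorm p (x.map fun a => (a : E →L[ℂ] E)) := by
  change A.nrm n _ = _
  rw [FilteredSQpAlgebra.nrm_apply]
  have h1 : (x.map fun a => (Unitization.inr a : Unitization ℂ A.alg)).map A.rep =
      x.map fun a => (a : E →L[ℂ] E) := by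
    ext1 i j
    simp only [Matrix.map_apply, FilteredSQpAlgebra.rep_apply, Unitization.snd_inr,
      Unitization.fst_inr, zero_smul, add_zero]
  have h2 : ((x.map fun a => (Unitization.inr a : Unitization ℂ A.alg)).map fun a => a.fst) = 0 := by
    ext1 i j
    simp only [Matrix.map_apply, Unitization.fst_inr, Matrix.zero_apply]
  rw [h1, h2, cNorm_zero]
  exact max_eq_left (norm_nonneg _)

/-- `0 → J → A → B → 0` is an extension of filtered `SQ_p` algebras: `J` is a closed two-sided ideal
of `A` with the filtration `J_r = J ∩ A_r`, and `q : A → B` is a surjective homomorphism with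
kernel `J`, by which `B` is identified with `A/J`. -/
structure IsExtension (J A : FilteredSQpAlgebra p E) (q : A.alg →ₙₐ[ℂ] B) : Prop where
  le : J.alg ≤ A.alg
  mul_mem_left : ∀ a ∈ A.alg, ∀ b ∈ J.alg, a * b ∈ J.alg
  mul_mem_right : ∀ a ∈ A.alg, ∀ b ∈ J.alg, b * a ∈ J.alg
  mem_filt : ∀ r, 0 < r → ∀ a, a ∈ J.filt r ↔ a ∈ J.alg ∧ a ∈ A.filt r
  surj : Function.Surjective q
  ker : ∀ a : A.alg, q a = 0 ↔ (a : E →L[ℂ] E) ∈ J.alg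

namespace IsExtension

variable {J A : FilteredSQpAlgebra p E} {q : A.alg →ₙₐ[ℂ] B} (h : IsExtension J A q)

/-- `A/J` with the quotient filtration, its unitization having the norms of `M_n(A⁺)/M_n(J)`. -/
noncomputable def quotient : FAlg p B := A.toFAlg.quot q h.surj

/-- The inclusion `j : J → A`. -/
def incl : J.alg →ₙₐ[ℂ] A.alg := NonUnitalSubalgebra.inclusion h.le

theorem filteredHom_incl : FilteredHom J.toFAlg A.toFAlg h.incl where
  pcb := by
    refine ⟨1, fun n x => ?_⟩
    rw [one_mul, J.nrm_inr]
    exact (A.nrm_inr (x.map h.incl)).le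
  filt r hr a ha := ((h.mem_filt r hr a).1 ha).2

theorem filteredHom_quot : FilteredHom A.toFAlg h.quotient q where
  pcb := by
    refine ⟨1, fun n x => ?_⟩
    rw [one_mul]
    refine FAlg.quotNrm_le ?_
    ext1 i j
    simp only [Matrix.map_apply, FAlg.plus_apply, Unitization.fst_inr, Unitization.snd_inr,
      Unitization.inl_zero, zero_add]
  filt r hr a ha := by
    refine ⟨Unitization.inr a, ha, ?_⟩
    change FAlg.plus q (Unitization.inr a) = _
    rw [FAlg.plus_apply, Unitization.fst_inr, Unitization.snd_inr, Unitization.inl_zero, zero_add]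

end IsExtension

/-- The extension `0 → J → A → A/J → 0` is split by the filtered homomorphism `s : A/J → A`, and the
induced homomorphism `Ã/J → Ã` is `p`-completely contractive: this is `s` itself if `A` is unital,
and `s⁺ : A⁺/J → A⁺` otherwise. -/
structure IsSplitExtension (J A : FilteredSQpAlgebra p E) (q : A.alg →ₙₐ[ℂ] B)
    (s : B →ₙₐ[ℂ] A.alg) : Prop extends IsExtension J A q where
  filteredHom_section : FilteredHom toIsExtension.quotient A.toFAlg s
  apply_section : ∀ b, q (s b) = b
  contractive_of_isUnital : A.IsUnital → ∀ n (y : Matrix (Fin n) (Fin n) B),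
    A.toFAlg.toQ.nrm n (y.map fun b => Unitization.inr (s b)) ≤
      toIsExtension.quotient.toQ.nrm n (y.map fun b => Unitization.inr b)
  contractive_of_not_isUnital : ¬ A.IsUnital →
    ∀ n (y : Matrix (Fin n) (Fin n) (Unitization ℂ B)),
      A.toFAlg.toQ.nrm n (y.map (FAlg.plus s)) ≤ toIsExtension.quotient.toQ.nrm n y

end ext
end QK

/-! Write `σ = s⁺ ∘ q⁺`. Because `q ∘ s = id`, this is an idempotent endomorphism of `A⁺`, and `id -
σ` takes values in `J`. Split exactness amounts to turning the linear map `id - σ` into a controlled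
retraction `K_i(A) → K_i(J)` whose composite with `j_*` is `x ↦ x - σ_* x`. This is done by explicit
formulas on matrices, so all estimates are polynomial in `N` and linear in `ε`.

In degree `1`, for a quasi-inverse pair `(u, v)`, the element `u σ(v)` represents `[u] - [σ u]`. It
differs from `σ(u) σ(v)`, which is close to `1`, by a matrix over `J`; hence `1 + (u σ(v) - σ(u)
σ(v))` is a quasi-invertible over `J⁺`. That `diag(u σ(v), σ(u))` is homotopic to `diag(u, 1)` is
the usual Whitehead rotation (`glHtpy_bdiag_mul`).

In degree `0`, put `f = σ(e)`. The matrix with rows `(f, -(1 - f))` and `(1 - f, f)` is invertible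
when `f` is idempotent, is joined to `1` by rotations, and conjugates `diag(f, 1 - f)` to `diag(1,
0)`. It therefore conjugates `diag(e, 1 - f)` to `diag(1, 0)` plus the matrix with blocks `f(e-f)f`,
`f(e-f)(1-f)`, `(1-f)(e-f)f`, `(1-f)(e-f)(1-f)`, whose entries lie in `J`. For quasi-idempotents all
this holds up to errors controlled by `f² - f` (`diffIdem_htpy`), and `[e] - [f]` becomes the class
of this matrix minus `[1_n]`.

Both formulas are natural, additive and continuous, so they define homomorphisms `ret` with `j_* ∘
ret + σ_*` equal to relaxation (`ret_add_kuMap`). They vanish on the image of `s_*`. On `K_i(J)`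
they give relaxation: there `id - σ` becomes the difference of the identity and the augmentation,
and the augmentation vanishes on `K_i(J)`. Injectivity of `j_*`, exactness in the middle,
surjectivity of `q_*` and the inverse `(ret, q_*)` of the direct sum map follow formally.

The constants do not depend on the algebras because `j⁺` and `s⁺` are bounded by `3` and `q⁺` by
`1`. The factor `3` accounts for the possibly different units: those of `J̃` and `Ã`, or the unit of
`A` and `s(q(1))`. Matrices of scalars are controlled because the underlying space is an `SQ_p`
space. -/

namespace QK

/-! ### Two by two block matrices -/

section Blocks

variable {U : Type*} [Ring U] {n : ℕ}

/-- The `2n × 2n` matrix with blocks `a, b, c, d`. -/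
def blk (a b c d : Matrix (Fin n) (Fin n) U) : Matrix (Fin (n + n)) (Fin (n + n)) U :=
  (Matrix.fromBlocks a b c d).submatrix finSumFinEquiv.symm finSumFinEquiv.symm

variable (a b c d a' b' c' d' : Matrix (Fin n) (Fin n) U)

@[simp] theorem blk_ll (i j : Fin n) : blk a b c d (Fin.castAdd n i) (Fin.castAdd n j) = a i j := by
  simp [blk]
@[simp] theorem blk_lr (i j : Fin n) : blk a b c d (Fin.castAdd n i) (Fin.natAdd n j) = b i j := by
  simp [blk, -Fin.natAdd_eq_addNat]
@[simp] theorem blk_rl (i j : Fin n) : blk a b c d (Fin.natAdd n i) (Fin.castAdd n j) = c i j := by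
  simp [blk, -Fin.natAdd_eq_addNat]
@[simp] theorem blk_rr (i j : Fin n) : blk a b c d (Fin.natAdd n i) (Fin.natAdd n j) = d i j := by
  simp [blk, -Fin.natAdd_eq_addNat]

theorem bdiag_eq_blk : bdiag a d = blk a 0 0 d := rfl

theorem blk_mul : blk a b c d * blk a' b' c' d' =
    blk (a * a' + b * c') (a * b' + b * d') (c * a' + d * c') (c * b' + d * d') := by
  simp only [blk]
  rw [Matrix.submatrix_mul_equiv, Matrix.fromBlocks_multiply]

theorem blk_add : blk a b c d + blk a' b' c' d' = blk (a + a') (b + b') (c + c') (d + d') := by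
  simp only [blk, ← Matrix.fromBlocks_add]
  rfl

theorem blk_neg : -blk a b c d = blk (-a) (-b) (-c) (-d) := by
  simp only [blk, ← Matrix.fromBlocks_neg]
  rfl

theorem blk_sub : blk a b c d - blk a' b' c' d' = blk (a - a') (b - b') (c - c') (d - d') := by
  rw [sub_eq_add_neg, blk_neg, blk_add]
  simp only [sub_eq_add_neg]

theorem blk_smul {R : Type*} [SMul R U] (z : R) :
    z • blk a b c d = blk (z • a) (z • b) (z • c) (z • d) := by
  simp only [blk, ← Matrix.fromBlocks_smul]
  rfl

theorem blk_one : blk (1 : Matrix (Fin n) (Fin n) U) 0 0 1 = 1 := bdiag_one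

theorem blk_map {V : Type*} [Ring V] (φ : U → V) :
    (blk a b c d).map φ = blk (a.map φ) (b.map φ) (c.map φ) (d.map φ) := by
  ext1 i j
  refine Fin.addCases (fun i => ?_) (fun i => ?_) i <;>
    refine Fin.addCases (fun j => ?_) (fun j => ?_) j <;>
    simp only [Matrix.map_apply, blk_ll, blk_lr, blk_rl, blk_rr]

theorem bdiag_map {V : Type*} [Ring V] {m : ℕ} (φ : U → V) (hφ : φ 0 = 0)
    (x : Matrix (Fin n) (Fin n) U) (y : Matrix (Fin m) (Fin m) U) :
    (bdiag x y).map φ = bdiag (x.map φ) (y.map φ) := by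
  ext1 i j
  refine Fin.addCases (fun i => ?_) (fun i => ?_) i <;>
    refine Fin.addCases (fun j => ?_) (fun j => ?_) j <;>
    simp only [Matrix.map_apply, bdiag_ll, bdiag_lr, bdiag_rl, bdiag_rr, hφ]

theorem bdiag_add {m : ℕ} (x x' : Matrix (Fin n) (Fin n) U) (y y' : Matrix (Fin m) (Fin m) U) :
    bdiag x y + bdiag x' y' = bdiag (x + x') (y + y') := by
  ext i j
  refine Fin.addCases (fun i => ?_) (fun i => ?_) i <;>
    refine Fin.addCases (fun j => ?_) (fun j => ?_) j <;> simp

/-- The anti-diagonal part is a block diagonal matrix with permuted columns. Thus the bounds for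
`bdiag` and for permutations suffice to control the norms and filtration degrees of block matrices.
-/
theorem blk_eq_add : blk a b c d = bdiag a d + (bdiag b c).submatrix id (blockSwap n) := by
  ext i j
  refine Fin.addCases (fun i => ?_) (fun i => ?_) i <;>
    refine Fin.addCases (fun j => ?_) (fun j => ?_) j <;>
    simp [blockSwap_castAdd, blockSwap_natAdd, -Fin.natAdd_eq_addNat]

/-- The exchange of the two middle summands of `(n + n) + (m + m)`. -/
def middleSwap (n m : ℕ) : Fin ((n + m) + (n + m)) ≃ Fin ((n + n) + (m + m)) :=
  (finSumFinEquiv.symm.trans ((Equiv.sumCongr finSumFinEquiv.symm finSumFinEquiv.symm).trans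
    ((Equiv.sumSumSumComm (Fin n) (Fin m) (Fin n) (Fin m)).trans
      ((Equiv.sumCongr finSumFinEquiv finSumFinEquiv).trans finSumFinEquiv))))

/-- A permutation of the basis separates the two direct summands. This is what makes constructions
given by block formulas additive on stable classes. -/
theorem blk_bdiag {m : ℕ} (e f g h : Matrix (Fin m) (Fin m) U) :
    blk (bdiag a e) (bdiag b f) (bdiag c g) (bdiag d h) =
      (bdiag (blk a b c d) (blk e f g h)).submatrix (middleSwap n m) (middleSwap n m) := by
  have h1 : ∀ i : Fin n, middleSwap n m (Fin.castAdd (n + m) (Fin.castAdd m i)) =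
      Fin.castAdd (m + m) (Fin.castAdd n i) := fun i => by
    simp [middleSwap, -Fin.natAdd_eq_addNat]
  have h2 : ∀ i : Fin m, middleSwap n m (Fin.castAdd (n + m) (Fin.natAdd n i)) =
      Fin.natAdd (n + n) (Fin.castAdd m i) := fun i => by
    simp [middleSwap, -Fin.natAdd_eq_addNat]
  have h3 : ∀ i : Fin n, middleSwap n m (Fin.natAdd (n + m) (Fin.castAdd m i)) =
      Fin.castAdd (m + m) (Fin.natAdd n i) := fun i => by
    simp [middleSwap, -Fin.natAdd_eq_addNat]
  have h4 : ∀ i : Fin m, middleSwap n m (Fin.natAdd (n + m) (Fin.natAdd n i)) =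
      Fin.natAdd (n + n) (Fin.natAdd m i) := fun i => by
    simp [middleSwap, -Fin.natAdd_eq_addNat]
  ext1 i j
  rw [Matrix.submatrix_apply]
  refine Fin.addCases (fun i => Fin.addCases (fun i => ?_) (fun i => ?_) i)
    (fun i => Fin.addCases (fun i => ?_) (fun i => ?_) i) i <;>
  refine Fin.addCases (fun j => Fin.addCases (fun j => ?_) (fun j => ?_) j)
    (fun j => Fin.addCases (fun j => ?_) (fun j => ?_) j) j <;>
  simp only [h1, h2, h3, h4, blk_ll, blk_lr, blk_rl, blk_rr, bdiag_ll, bdiag_lr, bdiag_rl, bdiag_rr]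

end Blocks

/-! ### Norm estimates, perturbation of quasi-idempotents, rotations -/

namespace QAlg

open scoped ENNReal

variable {p : ℝ≥0∞} [Fact (1 ≤ p)] {U : Type*} [Ring U] [Algebra ℂ U] {X : QAlg p U} {n : ℕ}

section norm
variable {x y : Matrix (Fin n) (Fin n) U} {a b : ℝ}

theorem nrm_add_le (hx : X.nrm n x ≤ a) (hy : X.nrm n y ≤ b) : X.nrm n (x + y) ≤ a + b :=
  (map_add_le_add _ _ _).trans (add_le_add hx hy)

theorem nrm_sub_le (hx : X.nrm n x ≤ a) (hy : X.nrm n y ≤ b) : X.nrm n (x - y) ≤ a + b :=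
  (map_sub_le_add _ _ _).trans (add_le_add hx hy)

theorem nrm_mul_le (hx : X.nrm n x ≤ a) (hy : X.nrm n y ≤ b) : X.nrm n (x * y) ≤ a * b :=
  (X.mul_le _ _).trans (mul_le_mul hx hy (apply_nonneg _ _) ((apply_nonneg _ _).trans hx))

theorem nrm_smul_le {z : ℂ} {t : ℝ} (hz : ‖z‖ ≤ t) (hx : X.nrm n x ≤ a) :
    X.nrm n (z • x) ≤ t * a := by
  rw [map_smul_eq_mul]
  exact mul_le_mul hz hx (apply_nonneg _ _) ((norm_nonneg _).trans hz)

theorem nrm_blk_le {x y z w : Matrix (Fin n) (Fin n) U} (hx : X.nrm n x ≤ a) (hy : X.nrm n y ≤ b)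
    (hz : X.nrm n z ≤ b) (hw : X.nrm n w ≤ a) : X.nrm (n + n) (blk x y z w) ≤ a + b := by
  rw [blk_eq_add]
  exact nrm_add_le ((X.bdiag_le _ _).trans (max_le hx hw))
    ((X.perm_right _ _).trans ((X.bdiag_le _ _).trans (max_le hy hz)))

theorem blk_mem_mfilt {r : ℝ} {x y z w : Matrix (Fin n) (Fin n) U} (hx : x ∈ X.mfilt r n)
    (hy : y ∈ X.mfilt r n) (hz : z ∈ X.mfilt r n) (hw : w ∈ X.mfilt r n) :
    blk x y z w ∈ X.mfilt r (n + n) := by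
  rw [blk_eq_add]
  exact add_mem_mfilt (bdiag_mem_mfilt hx hw)
    fun i j => bdiag_mem_mfilt hy hz i (blockSwap n j)

theorem mfilt_mono {r s : ℝ} (h : r ≤ s) {x : Matrix (Fin n) (Fin n) U} (hx : x ∈ X.mfilt r n) :
    x ∈ X.mfilt s n := fun i j => X.filt_mono h (hx i j)

theorem neg_mem_mfilt {r : ℝ} {x : Matrix (Fin n) (Fin n) U} (hx : x ∈ X.mfilt r n) :
    -x ∈ X.mfilt r n := fun i j => neg_mem (hx i j)

end norm

theorem one_sub_mem_idem {ε r N : ℝ} (hr : 0 < r) {e : Matrix (Fin n) (Fin n) U}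
    (he : e ∈ X.Idem ε r N n) : 1 - e ∈ X.Idem ε r N n := by
  obtain ⟨h1, h2, h3, h4⟩ := he
  refine ⟨sub_mem_mfilt (one_mem_mfilt hr n) h1, ?_, h4, by rwa [sub_sub_cancel]⟩
  rwa [show (1 - e) * (1 - e) - (1 - e) = e * e - e by noncomm_ring]

/-- Perturbations of quasi-idempotents are quasi-idempotents. -/
theorem mem_idem_of_close {ε r N ε' r' N' η : ℝ} {e d : Matrix (Fin n) (Fin n) U}
    (he : e ∈ X.Idem ε r N n) (hd : d ∈ X.mfilt r' n) (hη : X.nrm n (d - e) ≤ η)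
    (h1 : ε + η * (2 * N + η + 1) ≤ ε') (h2 : N + η ≤ N') : d ∈ X.Idem ε' r' N' n := by
  obtain ⟨a1, a2, a3, a4⟩ := he
  set x := d - e with hx
  have hd' : d = e + x := by rw [hx]; abel
  refine ⟨hd, ?_, ?_, ?_⟩
  · have e1 : d * d - d = (e * e - e) + (e * x + x * e + x * x - x) := by
      rw [hd']; noncomm_ring
    have e2 := nrm_sub_le (nrm_add_le (nrm_add_le (nrm_mul_le a3 hη) (nrm_mul_le hη a3))
      (nrm_mul_le hη hη)) hη
    rw [e1]
    have := map_add_le_add (X.nrm n) (e * e - e) (e * x + x * e + x * x - x)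
    linarith
  · rw [hd']
    exact (nrm_add_le a3 hη).trans h2
  · rw [hd', ← sub_sub]
    exact (nrm_sub_le a4 hη).trans h2

/-- Close quasi-idempotents are homotopic. -/
theorem idemHtpy_of_close {ε r N ε' η : ℝ} {e d : Matrix (Fin n) (Fin n) U}
    (he : e ∈ X.Idem ε r N n) (hd : d ∈ X.Idem ε r N n) (hη : X.nrm n (d - e) ≤ η)
    (h1 : ε + η * η ≤ ε') : X.IdemHtpy ε' r N n e d := by
  letI := X.topo n
  refine JoinedIn.ofLine (f := fun t => ((1 - t : ℝ) : ℂ) • e + (t : ℂ) • d)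
    (continuous_segment e d).continuousOn (by simp) (by simp) ?_
  rintro _ ⟨t, ht, rfl⟩
  refine ⟨add_mem_mfilt (smul_mem_mfilt _ he.1) (smul_mem_mfilt _ hd.1), ?_, ?_, ?_⟩
  -- Along a segment the defect is the convex combination of the defects at the ends, minus `t(1 -
  -- t)(d - e)²`. The cost is therefore quadratic in the distance and does not involve `N`.
  · have e1 : (((1 - t : ℝ) : ℂ) • e + (t : ℂ) • d) * (((1 - t : ℝ) : ℂ) • e + (t : ℂ) • d) -
        (((1 - t : ℝ) : ℂ) • e + (t : ℂ) • d) =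
        (((1 - t : ℝ) : ℂ) • (e * e - e) + (t : ℂ) • (d * d - d)) -
          ((t * (1 - t) : ℝ) : ℂ) • ((d - e) * (d - e)) := by
      push_cast
      simp only [mul_add, add_mul, mul_sub, sub_mul, smul_mul_assoc, mul_smul_comm]
      module
    rw [e1]
    have e2 : X.nrm n (((1 - t : ℝ) : ℂ) • (e * e - e) + (t : ℂ) • (d * d - d)) < ε := by
      refine (norm_convex ht le_rfl le_rfl).trans_lt ?_
      have h2 := he.2.1
      have h3 := hd.2.1
      rcases ht.1.eq_or_lt with h | h
      · rw [← h]; simpa using h2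
      · have := mul_lt_mul_of_pos_left h3 h
        have := mul_le_mul_of_nonneg_left h2.le (sub_nonneg.2 ht.2)
        linarith
    have e3 : X.nrm n (((t * (1 - t) : ℝ) : ℂ) • ((d - e) * (d - e))) ≤ 1 * (η * η) := by
      refine nrm_smul_le ?_ (nrm_mul_le hη hη)
      rw [Complex.norm_real, Real.norm_of_nonneg (mul_nonneg ht.1 (sub_nonneg.2 ht.2))]
      nlinarith [ht.1, ht.2]
    have := map_sub_le_add (X.nrm n) (((1 - t : ℝ) : ℂ) • (e * e - e) + (t : ℂ) • (d * d - d))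
      (((t * (1 - t) : ℝ) : ℂ) • ((d - e) * (d - e)))
    linarith
  · refine (norm_convex ht he.2.2.1 hd.2.2.1).trans (le_of_eq (by ring))
  · have : 1 - (((1 - t : ℝ) : ℂ) • e + (t : ℂ) • d) =
        ((1 - t : ℝ) : ℂ) • (1 - e) + (t : ℂ) • (1 - d) := by
      push_cast
      module
    rw [this]
    refine (norm_convex ht he.2.2.2 hd.2.2.2).trans (le_of_eq (by ring))

/-- The matrix `f + (1 - f) R`, where `R` is the rotation with cosine `c` and sine `s`. -/
noncomputable def rot (f : Matrix (Fin n) (Fin n) U) (c s : ℝ) :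
    Matrix (Fin (n + n)) (Fin (n + n)) U :=
  blk (f + (c : ℂ) • (1 - f)) (-((s : ℂ) • (1 - f))) ((s : ℂ) • (1 - f)) (f + (c : ℂ) • (1 - f))

/-- As `f` and `1 - f` commute, the off-diagonal blocks cancel, and each diagonal block is `f² + 2c
f(1 - f) + (1 - f)² = 1 + 2(1 - c)(f² - f)`. So changing the sign of the sine gives a quasi-inverse,
which is exact when `f` is idempotent. -/
theorem rot_mul_rot (f : Matrix (Fin n) (Fin n) U) {c s : ℝ} (h : c ^ 2 + s ^ 2 = 1) :
    rot f c s * rot f c (-s) - 1 = bdiag (((2 * (1 - c) : ℝ) : ℂ) • (f * f - f))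
      (((2 * (1 - c) : ℝ) : ℂ) • (f * f - f)) := by
  have h' : (c : ℂ) ^ 2 + (s : ℂ) ^ 2 = 1 := by exact_mod_cast h
  rw [rot, rot, blk_mul, ← blk_one, blk_sub, bdiag_eq_blk]
  push_cast
  simp only [mul_add, add_mul, mul_sub, sub_mul, smul_mul_assoc, mul_smul_comm, mul_one, one_mul,
    neg_mul, mul_neg, neg_smul, smul_sub]
  congr 1 <;> match_scalars <;> first | ring1 | linear_combination h' | linear_combination -h' | linear_combination 2*h' | linear_combination -2 * h'

theorem nrm_rot_le {f : Matrix (Fin n) (Fin n) U} {c s N : ℝ} (hc : |c| ≤ 1) (hs : |s| ≤ 1)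
    (h1 : X.nrm n f ≤ N) (h2 : X.nrm n (1 - f) ≤ N) : X.nrm (n + n) (rot f c s) ≤ 3 * N := by
  have hc' : ‖(c : ℂ)‖ ≤ 1 := by rwa [Complex.norm_real]
  have hs' : ‖(s : ℂ)‖ ≤ 1 := by rwa [Complex.norm_real]
  have a1 := nrm_add_le h1 (nrm_smul_le hc' h2)
  have a2 := nrm_smul_le hs' h2
  refine (nrm_blk_le a1 ?_ a2 a1).trans (le_of_eq (by ring))
  rwa [map_neg_eq_map]

theorem rot_mem_mfilt {f : Matrix (Fin n) (Fin n) U} {c s r : ℝ} (hr : 0 < r)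
    (h : f ∈ X.mfilt r n) : rot f c s ∈ X.mfilt r (n + n) := by
  have h1 := sub_mem_mfilt (one_mem_mfilt hr n) h
  have h2 := add_mem_mfilt h (smul_mem_mfilt (c : ℂ) h1)
  exact blk_mem_mfilt h2 (neg_mem_mfilt (smul_mem_mfilt _ h1)) (smul_mem_mfilt _ h1) h2

end QAlg
end QK

/-! ### The difference of two quasi-idempotents -/

namespace QK
namespace QAlg

open scoped ENNReal

variable {p : ℝ≥0∞} [Fact (1 ≤ p)] {U : Type*} [Ring U] [Algebra ℂ U] {X : QAlg p U} {n : ℕ}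

/-- The rotation is affine in cosine and sine. The factor `ς` is there to cover the path of
quasi-inverses too, with `ς = -1`. -/
theorem continuous_rot (f : Matrix (Fin n) (Fin n) U) (ς : ℝ) :
    @Continuous _ _ _ (X.topo (n + n)) fun t : ℝ =>
      rot f (Real.cos (Real.pi / 2 * t)) (ς * Real.sin (Real.pi / 2 * t)) := by
  have h : ∀ c s : ℝ, rot f c s = bdiag f f + (c : ℂ) • bdiag (1 - f) (1 - f) +
      (s : ℂ) • blk 0 (-(1 - f)) (1 - f) 0 := by
    intro c s
    rw [rot, bdiag_eq_blk, bdiag_eq_blk, blk_smul, blk_smul, blk_add, blk_add]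
    simp only [smul_zero, add_zero, zero_add, smul_neg]
  letI := X.srng (n + n)
  letI : NormedSpace ℂ (Matrix (Fin (n + n)) (Fin (n + n)) U) :=
    { (inferInstance : Module ℂ (Matrix (Fin (n + n)) (Fin (n + n)) U)) with
      norm_smul_le := fun c x => (map_smul_eq_mul (X.nrm (n + n)) c x).le }
  simp only [h]
  fun_prop

/-- The conjugate of `diag(e, 1 - f)` by `rot f c s`. -/
noncomputable def rotConj (e f : Matrix (Fin n) (Fin n) U) (c s : ℝ) :
    Matrix (Fin (n + n)) (Fin (n + n)) U :=
  rot f c s * bdiag e (1 - f) * rot f c (-s)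

/-- Conjugation by a quasi-inverse pair almost preserves idempotents. With `Z`, `Z'` of norm at most
`3N` and `‖ZZ' - 1‖`, `‖Z'Z - 1‖` at most `4ε`, the defect is at most `9N²ε + 36N⁴ε` and the norms
are at most `9N³ + 4ε`. -/
theorem rotConj_mem_idem {ε r N : ℝ} (hε : 0 < ε) (hε1 : ε ≤ 1) (hr : 0 < r) (hN : 1 ≤ N)
    {e f : Matrix (Fin n) (Fin n) U} (he : e ∈ X.Idem ε r N n) (hf : f ∈ X.Idem ε r N n) {c s : ℝ}
    (h : c ^ 2 + s ^ 2 = 1) :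
    rotConj e f c s ∈ X.Idem (50 * N ^ 4 * ε) (3 * r) (13 * N ^ 3) (n + n) := by
  have hc : |c| ≤ 1 := (sq_le_one_iff_abs_le_one c).1 (by nlinarith [sq_nonneg s])
  have hs : |s| ≤ 1 := (sq_le_one_iff_abs_le_one s).1 (by nlinarith [sq_nonneg c])
  have hs' : |-s| ≤ 1 := by rwa [abs_neg]
  have hE := idem_bdiag he (one_sub_mem_idem hr hf)
  have n1 := nrm_rot_le (X := X) hc hs hf.2.2.1 hf.2.2.2
  have n2 := nrm_rot_le (X := X) hc hs' hf.2.2.1 hf.2.2.2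
  have m1 := rot_mem_mfilt (c := c) (s := s) hr hf.1
  have m2 := rot_mem_mfilt (c := c) (s := -s) hr hf.1
  have nk : X.nrm (n + n) (bdiag (((2 * (1 - c) : ℝ) : ℂ) • (f * f - f))
      (((2 * (1 - c) : ℝ) : ℂ) • (f * f - f))) ≤ 4 * ε := by
    have hk : X.nrm n (((2 * (1 - c) : ℝ) : ℂ) • (f * f - f)) ≤ 4 * ε := by
      refine nrm_smul_le ?_ hf.2.1.le
      rw [Complex.norm_real, Real.norm_eq_abs, abs_le]
      have := abs_le.1 hc
      constructor <;> linarith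
    exact (X.bdiag_le _ _).trans (max_le hk hk)
  have z1 := rot_mul_rot f h
  have z2 := rot_mul_rot f (show c ^ 2 + (-s) ^ 2 = 1 by rw [neg_sq]; exact h)
  rw [neg_neg] at z2
  rw [← z1] at nk
  have nk' := nk
  rw [z1, ← z2] at nk'
  rw [rotConj]
  set Z := rot f c s
  set Z' := rot f c (-s)
  set E := bdiag e (1 - f)
  have hN2 : 1 ≤ N ^ 2 := one_le_pow₀ hN
  have hN4 : N ^ 2 ≤ N ^ 4 := pow_le_pow_right₀ hN (by norm_num)
  refine ⟨?_, ?_, ?_, ?_⟩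
  · rw [show 3 * r = r + r + r by ring]
    exact mul_mem_mfilt (by linarith) hr (mul_mem_mfilt hr hr m1 hE.1) m2
  -- Inserting `Z'Z = 1 + (Z'Z - 1)` between the two factors separates the defect of `E` from that
  -- of the inverse.
  · have e1 : Z * E * Z' * (Z * E * Z') - Z * E * Z' =
        Z * (E * E - E) * Z' + Z * E * (Z' * Z - 1) * (E * Z') := by noncomm_ring
    rw [e1]
    have b1 := nrm_mul_le (nrm_mul_le n1 hE.2.1.le) n2
    have b2 := nrm_mul_le (nrm_mul_le (nrm_mul_le n1 hE.2.2.1) nk') (nrm_mul_le hE.2.2.1 n2)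
    refine (nrm_add_le b1 b2).trans_lt ?_
    have h1 : N ^ 2 * ε ≤ N ^ 4 * ε := mul_le_mul_of_nonneg_right hN4 hε.le
    have h2 : 0 < N ^ 4 * ε := by positivity
    nlinarith
  · refine (nrm_mul_le (nrm_mul_le n1 hE.2.2.1) n2).trans ?_
    have : 0 ≤ N ^ 3 := by positivity
    nlinarith
  · have e1 : 1 - Z * E * Z' = Z * (1 - E) * Z' - (Z * Z' - 1) := by noncomm_ring
    rw [e1]
    refine (nrm_sub_le (nrm_mul_le (nrm_mul_le n1 hE.2.2.2) n2) nk).trans ?_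
    have : 1 ≤ N ^ 3 := one_le_pow₀ hN
    nlinarith

/-- The difference of `e` and `f`, as a perturbation of `diag(1, 0)`. -/
def diffIdem (e f : Matrix (Fin n) (Fin n) U) : Matrix (Fin (n + n)) (Fin (n + n)) U :=
  blk (1 + f * (e - f) * f) (f * (e - f) * (1 - f)) ((1 - f) * (e - f) * f)
    ((1 - f) * (e - f) * (1 - f))

theorem diffIdem_self (f : Matrix (Fin n) (Fin n) U) : diffIdem f f = bdiag 1 0 := by
  simp [diffIdem, bdiag_eq_blk]

/-- The terms containing `e` agree on both sides, so the difference is `diag(1, 0)` minus the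
conjugate of `diag(f, 1 - f)`. That difference is zero for an idempotent `f`; in general it is a
multiple of `f² - f`, for instance `1 - f³ - (1 - f)³ = -3(f² - f)` in the first block. -/
theorem diffIdem_sub_rotConj (e f : Matrix (Fin n) (Fin n) U) :
    diffIdem e f - rotConj e f 0 1 =
      -blk ((3 : ℂ) • (f * f - f)) (-((f * f - f) * (f - (1 - f)))) (-((f * f - f) * (f - (1 - f))))
        (-(f * f - f)) := by
  rw [diffIdem, rotConj, rot, rot, bdiag_eq_blk, blk_mul, blk_mul, blk_sub, blk_neg]
  simp only [Complex.ofReal_zero, Complex.ofReal_one, zero_smul, add_zero, one_smul,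
    Complex.ofReal_neg, neg_smul, neg_neg, mul_zero, zero_add]
  rw [show (3 : ℂ) • (f * f - f) = (f * f - f) + (f * f - f) + (f * f - f) by module]
  congr 1 <;> noncomm_ring

theorem nrm_diffIdem_sub_le {ε r N : ℝ} (hε : 0 < ε) (hN : 1 ≤ N)
    {e f : Matrix (Fin n) (Fin n) U} (hf : f ∈ X.Idem ε r N n) :
    X.nrm (n + n) (diffIdem e f - rotConj e f 0 1) ≤ 5 * N * ε := by
  rw [diffIdem_sub_rotConj, map_neg_eq_map]
  have h := hf.2.1.le
  have h1 : X.nrm n (-((f * f - f) * (f - (1 - f)))) ≤ ε * (N + N) := by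
    rw [map_neg_eq_map]
    exact nrm_mul_le h (nrm_sub_le hf.2.2.1 hf.2.2.2)
  have h2 : X.nrm n ((3 : ℂ) • (f * f - f)) ≤ 3 * ε := nrm_smul_le (by simp) h
  refine (nrm_blk_le h2 h1 h1 ?_).trans ?_
  · rw [map_neg_eq_map]
    linarith
  · nlinarith

theorem diffIdem_mem_mfilt {r : ℝ} (hr : 0 < r) {e f : Matrix (Fin n) (Fin n) U}
    (he : e ∈ X.mfilt r n) (hf : f ∈ X.mfilt r n) : diffIdem e f ∈ X.mfilt (3 * r) (n + n) := by
  have h1 := sub_mem_mfilt (one_mem_mfilt hr n) hf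
  have h2 := sub_mem_mfilt he hf
  have key : ∀ {a b}, a ∈ X.mfilt r n → b ∈ X.mfilt r n → a * (e - f) * b ∈ X.mfilt (3 * r) n := by
    intro a b ha hb
    rw [show 3 * r = r + r + r by ring]
    exact mul_mem_mfilt (by linarith) hr (mul_mem_mfilt hr hr ha h2) hb
  exact blk_mem_mfilt (add_mem_mfilt (one_mem_mfilt (by linarith) n) (key hf hf)) (key hf h1)
    (key h1 hf) (key h1 h1)

/-- `diffIdem e f` is a quasi-idempotent which is homotopic to `diag(e, 1 - f)`. -/
theorem diffIdem_htpy {ε r N : ℝ} (hε : 0 < ε) (hε1 : ε ≤ 1) (hr : 0 < r) (hN : 1 ≤ N)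
    {e f : Matrix (Fin n) (Fin n) U} (he : e ∈ X.Idem ε r N n) (hf : f ∈ X.Idem ε r N n) :
    diffIdem e f ∈ X.Idem (250 * N ^ 4 * ε) (3 * r) (20 * N ^ 3) (n + n) ∧
      X.IdemHtpy (300 * N ^ 4 * ε) (3 * r) (20 * N ^ 3) (n + n) (bdiag e (1 - f))
        (diffIdem e f) := by
  letI := X.topo (n + n)
  have hN2 : 1 ≤ N ^ 2 := one_le_pow₀ hN
  have hN3 : N ≤ N ^ 3 := le_self_pow₀ hN (by norm_num)
  have hN4 : N ^ 2 ≤ N ^ 4 := pow_le_pow_right₀ hN (by norm_num)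
  have hN4' : N ≤ N ^ 4 := le_self_pow₀ hN (by norm_num)
  have hp2 : N ^ 2 * ε ≤ N ^ 4 * ε := mul_le_mul_of_nonneg_right hN4 hε.le
  have hp1 : N * ε ≤ N ^ 4 * ε := mul_le_mul_of_nonneg_right hN4' hε.le
  have hp0 : 0 < N ^ 4 * ε := by positivity
  have hq : N ^ 2 * ε * ε ≤ N ^ 4 * ε := by
    refine (mul_le_of_le_one_right (by positivity) hε1).trans hp2
  have hNε : N * ε ≤ N := mul_le_of_le_one_right (by linarith) hε1
  have hclose := nrm_diffIdem_sub_le (e := e) hε hN hf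
  have h01 := rotConj_mem_idem hε hε1 hr hN he hf (show (0 : ℝ) ^ 2 + 1 ^ 2 = 1 by norm_num)
  have hd : diffIdem e f ∈ X.Idem (250 * N ^ 4 * ε) (3 * r) (20 * N ^ 3) (n + n) := by
    refine mem_idem_of_close h01 (diffIdem_mem_mfilt hr he.1 hf.1) hclose ?_ ?_
    -- Perturbing `(50N⁴ε, 3r, 13N³)` by `η = 5Nε`: the defect is at most `50N⁴ε` plus this
    -- quantity, together at most `210N⁴ε`, and the norms are at most `18N³`.
    · have : 5 * N * ε * (2 * (13 * N ^ 3) + 5 * N * ε + 1) =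
          130 * (N ^ 4 * ε) + 25 * (N ^ 2 * ε * ε) + 5 * (N * ε) := by ring
      rw [this]
      linarith
    · linarith
  -- The homotopy rotates by a quarter turn, from the identity matrix to `rot f 0 1`, and then
  -- follows a straight segment to `diffIdem e f`.
  refine ⟨hd, JoinedIn.trans (y := rotConj e f 0 1) ?_ ?_⟩
  · refine JoinedIn.ofLine (f := fun t => rotConj e f (Real.cos (Real.pi / 2 * t))
      (Real.sin (Real.pi / 2 * t))) ?_ ?_ ?_ ?_
    · have h1 := continuous_rot (X := X) f 1
      have h2 := continuous_rot (X := X) f (-1)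
      simp only [one_mul, neg_mul] at h1 h2
      exact (continuous_mul_path (continuous_mul_path h1 continuous_const) h2).continuousOn
    · simp [rotConj, rot, blk_one]
    · simp
    · rintro _ ⟨t, -, rfl⟩
      refine idem_mono ?_ le_rfl ?_ _ (rotConj_mem_idem hε hε1 hr hN he hf
        (Real.cos_sq_add_sin_sq _))
      · linarith
      · linarith
  · refine idemHtpy_of_close (idem_mono ?_ le_rfl ?_ _ h01) hd hclose ?_
    · linarith
    · linarith
    · nlinarith

end QAlg
end QK

/-! ### Classes of matrices, and homomorphisms out of the quantitative K-groups -/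

namespace QK

namespace StableSystem

variable {U : Type*} [Ring U] {T : StableSystem U}

theorem cls_eq_of_H {n : ℕ} {x y : Matrix (Fin n) (Fin n) U} {hx : x ∈ T.S n} {hy : y ∈ T.S n}
    (h : T.H n x y) : T.cls x hx = T.cls y hy :=
  Quotient.sound ⟨n, le_rfl, le_rfl, by simpa [pad_self] using h⟩

/-- The bijection `g` is a special case of an embedding of index sets. Two sizes `n` and `m` are
allowed so that sums bracketed in different ways can be compared without casts. -/
theorem cls_reindex {n m : ℕ} (g : Fin n ≃ Fin m) {x : Matrix (Fin m) (Fin m) U} {hx : x ∈ T.S m}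
    {h : x.submatrix g g ∈ T.S n} : T.cls (x.submatrix g g) h = T.cls x hx :=
  Quotient.sound (T.rel_of_embed h hx g g.injective (fun _ _ => rfl) (by
    rintro a b (h | h) <;> exact absurd (g.surjective _) h))

theorem cls_diagonal {n : ℕ} {h : (Matrix.diagonal fun _ : Fin n => T.d) ∈ T.S n} :
    T.cls (Matrix.diagonal fun _ : Fin n => T.d) h = 0 := by
  refine Quotient.sound ⟨n, le_rfl, Nat.zero_le _, ?_⟩
  have : pad T.d n T.zeroElt.2.1 = Matrix.diagonal fun _ : Fin n => T.d := by
    ext i j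
    simp [pad, zeroElt, Matrix.diagonal_apply]
  rw [this, pad_self]
  exact T.H_diag n

/-- A homotopy invariant additive function of matrices defines a homomorphism on stable classes. -/
def liftCls {G : Type*} [AddCommMonoid G] (φ : ∀ n (x : Matrix (Fin n) (Fin n) U), x ∈ T.S n → G)
    (hadd : ∀ {n m x y} (hx : x ∈ T.S n) (hy : y ∈ T.S m),
      φ (n + m) (bdiag x y) (T.S_bdiag hx hy) = φ n x hx + φ m y hy)
    (hH : ∀ {n x y} (hx : x ∈ T.S n) (hy : y ∈ T.S n), T.H n x y → φ n x hx = φ n y hy)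
    (h0 : ∀ n, φ n (Matrix.diagonal fun _ => T.d) (T.S_diag n) = 0) : T.Cls →+ G where
  toFun := Quotient.lift (fun x => φ x.1 x.2.1 x.2.2) (by
    -- Enlarging a matrix adds a diagonal block of copies of `d`, on which `φ` vanishes.
    have key : ∀ {n K : ℕ} {x : Matrix (Fin n) (Fin n) U} (h : n ≤ K) (hx : x ∈ T.S n),
        φ K (pad T.d K x) (T.S_pad h hx) = φ n x hx := by
      intro n K x h hx
      obtain ⟨k, rfl⟩ := Nat.exists_eq_add_of_le h
      simp only [pad_eq_bdiag]
      rw [hadd hx (T.S_diag k), h0, add_zero]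
    rintro ⟨n, x, hx⟩ ⟨m, y, hy⟩ ⟨K, h1, h2, h3⟩
    change φ n x hx = φ m y hy
    rw [← key h1 hx, ← key h2 hy]
    exact hH _ _ h3)
  map_zero' := h0 0
  map_add' := by
    rintro ⟨n, x, hx⟩ ⟨m, y, hy⟩
    exact hadd hx hy

theorem addHom_ext {G : Type*} [AddZeroClass G] {f g : T.Cls →+ G}
    (h : ∀ {n} (x : Matrix (Fin n) (Fin n) U) (hx : x ∈ T.S n), f (T.cls x hx) = g (T.cls x hx)) :
    f = g := by
  ext ⟨n, x, hx⟩
  exact h x hx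

end StableSystem

namespace QAlg

open scoped ENNReal

variable {p : ℝ≥0∞} [Fact (1 ≤ p)] {U V : Type*} [Ring U] [Algebra ℂ U] [Ring V] [Algebra ℂ V]
  {X : QAlg p U} {Y : QAlg p V} {P Q : Param} {n m : ℕ}

/-- The class in `K_0` of a quasi-idempotent. -/
noncomputable def idemCls (X : QAlg p U) (P : Param) (e : Matrix (Fin n) (Fin n) U)
    (he : e ∈ X.Idem P.ε P.r P.N n) : X.KU 0 P :=
  (Algebra.GrothendieckAddGroup.of ((X.idemSystem P).cls e he) :
    Algebra.GrothendieckAddGroup (X.idemSystem P).Cls)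

theorem mem_qInv {ε r N : ℝ} {u v : Matrix (Fin n) (Fin n) U} (h : (u, v) ∈ X.InvPair ε r N n) :
    u ∈ X.QInv ε r N n := ⟨v, h⟩

/-- The class in `K_1` of a quasi-invertible. -/
def glCls (X : QAlg p U) (P : Param) (u : Matrix (Fin n) (Fin n) U)
    (hu : u ∈ X.QInv P.ε P.r P.N n) : X.KU 1 P :=
  (X.glSystem P).cls u hu

section classes

theorem idemCls_bdiag {x : Matrix (Fin n) (Fin n) U} {y : Matrix (Fin m) (Fin m) U}
    (hx : x ∈ X.Idem P.ε P.r P.N n) (hy : y ∈ X.Idem P.ε P.r P.N m) :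
    X.idemCls P (bdiag x y) (idem_bdiag hx hy) = X.idemCls P x hx + X.idemCls P y hy :=
  map_add (Algebra.GrothendieckAddGroup.of (M := (X.idemSystem P).Cls))
    ((X.idemSystem P).cls x hx) ((X.idemSystem P).cls y hy)

theorem idemCls_eq {x y : Matrix (Fin n) (Fin n) U} (hx : x ∈ X.Idem P.ε P.r P.N n)
    (hy : y ∈ X.Idem P.ε P.r P.N n) (h : X.IdemHtpy (4 * P.ε) P.r (4 * P.N) n x y) :
    X.idemCls P x hx = X.idemCls P y hy :=
  congrArg (Algebra.GrothendieckAddGroup.of (M := (X.idemSystem P).Cls))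
    (StableSystem.cls_eq_of_H (T := X.idemSystem P) h)

theorem idemCls_congr {x y : Matrix (Fin n) (Fin n) U} (h : x = y) (hx : x ∈ X.Idem P.ε P.r P.N n)
    (hy : y ∈ X.Idem P.ε P.r P.N n) : X.idemCls P x hx = X.idemCls P y hy := by
  subst h; rfl

theorem idemCls_reindex (g : Fin n ≃ Fin m) {x : Matrix (Fin m) (Fin m) U}
    (hx : x ∈ X.Idem P.ε P.r P.N m) (h : x.submatrix g g ∈ X.Idem P.ε P.r P.N n) :
    X.idemCls P (x.submatrix g g) h = X.idemCls P x hx :=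
  congrArg (Algebra.GrothendieckAddGroup.of (M := (X.idemSystem P).Cls))
    (StableSystem.cls_reindex (T := X.idemSystem P) g)

theorem idemCls_zero (h : (0 : Matrix (Fin n) (Fin n) U) ∈ X.Idem P.ε P.r P.N n) :
    X.idemCls P 0 h = 0 := by
  have h0 : (Matrix.diagonal fun _ : Fin n => (0 : U)) = 0 := Matrix.diagonal_zero
  rw [← idemCls_congr h0 (by rwa [h0]) h]
  exact (congrArg (Algebra.GrothendieckAddGroup.of (M := (X.idemSystem P).Cls))
    (StableSystem.cls_diagonal (T := X.idemSystem P))).trans (map_zero _)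

/-- By the universal property of the Grothendieck group, a homomorphism to a group is determined by
its values on the classes of single quasi-idempotents. -/
theorem KU_zero_hom_ext {G : Type*} [AddCommGroup G] {f g : X.KU 0 P →+ G}
    (h : ∀ {n} (e : Matrix (Fin n) (Fin n) U) (he : e ∈ X.Idem P.ε P.r P.N n),
      f (X.idemCls P e he) = g (X.idemCls P e he)) : f = g := by
  refine (Algebra.GrothendieckAddGroup.lift (M := (X.idemSystem P).Cls)).symm.injective ?_
  refine StableSystem.addHom_ext fun x hx => ?_
  exact h x hx

theorem glCls_bdiag {x : Matrix (Fin n) (Fin n) U} {y : Matrix (Fin m) (Fin m) U}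
    (hx : x ∈ X.QInv P.ε P.r P.N n) (hy : y ∈ X.QInv P.ε P.r P.N m)
    (h : bdiag x y ∈ X.QInv P.ε P.r P.N (n + m)) :
    X.glCls P (bdiag x y) h = X.glCls P x hx + X.glCls P y hy := rfl

theorem glCls_eq {x y : Matrix (Fin n) (Fin n) U} (hx : x ∈ X.QInv P.ε P.r P.N n)
    (hy : y ∈ X.QInv P.ε P.r P.N n) (h : X.GLHtpy (4 * P.ε) (2 * P.r) (4 * P.N) n x y) :
    X.glCls P x hx = X.glCls P y hy :=
  StableSystem.cls_eq_of_H (T := X.glSystem P) h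

theorem glCls_congr {x y : Matrix (Fin n) (Fin n) U} (h : x = y) (hx : x ∈ X.QInv P.ε P.r P.N n)
    (hy : y ∈ X.QInv P.ε P.r P.N n) : X.glCls P x hx = X.glCls P y hy := by
  subst h; rfl

theorem glCls_one (h : (1 : Matrix (Fin n) (Fin n) U) ∈ X.QInv P.ε P.r P.N n) :
    X.glCls P 1 h = 0 := by
  have h0 : (Matrix.diagonal fun _ : Fin n => (1 : U)) = 1 := Matrix.diagonal_one
  rw [← glCls_congr h0 (by rwa [h0]) h]
  exact StableSystem.cls_diagonal (T := X.glSystem P)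

theorem KU_one_hom_ext {G : Type*} [AddCommGroup G] {f g : X.KU 1 P →+ G}
    (h : ∀ {n} (e : Matrix (Fin n) (Fin n) U) (he : e ∈ X.QInv P.ε P.r P.N n),
      f (X.glCls P e he) = g (X.glCls P e he)) : f = g :=
  StableSystem.addHom_ext (T := X.glSystem P) (f := f) (g := g) fun x hx => h x hx

theorem kuMap_idemCls {φ : U →ₐ[ℂ] V} {c : ℝ} (h : Bdd X Y φ c) (hPQ : Scaled c P Q)
    {e : Matrix (Fin n) (Fin n) U} (he : e ∈ X.Idem P.ε P.r P.N n) :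
    kuMap h hPQ 0 (X.idemCls P e he) = Y.idemCls Q (e.map φ)
      (h.idem P.r_pos hPQ.ε_le hPQ.r_le hPQ.N_le he) :=
  DFunLike.congr_fun (Algebra.GrothendieckAddGroup.lift.symm_apply_apply
    (Algebra.GrothendieckAddGroup.of.comp (idemMap h hPQ))) ((X.idemSystem P).cls e he)

theorem Bdd.qInv {φ : U →ₐ[ℂ] V} {c : ℝ} (h : Bdd X Y φ c) (hPQ : Scaled c P Q)
    {u : Matrix (Fin n) (Fin n) U} (hu : u ∈ X.QInv P.ε P.r P.N n) :
    u.map φ ∈ Y.QInv Q.ε Q.r Q.N n := by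
  obtain ⟨v, hv⟩ := hu
  exact ⟨_, h.invPair P.r_pos hPQ.ε_le hPQ.r_le hPQ.N_le hv⟩

theorem kuMap_glCls {φ : U →ₐ[ℂ] V} {c : ℝ} (h : Bdd X Y φ c) (hPQ : Scaled c P Q)
    {u : Matrix (Fin n) (Fin n) U} (hu : u ∈ X.QInv P.ε P.r P.N n) :
    kuMap h hPQ 1 (X.glCls P u hu) = Y.glCls Q (u.map φ) (h.qInv hPQ hu) := rfl

end classes

/-! ### Homotopies of quasi-invertibles -/

section invertibles

variable {ε r N η : ℝ}

theorem nrm_convex_lt {t : ℝ} (ht : t ∈ Set.Icc (0 : ℝ) 1) {x y : Matrix (Fin n) (Fin n) U}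
    (hx : X.nrm n x < ε) (hy : X.nrm n y < ε) :
    X.nrm n (((1 - t : ℝ) : ℂ) • x + (t : ℂ) • y) < ε := by
  refine (norm_convex ht le_rfl le_rfl).trans_lt ?_
  rcases ht.1.eq_or_lt with h | h
  · rw [← h]; simpa using hx
  · have := mul_lt_mul_of_pos_left hy h
    have := mul_le_mul_of_nonneg_left hx.le (sub_nonneg.2 ht.2)
    linarith

/-- Two quasi-inverses of the same element are homotopic. -/
theorem joinedIn_invPair {u v v' : Matrix (Fin n) (Fin n) U} (h : (u, v) ∈ X.InvPair ε r N n)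
    (h' : (u, v') ∈ X.InvPair ε r N n) :
    @JoinedIn _ (@instTopologicalSpaceProd _ _ (X.topo n) (X.topo n)) (X.InvPair ε r N n)
      (u, v) (u, v') := by
  letI := X.topo n
  -- For fixed `u` the conditions on a quasi-inverse are convex, so the segment from `v` to `v'`
  -- stays inside at no cost in the parameters.
  refine JoinedIn.ofLine (f := fun t => (u, ((1 - t : ℝ) : ℂ) • v + (t : ℂ) • v'))
    (continuous_const.prodMk (continuous_segment v v')).continuousOn (by simp) (by simp) ?_
  rintro _ ⟨t, ht, rfl⟩
  obtain ⟨a1, a2, a3, a4, a5, a6⟩ := h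
  obtain ⟨b1, b2, b3, b4, b5, b6⟩ := h'
  refine ⟨a1, add_mem_mfilt (smul_mem_mfilt _ a2) (smul_mem_mfilt _ b2), ?_, ?_, a5, ?_⟩
  · refine lt_of_eq_of_lt (congrArg _ ?_) (nrm_convex_lt ht a3 b3)
    simp only [mul_add, mul_smul_comm]
    push_cast
    module
  · refine lt_of_eq_of_lt (congrArg _ ?_) (nrm_convex_lt ht a4 b4)
    simp only [add_mul, smul_mul_assoc]
    push_cast
    module
  · refine (norm_convex ht a6 b6).trans (le_of_eq ?_)
    ring

theorem glHtpy_mono {ε' r' N' : ℝ} (h1 : ε ≤ ε') (h2 : r ≤ r') (h3 : N ≤ N')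
    {x y : Matrix (Fin n) (Fin n) U} (h : X.GLHtpy ε r N n x y) : X.GLHtpy ε' r' N' n x y := by
  letI := X.topo n
  obtain ⟨a, b, h⟩ := h
  exact ⟨a, b, h.mono (invPair_mono h1 h2 h3 n)⟩

theorem idemHtpy_mono {ε' r' N' : ℝ} (h1 : ε ≤ ε') (h2 : r ≤ r') (h3 : N ≤ N')
    {x y : Matrix (Fin n) (Fin n) U} (h : X.IdemHtpy ε r N n x y) : X.IdemHtpy ε' r' N' n x y := by
  letI := X.topo n
  exact JoinedIn.mono h (idem_mono h1 h2 h3 n)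

theorem invPair_mul {a a' b b' : Matrix (Fin n) (Fin n) U} (hr : 0 < r)
    (hN1 : 1 ≤ N) (ha : (a, a') ∈ X.InvPair ε r N n) (hb : (b, b') ∈ X.InvPair ε r N n) :
    (a * b, b' * a') ∈ X.InvPair (2 * N ^ 2 * ε) (2 * r) (N ^ 2) n := by
  obtain ⟨a1, a2, a3, a4, a5, a6⟩ := ha
  obtain ⟨b1, b2, b3, b4, b5, b6⟩ := hb
  have hε : 0 ≤ ε := (apply_nonneg _ _).trans a3.le
  have hN2 : ε ≤ N ^ 2 * ε := le_mul_of_one_le_left hε (one_le_pow₀ hN1)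
  refine ⟨?_, ?_, ?_, ?_, ?_, ?_⟩
  · rw [two_mul]; exact mul_mem_mfilt hr hr a1 b1
  · rw [two_mul]; exact mul_mem_mfilt hr hr b2 a2
  · have e1 : a * b * (b' * a') - 1 = a * (b * b' - 1) * a' + (a * a' - 1) := by noncomm_ring
    have e2 := nrm_mul_le (nrm_mul_le a5 b3.le) a6
    have := map_add_le_add (X.nrm n) (a * (b * b' - 1) * a') (a * a' - 1)
    rw [e1]
    nlinarith
  · have e1 : b' * a' * (a * b) - 1 = b' * (a' * a - 1) * b + (b' * b - 1) := by noncomm_ring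
    have e2 := nrm_mul_le (nrm_mul_le b6 a4.le) b5
    have := map_add_le_add (X.nrm n) (b' * (a' * a - 1) * b) (b' * b - 1)
    rw [e1]
    nlinarith
  · rw [sq]; exact nrm_mul_le a5 b5
  · rw [sq]; exact nrm_mul_le b6 a6

/-- The same quasi-inverse `x'` serves along the whole segment from `x` to `y`. Its norm is at most
`N`, which accounts for the extra defect `N η`; no quasi-inverse of `y` has to be given. -/
theorem glHtpy_of_close {x x' y : Matrix (Fin n) (Fin n) U} (hx : (x, x') ∈ X.InvPair ε r N n)
    (hy : y ∈ X.mfilt r n) (hyN : X.nrm n y ≤ N) (hη : X.nrm n (y - x) ≤ η) (hη0 : 0 ≤ η) {ε' : ℝ}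
    (h1 : ε + N * η ≤ ε') : X.GLHtpy ε' r N n x y := by
  letI := X.topo n
  obtain ⟨a1, a2, a3, a4, a5, a6⟩ := hx
  have hN : 0 ≤ N := (apply_nonneg _ _).trans a5
  refine ⟨x', x', JoinedIn.ofLine (f := fun t => (((1 - t : ℝ) : ℂ) • x + (t : ℂ) • y, x'))
    ((continuous_segment x y).prodMk continuous_const).continuousOn (by simp) (by simp) ?_⟩
  have hNη : 0 ≤ N * η := mul_nonneg hN hη0
  have b3 : X.nrm n (y * x' - 1) < ε + N * η := by
    rw [show y * x' - 1 = (x * x' - 1) + (y - x) * x' by noncomm_ring]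
    have := map_add_le_add (X.nrm n) (x * x' - 1) ((y - x) * x')
    have := nrm_mul_le hη a6
    linarith
  have b4 : X.nrm n (x' * y - 1) < ε + N * η := by
    rw [show x' * y - 1 = (x' * x - 1) + x' * (y - x) by noncomm_ring]
    have := map_add_le_add (X.nrm n) (x' * x - 1) (x' * (y - x))
    have := nrm_mul_le a6 hη
    linarith
  rintro _ ⟨t, ht, rfl⟩
  refine ⟨add_mem_mfilt (smul_mem_mfilt _ a1) (smul_mem_mfilt _ hy), a2, ?_, ?_, ?_, a6⟩
  · refine lt_of_lt_of_le (lt_of_eq_of_lt (congrArg _ ?_)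
      (nrm_convex_lt ht (lt_of_lt_of_le a3 (le_add_of_nonneg_right hNη)) b3)) h1
    simp only [add_mul, smul_mul_assoc]
    push_cast
    module
  · refine lt_of_lt_of_le (lt_of_eq_of_lt (congrArg _ ?_)
      (nrm_convex_lt ht (lt_of_lt_of_le a4 (le_add_of_nonneg_right hNη)) b4)) h1
    simp only [mul_add, mul_smul_comm]
    push_cast
    module
  · refine (norm_convex ht a5 hyN).trans (le_of_eq ?_)
    ring

/-- If `w g` is close to `u`, then `diag(w, g)` is homotopic to `diag(u, 1)`. -/
theorem glHtpy_bdiag_mul (hε : 0 < ε) (hr : 0 < r) (hN : 1 ≤ N)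
    {w w' g g' u : Matrix (Fin n) (Fin n) U} (hw : (w, w') ∈ X.InvPair ε r N n)
    (hg : (g, g') ∈ X.InvPair ε r N n) (hu : u ∈ X.mfilt r n) (huN : X.nrm n u ≤ N)
    (hη : X.nrm n (u - w * g) ≤ η) (hη0 : 0 ≤ η) :
    X.GLHtpy (128 * N ^ 2 * ε + N ^ 2 * η) (4 * r) (16 * N ^ 2) (n + n) (bdiag w g)
      (bdiag u 1) := by
  letI := X.topo (n + n)
  have hB := blockSwap_invol (n := n)
  have h1 := invPair_one (X := X) hε hr hN n
  have hN1 : N ≤ N ^ 2 := le_self_pow₀ hN (by norm_num)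
  have hN2 : 0 ≤ N ^ 2 * ε := by positivity
  have hN3 : 0 ≤ N ^ 2 * η := by positivity
  refine glHtpy_trans (y := bdiag (w * g) 1) ?_ ?_
  · refine ⟨bdiag w' g', bdiag (g' * w') 1, ?_⟩
    have e0 : bdiag w g = bdiag w 1 * bdiag 1 g := by rw [bdiag_mul, mul_one, one_mul]
    have e0' : bdiag w' g' = bdiag 1 g' * bdiag w' 1 := by rw [bdiag_mul, mul_one, one_mul]
    have e1 : bdiag (w * g) (1 : Matrix (Fin n) (Fin n) U) = bdiag w 1 * bdiag g 1 := by
      rw [bdiag_mul, mul_one]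
    have e1' : bdiag (g' * w') (1 : Matrix (Fin n) (Fin n) U) = bdiag g' 1 * bdiag w' 1 := by
      rw [bdiag_mul, mul_one]
    -- Whitehead's rotation: `diag(w, g) = diag(w, 1) diag(1, g)`, and the second factor is rotated
    -- into `diag(g, 1)`, which leads to `diag(wg, 1)`.
    refine JoinedIn.ofLine (f := fun t => (bdiag w 1 * conj (blockSwap n) t (bdiag 1 g),
      conj (blockSwap n) t (bdiag 1 g') * bdiag w' 1)) ?_ ?_ ?_ ?_
    · exact ((continuous_mul_path continuous_const (continuous_conj _)).prodMk
        (continuous_mul_path (continuous_conj _) continuous_const)).continuousOn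
    · simp only [conj_zero, ← e0, ← e0']
    · simp only [conj_at_one hB, bdiag_blockSwap, ← e1, ← e1']
    rintro _ ⟨t, _, rfl⟩
    -- The rotation costs a factor `4` in `ε` and `N` and `2` in `r`; the product formula at these
    -- values gives `2(4N)²(4ε) = 128N²ε`, radius `4r` and norm `16N²`.
    refine invPair_mono ?_ ?_ ?_ _ (invPair_mul (by linarith : 0 < 2 * r)
      (by linarith : 1 ≤ 4 * N) (invPair_mono (le_four hε) (le_two hr) (four_le hN) _
        (invPair_bdiag hw h1)) (conj_mem_invPair hB hε hr (invPair_bdiag h1 hg) t))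
    · nlinarith
    · linarith
    · nlinarith
  -- The remaining segment from `wg` to `u` uses that the quasi-inverse `g'w'` has norm at most
  -- `N²`.
  · have hwg := invPair_mul hr hN hw hg
    have := glHtpy_of_close hwg (mfilt_mono (le_two hr) hu)
      (huN.trans hN1) hη hη0 le_rfl
    refine glHtpy_mono ?_ (by linarith) ?_ (glHtpy_bdiag this
      (glHtpy_refl ⟨1, invPair_one ?_ (by linarith) (one_le_pow₀ hN) n⟩))
    · nlinarith
    · nlinarith
    · have : 0 < N ^ 2 * ε := by positivity
      nlinarith

end invertibles

end QAlg
end QK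

/-! ### Matrices representing the difference of the identity and an idempotent endomorphism -/

namespace QK
namespace QAlg

open scoped ENNReal

variable {p : ℝ≥0∞} [Fact (1 ≤ p)] {U V : Type*} [Ring U] [Algebra ℂ U] [Ring V] [Algebra ℂ V]
  {X : QAlg p U} {Y : QAlg p V} {n m : ℕ}

/-- A homomorphism which does not decrease norms by more than the factor `3` and which reflects
the filtration. -/
structure Emb (Y : QAlg p V) (X : QAlg p U) (j : V →ₐ[ℂ] U) : Prop where
  nrm_le : ∀ n (y : Matrix (Fin n) (Fin n) V), Y.nrm n y ≤ 3 * X.nrm n (y.map j)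
  filt : ∀ r, 0 < r → ∀ y, j y ∈ X.filt r → y ∈ Y.filt r
  inj : Function.Injective j

section emb

variable {j : V →ₐ[ℂ] U} {ε r N : ℝ}

theorem Emb.mfilt (h : Emb Y X j) (hr : 0 < r) {y : Matrix (Fin n) (Fin n) V}
    (hy : y.map j ∈ X.mfilt r n) : y ∈ Y.mfilt r n := fun a b => h.filt r hr _ (hy a b)

theorem Emb.idem (h : Emb Y X j) (hr : 0 < r) {e : Matrix (Fin n) (Fin n) V}
    (he : e.map j ∈ X.Idem ε r N n) : e ∈ Y.Idem (3 * ε) r (3 * N) n := by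
  obtain ⟨a1, a2, a3, a4⟩ := he
  refine ⟨h.mfilt hr a1, ?_, (h.nrm_le n _).trans (by linarith), (h.nrm_le n _).trans ?_⟩
  · refine (h.nrm_le n _).trans_lt ?_
    rw [Matrix.map_sub j (map_sub j), Matrix.map_mul]
    linarith
  · rw [Matrix.map_sub j (map_sub j), Matrix.map_one j (map_zero j) (map_one j)]
    linarith

theorem Emb.invPair (h : Emb Y X j) (hr : 0 < r) {u v : Matrix (Fin n) (Fin n) V}
    (he : (u.map j, v.map j) ∈ X.InvPair ε r N n) : (u, v) ∈ Y.InvPair (3 * ε) r (3 * N) n := by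
  obtain ⟨a1, a2, a3, a4, a5, a6⟩ := he
  refine ⟨h.mfilt hr a1, h.mfilt hr a2, ?_, ?_, (h.nrm_le n _).trans (by linarith),
    (h.nrm_le n _).trans (by linarith)⟩ <;>
  · refine (h.nrm_le n _).trans_lt ?_
    rw [Matrix.map_sub j (map_sub j), Matrix.map_mul, Matrix.map_one j (map_zero j) (map_one j)]
    linarith

/-- The norm on `Y` is dominated by the norm on `X`, so continuity of a path over the ideal can be
checked in the larger algebra, where the formulas are polynomial. -/
theorem Emb.continuous (h : Emb Y X j) {Z : Type*} [TopologicalSpace Z]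
    {f : Z → Matrix (Fin n) (Fin n) V}
    (hf : @Continuous _ _ _ (X.topo n) fun z => (f z).map j) :
    @Continuous _ _ _ (Y.topo n) f := by
  letI := X.sng n
  letI := Y.sng n
  refine continuous_iff_continuousAt.2 fun z => ?_
  have h1 : Filter.Tendsto (fun w => (f w).map j) (nhds z) (nhds ((f z).map j)) := hf.tendsto z
  refine tendsto_iff_dist_tendsto_zero.2 ?_
  refine squeeze_zero (fun _ => dist_nonneg) (fun w => ?_)
    (by simpa using (tendsto_iff_dist_tendsto_zero.1 h1).const_mul 3)
  rw [dist_eq_norm, dist_eq_norm, ← Matrix.map_sub j (map_sub j)]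
  exact h.nrm_le n _

end emb

/-- `σ` is an idempotent endomorphism of `X`, and `τ` is the map `id - σ`, with values in an
algebra `Y` which is embedded in `X`. -/
structure Retr (X : QAlg p U) (Y : QAlg p V) (σ : U →ₐ[ℂ] U) (τ : U →ₗ[ℂ] V) : Prop where
  bdd : Bdd X X σ 3
  idem : ∀ x, σ (σ x) = σ x
  exists_emb : ∃ j : V →ₐ[ℂ] U, Emb Y X j ∧ ∀ x, j (τ x) = x - σ x

section formulas

variable (σ : U →ₐ[ℂ] U) (τ : U →ₗ[ℂ] V)

/-- The difference of `e` and `σ e`, as a perturbation of `diag(1, 0)` over `V`. -/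
def retIdem (e : Matrix (Fin n) (Fin n) U) : Matrix (Fin (n + n)) (Fin (n + n)) V :=
  blk (1 + (e.map σ * e * e.map σ).map τ) ((e.map σ * e * (1 - e.map σ)).map τ)
    (((1 - e.map σ) * e * e.map σ).map τ) (((1 - e.map σ) * e * (1 - e.map σ)).map τ)

/-- The quotient of `u` and `σ u`, where `v` is a quasi-inverse of `u`. -/
def retInv (u v : Matrix (Fin n) (Fin n) U) : Matrix (Fin n) (Fin n) V :=
  1 + (u * v.map σ).map τ

/-- A quasi-inverse of `retInv σ τ u v`. -/
def retInv' (u v : Matrix (Fin n) (Fin n) U) : Matrix (Fin n) (Fin n) V :=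
  1 + (u.map σ * v).map τ

variable {σ τ}

theorem map_bdiag_σ (e : Matrix (Fin n) (Fin n) U) (e' : Matrix (Fin m) (Fin m) U) :
    (bdiag e e').map σ = bdiag (e.map σ) (e'.map σ) := bdiag_map _ (map_zero σ) _ _

theorem map_bdiag_τ (e : Matrix (Fin n) (Fin n) U) (e' : Matrix (Fin m) (Fin m) U) :
    (bdiag e e').map τ = bdiag (e.map τ) (e'.map τ) := bdiag_map _ (map_zero τ) _ _

/-- The formula is applied blockwise; only the order of the basis vectors changes. -/
theorem retIdem_bdiag (e : Matrix (Fin n) (Fin n) U) (e' : Matrix (Fin m) (Fin m) U) :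
    retIdem σ τ (bdiag e e') = (bdiag (retIdem σ τ e) (retIdem σ τ e')).submatrix
      (middleSwap n m) (middleSwap n m) := by
  simp only [retIdem, ← blk_bdiag, map_bdiag_σ, map_bdiag_τ, ← bdiag_one (n := n) (m := m),
    bdiag_mul, bdiag_sub, bdiag_add]

theorem retInv_bdiag (u v : Matrix (Fin n) (Fin n) U) (u' v' : Matrix (Fin m) (Fin m) U) :
    retInv σ τ (bdiag u u') (bdiag v v') = bdiag (retInv σ τ u v) (retInv σ τ u' v') := by
  simp only [retInv, map_bdiag_σ, map_bdiag_τ, ← bdiag_one (n := n) (m := m), bdiag_mul, bdiag_add]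

theorem retIdem_zero : retIdem σ τ (0 : Matrix (Fin n) (Fin n) U) = bdiag 1 0 := by
  have h0 : (0 : Matrix (Fin n) (Fin n) U).map τ = 0 := Matrix.map_zero _ (map_zero τ)
  simp only [retIdem, mul_zero, zero_mul, h0, add_zero, bdiag_eq_blk]

/-- Naturality in the target: `V` enters the formula only through the values of `τ` and the unit
matrix. With `φ` the embedding into `U`, this transfers estimates from `U` to `V`; with `φ`
annihilating `τ`, it gives the trivial invertible. -/
theorem retInv_map {W : Type*} [Ring W] [Algebra ℂ W] {τ' : U →ₗ[ℂ] W} (φ : V →ₐ[ℂ] W)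
    (h : ∀ x, φ (τ x) = τ' x) (u v : Matrix (Fin n) (Fin n) U) :
    (retInv σ τ u v).map φ = retInv σ τ' u v := by
  have h' : ∀ x : Matrix (Fin n) (Fin n) U, (x.map τ).map φ = x.map τ' := fun x => by
    ext1 a b
    exact h _
  simp only [retInv, Matrix.map_add φ (map_add φ), Matrix.map_one φ (map_zero φ) (map_one φ), h']

theorem retInv'_map {W : Type*} [Ring W] [Algebra ℂ W] {τ' : U →ₗ[ℂ] W} (φ : V →ₐ[ℂ] W)
    (h : ∀ x, φ (τ x) = τ' x) (u v : Matrix (Fin n) (Fin n) U) :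
    (retInv' σ τ u v).map φ = retInv' σ τ' u v := by
  have h' : ∀ x : Matrix (Fin n) (Fin n) U, (x.map τ).map φ = x.map τ' := fun x => by
    ext1 a b
    exact h _
  simp only [retInv', Matrix.map_add φ (map_add φ), Matrix.map_one φ (map_zero φ) (map_one φ), h']

theorem retIdem_map {W : Type*} [Ring W] [Algebra ℂ W] {τ' : U →ₗ[ℂ] W} (φ : V →ₐ[ℂ] W)
    (h : ∀ x, φ (τ x) = τ' x) (e : Matrix (Fin n) (Fin n) U) :
    (retIdem σ τ e).map φ = retIdem σ τ' e := by
  have h' : ∀ x : Matrix (Fin n) (Fin n) U, (x.map τ).map φ = x.map τ' := fun x => by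
    ext1 a b
    exact h _
  simp only [retIdem, blk_map, Matrix.map_add φ (map_add φ),
    Matrix.map_one φ (map_zero φ) (map_one φ), h']

section comap

variable {W : Type*} [Ring W] [Algebra ℂ W] {σ' : W →ₐ[ℂ] W} {τ' : W →ₗ[ℂ] V} (ψ : W →ₐ[ℂ] U)
  (hσ : ∀ x, σ (ψ x) = ψ (σ' x)) (hτ : ∀ x, τ (ψ x) = τ' x)
include hσ hτ

/-- Naturality in the source: when `ψ` intertwines the endomorphisms, products formed before or
after applying `ψ` agree. -/
theorem retIdem_comap (e : Matrix (Fin n) (Fin n) W) :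
    retIdem σ τ (e.map ψ) = retIdem σ' τ' e := by
  have h1 : ∀ x : Matrix (Fin n) (Fin n) W, (x.map ψ).map σ = (x.map σ').map ψ := fun x => by
    ext1 a b
    exact hσ _
  have h2 : ∀ x : Matrix (Fin n) (Fin n) W, (x.map ψ).map τ = x.map τ' := fun x => by
    ext1 a b
    exact hτ _
  simp only [retIdem, h1, ← Matrix.map_one ψ (map_zero ψ) (map_one ψ), ← Matrix.map_mul,
    ← Matrix.map_sub ψ (map_sub ψ), h2]

theorem retInv_comap (u v : Matrix (Fin n) (Fin n) W) :
    retInv σ τ (u.map ψ) (v.map ψ) = retInv σ' τ' u v := by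
  have h1 : ∀ x : Matrix (Fin n) (Fin n) W, (x.map ψ).map σ = (x.map σ').map ψ := fun x => by
    ext1 a b
    exact hσ _
  have h2 : ∀ x : Matrix (Fin n) (Fin n) W, (x.map ψ).map τ = x.map τ' := fun x => by
    ext1 a b
    exact hτ _
  simp only [retInv, h1, ← Matrix.map_mul, h2]

end comap

/-- Put `f = σ(e)`. As `σ` is multiplicative and fixes `f`, one has `f e f - σ(f e f) = f (e - f)
f`, and likewise for the other blocks. Writing the blocks through `τ` gives the formula a meaning
over the ideal, where `e` and `f` themselves need not live. -/
theorem retIdem_eq_diffIdem {τ : U →ₗ[ℂ] U} (hσ : ∀ x, σ (σ x) = σ x) (hτ : ∀ x, τ x = x - σ x)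
    (e : Matrix (Fin n) (Fin n) U) : retIdem σ τ e = diffIdem e (e.map σ) := by
  have h1 : ∀ x : Matrix (Fin n) (Fin n) U, x.map τ = x - x.map σ := fun x => by
    ext1 a b
    exact hτ _
  have h2 : (e.map σ).map σ = e.map σ := by
    ext1 a b
    exact hσ _
  simp only [retIdem, diffIdem, h1, Matrix.map_mul, Matrix.map_sub σ (map_sub σ), h2,
    Matrix.map_one σ (map_zero σ) (map_one σ)]
  congr 1 <;> noncomm_ring

/-- Here `σ(u σ(v)) = σ(u) σ(v)`, so the result is `u σ(v)` corrected by the small term `1 - σ(u)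
σ(v)`. The correction makes it exactly congruent to `1` modulo the range of `τ`. -/
theorem retInv_eq {τ : U →ₗ[ℂ] U} (hσ : ∀ x, σ (σ x) = σ x) (hτ : ∀ x, τ x = x - σ x)
    (u v : Matrix (Fin n) (Fin n) U) :
    retInv σ τ u v = u * v.map σ + (1 - u.map σ * v.map σ) := by
  have h1 : ∀ x : Matrix (Fin n) (Fin n) U, x.map τ = x - x.map σ := fun x => by
    ext1 a b
    exact hτ _
  have h2 : (v.map σ).map σ = v.map σ := by
    ext1 a b
    exact hσ _
  rw [retInv, h1, Matrix.map_mul, h2]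
  abel

theorem retInv'_eq {τ : U →ₗ[ℂ] U} (hσ : ∀ x, σ (σ x) = σ x) (hτ : ∀ x, τ x = x - σ x)
    (u v : Matrix (Fin n) (Fin n) U) :
    retInv' σ τ u v = u.map σ * v + (1 - u.map σ * v.map σ) := by
  have h1 : ∀ x : Matrix (Fin n) (Fin n) U, x.map τ = x - x.map σ := fun x => by
    ext1 a b
    exact hτ _
  have h2 : (u.map σ).map σ = u.map σ := by
    ext1 a b
    exact hσ _
  rw [retInv', h1, Matrix.map_mul, h2]
  abel

end formulas

namespace Retr

variable {σ : U →ₐ[ℂ] U} {τ : U →ₗ[ℂ] V} {ε r N : ℝ}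

theorem τ_eq_zero (R : Retr X Y σ τ) {x : U} (h : σ x = x) : τ x = 0 := by
  obtain ⟨j, hj, hτ⟩ := R.exists_emb
  exact hj.inj (by rw [hτ, h, sub_self, map_zero])

theorem σ_idem (R : Retr X Y σ τ) (hr : 0 < r) {e : Matrix (Fin n) (Fin n) U}
    (he : e ∈ X.Idem ε r N n) : e.map σ ∈ X.Idem (3 * ε) r (3 * N) n :=
  R.bdd.idem hr le_rfl le_rfl le_rfl he

/-- The estimate of `diffIdem_htpy` is applied at `(3ε, r, 3N)`, since `σ` has bound `3`; returning
to `Y` costs another factor `3`. The resulting constants `182250` and `1620` are rounded up. -/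
theorem retIdem_mem (R : Retr X Y σ τ) (hε : 0 < ε) (hε1 : 3 * ε ≤ 1) (hr : 0 < r) (hN : 1 ≤ N)
    {e : Matrix (Fin n) (Fin n) U} (he : e ∈ X.Idem ε r N n) :
    retIdem σ τ e ∈ Y.Idem (200000 * N ^ 4 * ε) (3 * r) (2000 * N ^ 3) (n + n) := by
  obtain ⟨j, hj, hτ⟩ := R.exists_emb
  have h1 := diffIdem_htpy (by linarith) hε1 hr (by linarith : 1 ≤ 3 * N)
    (idem_mono (by linarith) le_rfl (by linarith) n he) (R.σ_idem hr he)
  have h2 := retIdem_eq_diffIdem (τ := j.toLinearMap ∘ₗ τ) R.idem hτ e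
  have h3 := retIdem_map (σ := σ) (τ := τ) (τ' := j.toLinearMap ∘ₗ τ) j (fun _ => rfl) e
  have h4 := h1.1
  rw [← h2, ← h3] at h4
  have h5 : 0 ≤ N ^ 4 * ε := by positivity
  have h6 : 0 ≤ N ^ 3 := by positivity
  refine idem_mono ?_ le_rfl ?_ _ (hj.idem (by linarith) h4)
  · nlinarith
  · nlinarith

/-- Inside `X` the matrix is a polynomial expression in `e` and `σ(e)`, and `σ` is bounded. -/
theorem continuous_retIdem (R : Retr X Y σ τ) :
    @Continuous _ _ (X.topo n) (Y.topo (n + n)) fun e : Matrix (Fin n) (Fin n) U =>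
      retIdem σ τ e := by
  obtain ⟨j, hj, hτ⟩ := R.exists_emb
  letI := X.topo n
  refine hj.continuous ?_
  simp only [retIdem_map (σ := σ) (τ := τ) (τ' := j.toLinearMap ∘ₗ τ) j (fun _ => rfl),
    retIdem_eq_diffIdem (τ := j.toLinearMap ∘ₗ τ) R.idem hτ, diffIdem, blk_eq_add]
  have hσ := R.bdd.continuous n
  have hb := continuous_bdiag (X := X) n n
  have hp : @Continuous _ _ (X.topo (n + n)) (X.topo (n + n))
      fun x : Matrix (Fin (n + n)) (Fin (n + n)) U => x.submatrix id (blockSwap n) :=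
    cont_of_bound _ 1 fun x y => by
      rw [one_mul]
      exact X.perm_right (blockSwap n) (x - y)
  have key : ∀ {a b : Matrix (Fin n) (Fin n) U → Matrix (Fin n) (Fin n) U}, Continuous a →
      Continuous b → Continuous fun e => a e * (e - e.map σ) * b e := by
    intro a b ha hb
    letI := X.srng n
    have hs : Continuous fun e : Matrix (Fin n) (Fin n) U => e - e.map σ :=
      Continuous.sub (G := Matrix (Fin n) (Fin n) U) continuous_id hσ
    exact Continuous.mul (M := Matrix (Fin n) (Fin n) U)
      (Continuous.mul (M := Matrix (Fin n) (Fin n) U) ha hs) hb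
  have hg : Continuous fun e : Matrix (Fin n) (Fin n) U => 1 - e.map σ := by
    letI := X.srng n
    exact Continuous.sub (G := Matrix (Fin n) (Fin n) U) continuous_const hσ
  have h1 : Continuous fun e : Matrix (Fin n) (Fin n) U =>
      1 + e.map σ * (e - e.map σ) * e.map σ := by
    letI := X.srng n
    exact Continuous.add (M := Matrix (Fin n) (Fin n) U) continuous_const (key hσ hσ)
  letI := X.srng (n + n)
  exact Continuous.add (M := Matrix (Fin (n + n)) (Fin (n + n)) U)
    (hb.comp (h1.prodMk (key hg hg))) (hp.comp (hb.comp ((key hσ hg).prodMk (key hg hσ))))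

theorem retIdem_htpy (R : Retr X Y σ τ) (hε : 0 < ε) (hε1 : 3 * ε ≤ 1) (hr : 0 < r) (hN : 1 ≤ N)
    {e e' : Matrix (Fin n) (Fin n) U} (h : X.IdemHtpy ε r N n e e') :
    Y.IdemHtpy (200000 * N ^ 4 * ε) (3 * r) (2000 * N ^ 3) (n + n) (retIdem σ τ e)
      (retIdem σ τ e') := by
  letI := X.topo n
  letI := Y.topo (n + n)
  refine (JoinedIn.map h R.continuous_retIdem).mono ?_
  rintro _ ⟨a, ha, rfl⟩
  exact R.retIdem_mem hε hε1 hr hN ha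

/-- Up to the correction `1 - σ(u)σ(v)`, of norm at most `3ε`, the two elements are `u σ(v)` and
`σ(u) v`, which are quasi-inverse to each other. The estimates are made in `X` and carried to `Y`
with the factor `3`. -/
theorem retInv_mem (R : Retr X Y σ τ) (hε : 0 < ε) (hε1 : 3 * ε ≤ 1) (hr : 0 < r) (hN : 1 ≤ N)
    {u v : Matrix (Fin n) (Fin n) U} (h : (u, v) ∈ X.InvPair ε r N n) :
    (retInv σ τ u v, retInv' σ τ u v) ∈ Y.InvPair (200 * N ^ 2 * ε) (2 * r) (40 * N ^ 2) n := by
  obtain ⟨j, hj, hτ⟩ := R.exists_emb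
  have hσ := R.bdd.invPair hr le_rfl le_rfl le_rfl h
  have hN2 : 1 ≤ N ^ 2 := one_le_pow₀ hN
  have hp : ε ≤ N ^ 2 * ε := le_mul_of_one_le_left hε.le hN2
  have hq : ε * ε ≤ ε := mul_le_of_le_one_left hε.le (by linarith)
  suffices h' : ((retInv σ τ u v).map j, (retInv' σ τ u v).map j) ∈
      X.InvPair (60 * N ^ 2 * ε) (2 * r) (12 * N ^ 2) n by
    refine invPair_mono ?_ le_rfl ?_ _ (hj.invPair (by linarith) h') <;> nlinarith
  rw [retInv_map (τ' := j.toLinearMap ∘ₗ τ) j (fun _ => rfl),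
    retInv'_map (τ' := j.toLinearMap ∘ₗ τ) j (fun _ => rfl),
    retInv_eq (τ := j.toLinearMap ∘ₗ τ) R.idem hτ,
    retInv'_eq (τ := j.toLinearMap ∘ₗ τ) R.idem hτ]
  obtain ⟨a1, a2, a3, a4, a5, a6⟩ := h
  obtain ⟨b1, b2, b3, b4, b5, b6⟩ := hσ
  generalize u.map σ = u' at *
  generalize v.map σ = v' at *
  have hη : X.nrm n (1 - u' * v') ≤ 3 * ε := by
    rw [map_sub_rev]
    exact b3.le
  have ha := nrm_mul_le a5 b6
  have hb := nrm_mul_le b5 a6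
  have hm : 1 - u' * v' ∈ X.mfilt (2 * r) n := by
    refine sub_mem_mfilt (one_mem_mfilt (by linarith) n) ?_
    rw [two_mul]
    exact mul_mem_mfilt hr hr b1 b2
  refine ⟨add_mem_mfilt ?_ hm, add_mem_mfilt ?_ hm, ?_, ?_, ?_, ?_⟩
  · rw [two_mul]
    exact mul_mem_mfilt hr hr a1 b2
  · rw [two_mul]
    exact mul_mem_mfilt hr hr b1 a2
  -- The main term `u v' u' v` telescopes to `1` by way of the defects of `v'u'` and `uv`; every
  -- other summand contains the correction.
  · have e1 : (u * v' + (1 - u' * v')) * (u' * v + (1 - u' * v')) - 1 =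
        u * (v' * u' - 1) * v + (u * v - 1) + (u * v') * (1 - u' * v') +
          (1 - u' * v') * (u' * v) + (1 - u' * v') * (1 - u' * v') := by noncomm_ring
    rw [e1]
    refine (nrm_add_le (nrm_add_le (nrm_add_le (nrm_add_le (nrm_mul_le (nrm_mul_le a5 b4.le) a6)
      a3.le) (nrm_mul_le ha hη)) (nrm_mul_le hη hb)) (nrm_mul_le hη hη)).trans_lt ?_
    nlinarith
  · have e1 : (u' * v + (1 - u' * v')) * (u * v' + (1 - u' * v')) - 1 =
        u' * (v * u - 1) * v' + (u' * v' - 1) + (u' * v) * (1 - u' * v') +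
          (1 - u' * v') * (u * v') + (1 - u' * v') * (1 - u' * v') := by noncomm_ring
    rw [e1]
    refine (nrm_add_le (nrm_add_le (nrm_add_le (nrm_add_le (nrm_mul_le (nrm_mul_le b5 a4.le) b6)
      b3.le) (nrm_mul_le hb hη)) (nrm_mul_le hη ha)) (nrm_mul_le hη hη)).trans_lt ?_
    nlinarith
  · refine (nrm_add_le ha hη).trans ?_
    nlinarith
  · refine (nrm_add_le hb hη).trans ?_
    nlinarith

theorem retInv_htpy (R : Retr X Y σ τ) (hε : 0 < ε) (hε1 : 3 * ε ≤ 1) (hr : 0 < r) (hN : 1 ≤ N)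
    {u v u' v' : Matrix (Fin n) (Fin n) U} (h : (u, v) ∈ X.InvPair ε r N n)
    (h' : (u', v') ∈ X.InvPair ε r N n) (hu : X.GLHtpy ε r N n u u') :
    Y.GLHtpy (200 * N ^ 2 * ε) (2 * r) (40 * N ^ 2) n (retInv σ τ u v) (retInv σ τ u' v') := by
  obtain ⟨x, y, hxy⟩ := hu
  obtain ⟨j, hj, hτ⟩ := R.exists_emb
  letI := X.topo n
  letI := Y.topo n
  -- The quasi-inverses at the ends of the given homotopy need not be `v` and `v'`; convexity of the
  -- sets of quasi-inverses connects them.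
  have h1 : JoinedIn (X.InvPair ε r N n) (u, v) (u', v') :=
    (joinedIn_invPair h hxy.source_mem).trans (hxy.trans (joinedIn_invPair hxy.target_mem h'))
  have hσ := R.bdd.continuous n
  have c1 : Continuous fun w : Matrix (Fin n) (Fin n) U × Matrix (Fin n) (Fin n) U =>
      1 - w.1.map σ * w.2.map σ := by
    letI := X.srng n
    exact Continuous.sub (G := Matrix (Fin n) (Fin n) U) continuous_const
      (Continuous.mul (M := Matrix (Fin n) (Fin n) U) (hσ.comp continuous_fst)
        (hσ.comp continuous_snd))
  have c2 : Continuous fun w : Matrix (Fin n) (Fin n) U × Matrix (Fin n) (Fin n) U =>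
      retInv σ τ w.1 w.2 := by
    refine hj.continuous ?_
    simp only [retInv_map (σ := σ) (τ := τ) (τ' := j.toLinearMap ∘ₗ τ) j (fun _ => rfl),
      retInv_eq (τ := j.toLinearMap ∘ₗ τ) R.idem hτ]
    letI := X.srng n
    exact Continuous.add (M := Matrix (Fin n) (Fin n) U)
      (Continuous.mul (M := Matrix (Fin n) (Fin n) U) continuous_fst (hσ.comp continuous_snd)) c1
  have c3 : Continuous fun w : Matrix (Fin n) (Fin n) U × Matrix (Fin n) (Fin n) U =>
      retInv' σ τ w.1 w.2 := by
    refine hj.continuous ?_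
    simp only [retInv'_map (σ := σ) (τ := τ) (τ' := j.toLinearMap ∘ₗ τ) j (fun _ => rfl),
      retInv'_eq (τ := j.toLinearMap ∘ₗ τ) R.idem hτ]
    letI := X.srng n
    exact Continuous.add (M := Matrix (Fin n) (Fin n) U)
      (Continuous.mul (M := Matrix (Fin n) (Fin n) U) (hσ.comp continuous_fst) continuous_snd) c1
  refine ⟨retInv' σ τ u v, retInv' σ τ u' v', (JoinedIn.map h1 (c2.prodMk c3)).mono ?_⟩
  rintro _ ⟨⟨a, b⟩, hab, rfl⟩
  exact R.retInv_mem hε hε1 hr hN hab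

end Retr
end QAlg
end QK

/-! ### The retraction as a homomorphism of quantitative K-groups -/

namespace QK
namespace QAlg

open scoped ENNReal

variable {p : ℝ≥0∞} [Fact (1 ≤ p)] {U V : Type*} [Ring U] [Algebra ℂ U] [Ring V] [Algebra ℂ V]
  {X : QAlg p U} {Y : QAlg p V} {P Q S : Param}

section lift

/-- A homotopy invariant additive function of quasi-idempotents defines a homomorphism on `K_0`. -/
noncomputable def liftIdem {G : Type*} [AddCommGroup G]
    (φ : ∀ n (x : Matrix (Fin n) (Fin n) U), x ∈ X.Idem P.ε P.r P.N n → G)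
    (hadd : ∀ {n m x y} (hx : x ∈ X.Idem P.ε P.r P.N n) (hy : y ∈ X.Idem P.ε P.r P.N m),
      φ (n + m) (bdiag x y) (idem_bdiag hx hy) = φ n x hx + φ m y hy)
    (hH : ∀ {n x y} (hx : x ∈ X.Idem P.ε P.r P.N n) (hy : y ∈ X.Idem P.ε P.r P.N n),
      X.IdemHtpy (4 * P.ε) P.r (4 * P.N) n x y → φ n x hx = φ n y hy)
    (h0 : ∀ n h, φ n 0 h = 0) : X.KU 0 P →+ G :=
  Algebra.GrothendieckAddGroup.lift (StableSystem.liftCls (T := X.idemSystem P) φ hadd hH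
    (fun n => by
      have hz : (Matrix.diagonal fun _ : Fin n => (0 : U)) = 0 := Matrix.diagonal_zero
      have hS := (X.idemSystem P).S_diag n
      change φ n (Matrix.diagonal fun _ : Fin n => (0 : U)) hS = 0
      generalize_proofs at *
      revert hS
      change ∀ hS : (Matrix.diagonal fun _ : Fin n => (0 : U)) ∈ X.Idem P.ε P.r P.N n, _
      rw [hz]
      exact h0 n))

theorem liftIdem_idemCls {G : Type*} [AddCommGroup G]
    {φ : ∀ n (x : Matrix (Fin n) (Fin n) U), x ∈ X.Idem P.ε P.r P.N n → G} {hadd hH h0} {n : ℕ}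
    {x : Matrix (Fin n) (Fin n) U} (hx : x ∈ X.Idem P.ε P.r P.N n) :
    liftIdem (X := X) (P := P) φ hadd hH h0 (X.idemCls P x hx) = φ n x hx :=
  DFunLike.congr_fun (Algebra.GrothendieckAddGroup.lift.symm_apply_apply
    (StableSystem.liftCls (T := X.idemSystem P) φ hadd hH _)) ((X.idemSystem P).cls x hx)

end lift

/-- The parameters `Q` are so much larger than `P` that the retraction can be formed. -/
structure Far (P Q : Param) : Prop where
  ε_le : 10 ^ 10 * P.N ^ 6 * P.ε ≤ Q.ε
  r_le : 10 * P.r ≤ Q.r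
  N_le : 10 ^ 10 * P.N ^ 6 ≤ Q.N

theorem Far.of_le (h : P ≤ Q) (h' : Far Q S) : Far P S := by
  have hN : P.N ^ 6 ≤ Q.N ^ 6 := pow_le_pow_left₀ (zero_le_one.trans P.one_le) h.2.2 6
  have hN0 : 0 ≤ P.N ^ 6 := pow_nonneg (zero_le_one.trans P.one_le) 6
  refine ⟨le_trans ?_ h'.ε_le, le_trans ?_ h'.r_le, le_trans ?_ h'.N_le⟩
  · have := mul_le_mul hN h.1 P.ε_pos.le (hN0.trans hN)
    linarith
  · linarith [h.2.1]
  · linarith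

theorem Far.trans_le (h : Far P Q) (h' : Q ≤ S) : Far P S :=
  ⟨h.ε_le.trans h'.1, h.r_le.trans h'.2.1, h.N_le.trans h'.2.2⟩

/-- Since `N ≥ 1`, a single inequality of degree six dominates every monomial estimate needed for
the retraction. -/
theorem Far.bounds (h : Far P Q) {k : ℕ} (hk : k ≤ 6) {a : ℝ} (ha : a ≤ 10 ^ 10) :
    a * P.N ^ k * P.ε ≤ Q.ε ∧ a * P.N ^ k ≤ Q.N := by
  have hN : P.N ^ k ≤ P.N ^ 6 := pow_le_pow_right₀ P.one_le hk
  have hN0 : 0 ≤ P.N ^ k := pow_nonneg (zero_le_one.trans P.one_le) k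
  have h1 : a * P.N ^ k ≤ 10 ^ 10 * P.N ^ 6 := mul_le_mul ha hN hN0 (by norm_num)
  exact ⟨(mul_le_mul_of_nonneg_right h1 P.ε_pos.le).trans h.ε_le, h1.trans h.N_le⟩

theorem Far.scaled (h : Far P Q) : Scaled 3 P Q := by
  have h1 := h.bounds (k := 0) (by norm_num) (a := 3) (by norm_num)
  have h2 := h.bounds (k := 1) (by norm_num) (a := 3) (by norm_num)
  rw [pow_zero, mul_one] at h1
  rw [pow_one] at h2
  exact ⟨h1.1, by linarith [h.r_le, P.r_pos], h2.2⟩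

theorem Far.le (h : Far P Q) : P ≤ Q := by
  have := h.scaled
  exact ⟨by linarith [this.ε_le, P.ε_pos], this.r_le, by linarith [this.N_le, P.one_le]⟩

theorem Scaled.le {c : ℝ} (hc : 1 ≤ c) (h : Scaled c P Q) : P ≤ Q :=
  ⟨(le_mul_of_one_le_left P.ε_pos.le hc).trans h.ε_le, h.r_le,
    (le_mul_of_one_le_left (zero_le_one.trans P.one_le) hc).trans h.N_le⟩

theorem one_mem_idem (X : QAlg p U) (P : Param) (n : ℕ) :
    (1 : Matrix (Fin n) (Fin n) U) ∈ X.Idem P.ε P.r P.N n := by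
  have := one_sub_mem_idem P.r_pos (idem_zero (X := X) (r := P.r) P.ε_pos P.one_le n)
  rwa [sub_zero] at this

theorem one_mem_qInv (X : QAlg p U) (P : Param) (n : ℕ) :
    (1 : Matrix (Fin n) (Fin n) U) ∈ X.QInv P.ε P.r P.N n :=
  ⟨1, invPair_one P.ε_pos P.r_pos P.one_le n⟩

/-- The class of the identity matrix is additive. -/
theorem idemCls_one_add (X : QAlg p U) (P : Param) (n m : ℕ) :
    X.idemCls P (1 : Matrix (Fin (n + m)) (Fin (n + m)) U) (one_mem_idem X P _) =
      X.idemCls P (1 : Matrix (Fin n) (Fin n) U) (one_mem_idem X P _) +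
        X.idemCls P (1 : Matrix (Fin m) (Fin m) U) (one_mem_idem X P _) := by
  rw [← idemCls_bdiag]
  exact idemCls_congr bdiag_one.symm _ _

theorem idemCls_bdiag_one_zero (X : QAlg p U) (P : Param) (n : ℕ)
    (h : bdiag (1 : Matrix (Fin n) (Fin n) U) (0 : Matrix (Fin n) (Fin n) U) ∈
      X.Idem P.ε P.r P.N (n + n)) :
    X.idemCls P (bdiag 1 0) h =
      X.idemCls P (1 : Matrix (Fin n) (Fin n) U) (one_mem_idem X P n) := by
  have := idemCls_bdiag (one_mem_idem X P n) (idem_zero (X := X) (r := P.r) P.ε_pos P.one_le n)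
  rw [idemCls_zero, add_zero] at this
  exact this

namespace Retr

variable {σ : U →ₐ[ℂ] U} {τ : U →ₗ[ℂ] V} (R : Retr X Y σ τ) (hPQ : Far P Q) {n : ℕ}

theorem three_ε_le (P : Param) : 3 * P.ε ≤ 1 := by linarith [P.ε_lt]

include R hPQ in
theorem retIdem_mem_far {e : Matrix (Fin n) (Fin n) U} (he : e ∈ X.Idem P.ε P.r P.N n) :
    retIdem σ τ e ∈ Y.Idem Q.ε Q.r Q.N (n + n) := by
  refine idem_mono ?_ ?_ ?_ _ (R.retIdem_mem P.ε_pos (three_ε_le P) P.r_pos P.one_le he)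
  · exact (hPQ.bounds (k := 4) (by norm_num) (by norm_num)).1
  · linarith [hPQ.r_le, P.r_pos]
  · exact (hPQ.bounds (k := 3) (by norm_num) (by norm_num)).2

include R hPQ in
theorem retIdem_htpy_far {e e' : Matrix (Fin n) (Fin n) U}
    (h : X.IdemHtpy (4 * P.ε) P.r (4 * P.N) n e e') :
    Y.IdemHtpy (4 * Q.ε) Q.r (4 * Q.N) (n + n) (retIdem σ τ e) (retIdem σ τ e') := by
  have h1 := P.ε_pos
  have h2 := P.ε_lt
  have h3 := P.one_le
  refine idemHtpy_mono ?_ ?_ ?_ (R.retIdem_htpy (by linarith) (by linarith) P.r_pos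
    (by linarith) h)
  · have := (hPQ.bounds (k := 4) (a := 51200000) (by norm_num) (by norm_num)).1
    linarith
  · linarith [hPQ.r_le, P.r_pos]
  · have := (hPQ.bounds (k := 3) (a := 32000) (by norm_num) (by norm_num)).2
    linarith

include R hPQ in
theorem retInv_mem_far {u v : Matrix (Fin n) (Fin n) U} (h : (u, v) ∈ X.InvPair P.ε P.r P.N n) :
    (retInv σ τ u v, retInv' σ τ u v) ∈ Y.InvPair Q.ε Q.r Q.N n := by
  refine invPair_mono ?_ ?_ ?_ _ (R.retInv_mem P.ε_pos (three_ε_le P) P.r_pos P.one_le h)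
  · exact (hPQ.bounds (k := 2) (by norm_num) (by norm_num)).1
  · linarith [hPQ.r_le, P.r_pos]
  · exact (hPQ.bounds (k := 2) (by norm_num) (by norm_num)).2

include R hPQ in
theorem retInv_htpy_far {u v u' v' : Matrix (Fin n) (Fin n) U}
    (h : (u, v) ∈ X.InvPair P.ε P.r P.N n) (h' : (u', v') ∈ X.InvPair P.ε P.r P.N n)
    (hu : X.GLHtpy (4 * P.ε) (2 * P.r) (4 * P.N) n u u') :
    Y.GLHtpy (4 * Q.ε) (2 * Q.r) (4 * Q.N) n (retInv σ τ u v) (retInv σ τ u' v') := by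
  have h1 := P.ε_pos
  have h2 := P.ε_lt
  have h3 := P.one_le
  have h4 := P.r_pos
  have hm := invPair_mono (X := X) (le_four h1) (le_two h4) (four_le h3) n
  refine glHtpy_mono ?_ ?_ ?_ (R.retInv_htpy (by linarith) (by linarith) (by linarith)
    (by linarith) (hm h) (hm h') hu)
  · have := (hPQ.bounds (k := 2) (a := 3200) (by norm_num) (by norm_num)).1
    linarith
  · linarith [hPQ.r_le, P.r_pos]
  · have := (hPQ.bounds (k := 2) (a := 160) (by norm_num) (by norm_num)).2
    linarith

/-- The zero matrix is sent to `diag(1, 0)` rather than to `0`, which is why the class of `1` has to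
be subtracted in the definition of the retraction. -/
theorem retZero_aux (n : ℕ) (h : (0 : Matrix (Fin n) (Fin n) U) ∈ X.Idem P.ε P.r P.N n) :
    Y.idemCls Q (retIdem σ τ (0 : Matrix (Fin n) (Fin n) U)) (R.retIdem_mem_far hPQ h) -
      Y.idemCls Q (1 : Matrix (Fin n) (Fin n) V) (one_mem_idem Y Q n) = 0 := by
  have h1 := R.retIdem_mem_far hPQ h
  have h2 := h1
  rw [retIdem_zero] at h2
  rw [idemCls_congr retIdem_zero h1 h2, idemCls_bdiag_one_zero, sub_self]

/-- The retraction on `K_0`. -/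
noncomputable def retZero : X.KU 0 P →+ Y.KU 0 Q :=
  liftIdem (fun n e he => Y.idemCls Q (retIdem σ τ e) (R.retIdem_mem_far hPQ he) -
      Y.idemCls Q (1 : Matrix (Fin n) (Fin n) V) (one_mem_idem Y Q n))
    (by
      intro n m x y hx hy
      have h1 := R.retIdem_mem_far hPQ hx
      have h2 := R.retIdem_mem_far hPQ hy
      have h3 := R.retIdem_mem_far hPQ (idem_bdiag hx hy)
      have h4 := h3
      rw [retIdem_bdiag] at h4
      -- The block formula is additive up to the permutation of the middle summands, which does not
      -- affect the class.
      rw [idemCls_one_add, idemCls_congr (retIdem_bdiag x y) h3 h4,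
        idemCls_reindex _ (idem_bdiag h1 h2), idemCls_bdiag h1 h2]
      abel)
    (by
      intro n x y hx hy h
      rw [idemCls_eq _ _ (R.retIdem_htpy_far hPQ h)])
    (R.retZero_aux hPQ)

/-- The retraction on `K_1`. -/
noncomputable def retOne : X.KU 1 P →+ Y.KU 1 Q :=
  StableSystem.liftCls (T := X.glSystem P) (G := Y.KU 1 Q)
    -- A quasi-inverse is chosen arbitrarily; by `retInv_htpy_far` another choice gives a homotopic
    -- element, as additivity and homotopy invariance below require.
    (fun _ u hu => Y.glCls Q (retInv σ τ u hu.choose)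
      (mem_qInv (R.retInv_mem_far hPQ hu.choose_spec)))
    (by
      intro n m x y hx hy
      have h1 := R.retInv_mem_far hPQ hx.choose_spec
      have h2 := R.retInv_mem_far hPQ hy.choose_spec
      have h3 := invPair_bdiag hx.choose_spec hy.choose_spec
      have h4 : bdiag x y ∈ X.QInv P.ε P.r P.N (n + m) := mem_qInv h3
      refine Eq.trans ?_ (glCls_bdiag (mem_qInv h1) (mem_qInv h2) (mem_qInv (invPair_bdiag h1 h2)))
      refine glCls_eq _ _ ?_
      rw [← retInv_bdiag]
      exact R.retInv_htpy_far hPQ h4.choose_spec h3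
        (glHtpy_refl (qInv_mono X (le_four P.ε_pos) (le_two P.r_pos) (four_le P.one_le) _ (mem_qInv h3))))
    (by
      intro n x y hx hy h
      exact glCls_eq _ _ (R.retInv_htpy_far hPQ hx.choose_spec hy.choose_spec h))
    (by
      intro n
      have h0 : (Matrix.diagonal fun _ : Fin n => (1 : U)) = 1 := Matrix.diagonal_one
      have hS : (Matrix.diagonal fun _ : Fin n => (1 : U)) ∈ X.QInv P.ε P.r P.N n :=
        (X.glSystem P).S_diag n
      -- The quasi-inverse chosen for the unit matrix may not be the unit matrix itself, so the
      -- value is compared with the one for the pair `(1, 1)`.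
      have h1 : (1, 1) ∈ X.InvPair P.ε P.r P.N n := invPair_one P.ε_pos P.r_pos P.one_le n
      have h2 : X.GLHtpy (4 * P.ε) (2 * P.r) (4 * P.N) n (Matrix.diagonal fun _ => (1 : U)) 1 := by
        rw [h0]
        exact glHtpy_refl (qInv_mono X (le_four P.ε_pos) (le_two P.r_pos) (four_le P.one_le) _
          (one_mem_qInv X P n))
      have h3 := R.retInv_htpy_far hPQ hS.choose_spec h1 h2
      have h4 : retInv σ τ (1 : Matrix (Fin n) (Fin n) U) 1 = 1 := by
        have h5 : τ 1 = 0 := R.τ_eq_zero (map_one σ)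
        rw [retInv, Matrix.map_one σ (map_zero σ) (map_one σ), mul_one]
        ext a b
        by_cases hab : a = b <;> simp [Matrix.one_apply, hab, h5]
      rw [h4] at h3
      exact (glCls_eq _ (one_mem_qInv Y Q n) h3).trans (glCls_one _))

/-- The retraction `K_i(X) → K_i(Y)` given by the difference of the identity and `σ`. -/
noncomputable def ret (i : Fin 2) : X.KU i P →+ Y.KU i Q :=
  match i with
  | 0 => R.retZero hPQ
  | 1 => R.retOne hPQ

theorem ret_idemCls {e : Matrix (Fin n) (Fin n) U} (he : e ∈ X.Idem P.ε P.r P.N n) :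
    R.ret hPQ 0 (X.idemCls P e he) = Y.idemCls Q (retIdem σ τ e) (R.retIdem_mem_far hPQ he) -
      Y.idemCls Q (1 : Matrix (Fin n) (Fin n) V) (one_mem_idem Y Q n) :=
  liftIdem_idemCls (h0 := R.retZero_aux hPQ) he

theorem ret_glCls {u v : Matrix (Fin n) (Fin n) U} (h : (u, v) ∈ X.InvPair P.ε P.r P.N n)
    (hu : u ∈ X.QInv P.ε P.r P.N n) :
    R.ret hPQ 1 (X.glCls P u hu) =
      Y.glCls Q (retInv σ τ u v) (mem_qInv (R.retInv_mem_far hPQ h)) := by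
  change Y.glCls Q (retInv σ τ u hu.choose) (mem_qInv (R.retInv_mem_far hPQ hu.choose_spec)) = _
  exact glCls_eq _ _ (R.retInv_htpy_far hPQ hu.choose_spec h (glHtpy_refl
    (qInv_mono X (le_four P.ε_pos) (le_two P.r_pos) (four_le P.one_le) _ (mem_qInv h))))

end Retr
end QAlg
end QK

/-! ### Naturality, vanishing and the decomposition formula for the retraction -/

namespace QK
namespace QAlg

open scoped ENNReal

variable {p : ℝ≥0∞} [Fact (1 ≤ p)] {U V W : Type*} [Ring U] [Algebra ℂ U] [Ring V] [Algebra ℂ V]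
  [Ring W] [Algebra ℂ W] {X : QAlg p U} {Y : QAlg p V} {Z : QAlg p W} {P Q S : Param}

namespace Retr

variable {σ : U →ₐ[ℂ] U} {τ : U →ₗ[ℂ] V}

/-- It suffices to compare representatives, and the matrix formulas commute with `φ`. With `φ` the
identity this is compatibility with relaxation; with `φ = j⁺` it transports the retraction into
`A⁺`. -/
theorem kuMap_ret (R : Retr X Y σ τ) {τ' : U →ₗ[ℂ] W} (R' : Retr X Z σ τ') {φ : V →ₐ[ℂ] W}
    (hφ : ∀ x, φ (τ x) = τ' x) {c : ℝ} (h : Bdd Y Z φ c) (hPQ : Far P Q) (hQS : Scaled c Q S)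
    (hPS : Far P S) (i : Fin 2) (x : X.KU i P) :
    kuMap h hQS i (R.ret hPQ i x) = R'.ret hPS i x := by
  match i with
  | 0 =>
    refine DFunLike.congr_fun (f := (kuMap h hQS 0).comp (R.ret hPQ 0)) (KU_zero_hom_ext ?_) x
    intro n e he
    rw [AddMonoidHom.comp_apply, ret_idemCls, ret_idemCls, map_sub, kuMap_idemCls, kuMap_idemCls]
    exact congrArg₂ _ (idemCls_congr (retIdem_map φ hφ e) _ _)
      (idemCls_congr (Matrix.map_one φ (map_zero φ) (map_one φ)) _ _)
  | 1 =>
    refine DFunLike.congr_fun (f := (kuMap h hQS 1).comp (R.ret hPQ 1)) (KU_one_hom_ext ?_) x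
    intro n u hu
    obtain ⟨v, hv⟩ := id hu
    rw [AddMonoidHom.comp_apply, R.ret_glCls hPQ hv, R'.ret_glCls hPS hv, kuMap_glCls]
    exact glCls_congr (retInv_map φ hφ u v) _ _

/-- The formulas evaluated on `ψ(e)` or `ψ(u)` are those of `(σ', τ')` on `e` or `u`. Besides
relaxation of the source, this covers the restriction along `j⁺`, where `σ'` is the augmentation. -/
theorem ret_kuMap (R : Retr X Y σ τ) {σ' : W →ₐ[ℂ] W} {τ' : W →ₗ[ℂ] V} (R' : Retr Z Y σ' τ')
    {ψ : W →ₐ[ℂ] U} (hσ : ∀ x, σ (ψ x) = ψ (σ' x)) (hτ : ∀ x, τ (ψ x) = τ' x) {c : ℝ}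
    (h : Bdd Z X ψ c) (hPQ : Scaled c P Q) (hQS : Far Q S) (hPS : Far P S) (i : Fin 2)
    (x : Z.KU i P) : R.ret hQS i (kuMap h hPQ i x) = R'.ret hPS i x := by
  match i with
  | 0 =>
    refine DFunLike.congr_fun (f := (R.ret hQS 0).comp (kuMap h hPQ 0)) (KU_zero_hom_ext ?_) x
    intro n e he
    rw [AddMonoidHom.comp_apply, ret_idemCls, kuMap_idemCls, ret_idemCls]
    exact congrArg₂ _ (idemCls_congr (retIdem_comap ψ hσ hτ e) _ _) rfl
  | 1 =>
    refine DFunLike.congr_fun (f := (R.ret hQS 1).comp (kuMap h hPQ 1)) (KU_one_hom_ext ?_) x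
    intro n u hu
    obtain ⟨v, hv⟩ := id hu
    have hv' := h.invPair P.r_pos hPQ.ε_le hPQ.r_le hPQ.N_le hv
    rw [AddMonoidHom.comp_apply, R'.ret_glCls hPS hv, kuMap_glCls]
    exact (R.ret_glCls hQS hv' _).trans (glCls_congr (retInv_comap ψ hσ hτ u v) _ _)

/-- The retraction vanishes on classes which are fixed by `σ`. -/
theorem ret_kuMap_eq_zero (R : Retr X Y σ τ) {ψ : W →ₐ[ℂ] U} (hσ : ∀ x, σ (ψ x) = ψ x) {c : ℝ}
    (h : Bdd Z X ψ c) (hPQ : Scaled c P Q) (hQS : Far Q S) (i : Fin 2) (x : Z.KU i P) :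
    R.ret hQS i (kuMap h hPQ i x) = 0 := by
  have hτ : ∀ x, τ (ψ x) = (0 : W →ₗ[ℂ] V) x := fun x => R.τ_eq_zero (hσ x)
  have hz : ∀ {n : ℕ} (x : Matrix (Fin n) (Fin n) W), x.map (0 : W →ₗ[ℂ] V) = 0 := fun x => by
    ext1 a b
    rfl
  match i with
  | 0 =>
    refine DFunLike.congr_fun (f := (R.ret hQS 0).comp (kuMap h hPQ 0)) (g := 0)
      (KU_zero_hom_ext ?_) x
    intro n e he
    have h1 := R.retIdem_mem_far hQS (h.idem P.r_pos hPQ.ε_le hPQ.r_le hPQ.N_le he)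
    -- On the range of `ψ` the map `τ` vanishes, so only the constant part `diag(1, 0)` of the
    -- formula survives.
    have e1 : retIdem σ τ (e.map ψ) = bdiag 1 0 := by
      rw [retIdem_comap (σ' := AlgHom.id ℂ W) ψ hσ hτ]
      simp only [retIdem, hz, add_zero, bdiag_eq_blk]
    have h2 := h1
    rw [e1] at h2
    rw [AddMonoidHom.comp_apply, kuMap_idemCls, ret_idemCls, idemCls_congr e1 h1 h2,
      idemCls_bdiag_one_zero, sub_self]
    rfl
  | 1 =>
    refine DFunLike.congr_fun (f := (R.ret hQS 1).comp (kuMap h hPQ 1)) (g := 0)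
      (KU_one_hom_ext ?_) x
    intro n u hu
    obtain ⟨v, hv⟩ := id hu
    have hv' := h.invPair P.r_pos hPQ.ε_le hPQ.r_le hPQ.N_le hv
    have e1 : retInv σ τ (u.map ψ) (v.map ψ) = 1 := by
      rw [retInv_comap (σ' := AlgHom.id ℂ W) ψ hσ hτ]
      simp only [retInv, hz, add_zero]
    rw [AddMonoidHom.comp_apply, kuMap_glCls]
    exact (R.ret_glCls hQS hv' _).trans ((glCls_congr e1 _ (one_mem_qInv _ _ _)).trans (glCls_one _))

/-- The retraction takes values in classes which are killed by homomorphisms that vanish on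
differences. -/
theorem kuMap_ret_eq_zero (R : Retr X Y σ τ) {φ : V →ₐ[ℂ] W} (hφ : ∀ x, φ (τ x) = 0) {c : ℝ}
    (h : Bdd Y Z φ c) (hPQ : Far P Q) (hQS : Scaled c Q S) (i : Fin 2) (x : X.KU i P) :
    kuMap h hQS i (R.ret hPQ i x) = 0 := by
  have hz : ∀ {n : ℕ} (x : Matrix (Fin n) (Fin n) U), x.map (0 : U →ₗ[ℂ] W) = 0 := fun x => by
    ext1 a b
    rfl
  match i with
  | 0 =>
    refine DFunLike.congr_fun (f := (kuMap h hQS 0).comp (R.ret hPQ 0)) (g := 0)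
      (KU_zero_hom_ext ?_) x
    intro n e he
    have h1 := h.idem Q.r_pos hQS.ε_le hQS.r_le hQS.N_le (R.retIdem_mem_far hPQ he)
    have e1 : (retIdem σ τ e).map φ = bdiag 1 0 := by
      rw [retIdem_map (τ' := 0) φ hφ]
      simp only [retIdem, hz, add_zero, bdiag_eq_blk]
    have h2 := h1
    rw [e1] at h2
    rw [AddMonoidHom.comp_apply, ret_idemCls, map_sub, kuMap_idemCls, kuMap_idemCls,
      idemCls_congr e1 h1 h2, idemCls_bdiag_one_zero]
    exact sub_eq_zero.2 (idemCls_congr (Matrix.map_one φ (map_zero φ) (map_one φ)).symm _ _)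
  | 1 =>
    refine DFunLike.congr_fun (f := (kuMap h hQS 1).comp (R.ret hPQ 1)) (g := 0)
      (KU_one_hom_ext ?_) x
    intro n u hu
    obtain ⟨v, hv⟩ := id hu
    have e1 : (retInv σ τ u v).map φ = 1 := by
      rw [retInv_map (τ' := 0) φ hφ]
      simp only [retInv, hz, add_zero]
    rw [AddMonoidHom.comp_apply, R.ret_glCls hPQ hv, kuMap_glCls]
    exact (glCls_congr e1 _ (one_mem_qInv _ _ _)).trans (glCls_one _)

/-- For the difference `id - σ` with values in `X`, the retraction is `x ↦ x - σ x`. -/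
theorem ret_add_kuMap {τ : U →ₗ[ℂ] U} (R : Retr X X σ τ) (hτ : ∀ x, τ x = x - σ x) (hPQ : Far P Q)
    (h1 : Scaled 1 P Q) (i : Fin 2) (x : X.KU i P) :
    R.ret hPQ i x + kuMap R.bdd hPQ.scaled i x = kuMap (bdd_id X) h1 i x := by
  have hε := P.ε_pos
  have hε' := P.ε_lt
  have hr := P.r_pos
  have hN := P.one_le
  have hid : ∀ {n : ℕ} (x : Matrix (Fin n) (Fin n) U), x.map (AlgHom.id ℂ U) = x := fun x => by
    ext1 a b
    rfl
  match i with
  | 0 =>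
    refine DFunLike.congr_fun (f := R.ret hPQ 0 + kuMap R.bdd hPQ.scaled 0) (KU_zero_hom_ext ?_) x
    intro n e he
    have hf := R.σ_idem hr he
    have he3 := idem_mono (X := X) (by linarith : P.ε ≤ 3 * P.ε) le_rfl
      (by linarith : P.N ≤ 3 * P.N) n he
    have hd := R.retIdem_mem_far hPQ he
    have heQ := idem_mono (X := X) hPQ.le.1 hPQ.le.2.1 hPQ.le.2.2 n he
    have hfQ := R.bdd.idem hr hPQ.scaled.ε_le hPQ.scaled.r_le hPQ.scaled.N_le he
    have hgQ := one_sub_mem_idem Q.r_pos hfQ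
    -- The constants of `diffIdem_htpy` at `(3ε, r, 3N)` are `72900N⁴ε`, `3r` and `540N³`, all below
    -- the `Far` bounds.
    have key : ∀ {a b : Matrix (Fin (n + n)) (Fin (n + n)) U},
        X.IdemHtpy (300 * (3 * P.N) ^ 4 * (3 * P.ε)) (3 * P.r) (20 * (3 * P.N) ^ 3) (n + n) a b →
        X.IdemHtpy (4 * Q.ε) Q.r (4 * Q.N) (n + n) a b := fun hab => by
      refine idemHtpy_mono ?_ ?_ ?_ hab
      · have := (hPQ.bounds (k := 4) (a := 80000) (by norm_num) (by norm_num)).1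
        have := Q.ε_pos
        linarith
      · linarith [hPQ.r_le]
      · have := (hPQ.bounds (k := 3) (a := 1000) (by norm_num) (by norm_num)).2
        have := Q.one_le
        linarith
    -- With `f = σ(e)`, the first homotopy gives `[e] + [1 - f] = [retIdem e]`. The second, for the
    -- pair `(f, f)`, gives `[f] + [1 - f] = [1_n]`. Subtracting the two is the claim.
    have k1 := key (diffIdem_htpy (by linarith) (by linarith) hr (by linarith) he3 hf).2
    have k2 := key (diffIdem_htpy (by linarith) (by linarith) hr (by linarith) hf hf).2
    rw [← retIdem_eq_diffIdem R.idem hτ] at k1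
    rw [diffIdem_self] at k2
    have m2 := idem_bdiag (one_mem_idem X Q n) (idem_zero (X := X) (r := Q.r) Q.ε_pos Q.one_le n)
    have e1 := idemCls_eq (idem_bdiag heQ hgQ) hd k1
    have e2 := idemCls_eq (idem_bdiag hfQ hgQ) m2 k2
    rw [idemCls_bdiag_one_zero, idemCls_bdiag hfQ hgQ] at e2
    rw [idemCls_bdiag heQ hgQ] at e1
    rw [AddMonoidHom.add_apply, ret_idemCls, kuMap_idemCls, kuMap_idemCls, ← e1, ← e2]
    rw [idemCls_congr (hid e) _ heQ]
    abel
  | 1 =>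
    refine DFunLike.congr_fun (f := R.ret hPQ 1 + kuMap R.bdd hPQ.scaled 1) (KU_one_hom_ext ?_) x
    intro n u hu
    obtain ⟨v, hv⟩ := id hu
    have hw := R.retInv_mem hε (three_ε_le P) hr hN hv
    have hσ := R.bdd.invPair hr le_rfl le_rfl le_rfl hv
    have hN2 : 1 ≤ P.N ^ 2 := one_le_pow₀ hN
    have hN2' : P.N ≤ P.N ^ 2 := le_self_pow₀ hN (by norm_num)
    have hp : P.ε ≤ P.N ^ 2 * P.ε := le_mul_of_one_le_left hε.le hN2
    have hg := invPair_mono (X := X) (by linarith : 3 * P.ε ≤ 200 * P.N ^ 2 * P.ε)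
      (by linarith : P.r ≤ 2 * P.r) (by linarith : 3 * P.N ≤ 40 * P.N ^ 2) n hσ
    -- With `w = uσ(v) + (1 - σ(u)σ(v))`, both `uσ(v)σ(u) - u` and `(1 - σ(u)σ(v))σ(u)` are small;
    -- the bounds are `3εN` and `9Nε`.
    have hη : X.nrm n (u - retInv σ τ u v * u.map σ) ≤ 12 * P.N * P.ε := by
      rw [retInv_eq R.idem hτ]
      have e1 : u - (u * v.map σ + (1 - u.map σ * v.map σ)) * u.map σ =
          (u.map σ * v.map σ - 1) * u.map σ - u * (v.map σ * u.map σ - 1) := by noncomm_ring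
      rw [e1]
      refine (nrm_sub_le (nrm_mul_le hσ.2.2.1.le hσ.2.2.2.2.1)
        (nrm_mul_le hv.2.2.2.2.1 hσ.2.2.2.1.le)).trans (le_of_eq ?_)
      ring
    have k := glHtpy_bdiag_mul (by positivity) (by linarith : 0 < 2 * P.r) (by linarith) hw hg
      (mfilt_mono (by linarith) hv.1) (hv.2.2.2.2.1.trans (by linarith)) hη (by positivity)
    have hwQ := R.retInv_mem_far hPQ hv
    have hgQ := R.bdd.invPair hr hPQ.scaled.ε_le hPQ.scaled.r_le hPQ.scaled.N_le hv
    have huQ := invPair_mono (X := X) hPQ.le.1 hPQ.le.2.1 hPQ.le.2.2 n hv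
    have h1Q := invPair_one (X := X) Q.ε_pos Q.r_pos Q.one_le n
    have k' : X.GLHtpy (4 * Q.ε) (2 * Q.r) (4 * Q.N) (n + n) (bdiag (retInv σ τ u v) (u.map σ))
        (bdiag u 1) := by
      refine glHtpy_mono ?_ ?_ ?_ k
      -- Whitehead's rotation is used at `(200N²ε, 2r, 40N²)`, so its defect `128N²ε` becomes of
      -- order `N⁶ε`. This is the origin of the exponent `6` in `Far`. The exponent `5` comes from
      -- the distance `12Nε`.
      · have b1 := (hPQ.bounds (k := 6) (a := 10 ^ 9) (by norm_num) (by norm_num)).1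
        have b2 := (hPQ.bounds (k := 5) (a := 10 ^ 9) (by norm_num) (by norm_num)).1
        have := Q.ε_pos
        linarith
      · linarith [hPQ.r_le]
      · have := (hPQ.bounds (k := 4) (a := 6400) (by norm_num) (by norm_num)).2
        have := Q.one_le
        linarith
    have e1 := glCls_eq (mem_qInv (invPair_bdiag hwQ hgQ)) (mem_qInv (invPair_bdiag huQ h1Q)) k'
    rw [glCls_bdiag (mem_qInv hwQ) (mem_qInv hgQ), glCls_bdiag (mem_qInv huQ) (mem_qInv h1Q), glCls_one, add_zero] at e1
    rw [AddMonoidHom.add_apply, R.ret_glCls hPQ hv, kuMap_glCls, kuMap_glCls, e1]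
    exact glCls_congr (hid u).symm _ _

end Retr
end QAlg
end QK

/-! ### The retraction of a split extension of filtered algebras -/

namespace QK

open scoped ENNReal

universe u v

section concrete

variable {p : ℝ≥0∞} [Fact (1 ≤ p)] [Fact (p ≠ ⊤)]
variable {E : Type u} [NormedAddCommGroup E] [NormedSpace ℂ E] [CompleteSpace E]
variable {B : Type v} [NonUnitalRing B] [Module ℂ B] [IsScalarTower ℂ B B] [SMulCommClass ℂ B B]

theorem QAlg.emb_id {U : Type*} [Ring U] [Algebra ℂ U] (X : QAlg p U) :
    Emb X X (AlgHom.id ℂ U) := by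
  refine ⟨fun n y => ?_, fun _ _ _ hy => hy, fun _ _ hxy => hxy⟩
  rw [show y.map (AlgHom.id ℂ U) = y from rfl]
  linarith [apply_nonneg (X.nrm n) y]

namespace FilteredSQpAlgebra

/-- The matrix is the product of a scalar matrix and a constant diagonal one. The scalar factor is
bounded by its norm on `ℓ_p^n` because `E` is an `SQ_p` space. -/
theorem opNorm_map_smul_le (A : FilteredSQpAlgebra p E) {n : ℕ} (z : Matrix (Fin n) (Fin n) ℂ)
    (T : E →L[ℂ] E) : opNorm p (z.map fun c => c • T) ≤ cNorm p z * ‖T‖ := by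
  have h : (z.map fun c => c • T) =
      (z.map fun c => c • ContinuousLinearMap.id ℂ E) * Matrix.diagonal fun _ => T := by
    ext1 i j
    rw [Matrix.mul_diagonal]
    simp only [Matrix.map_apply, smul_mul_assoc]
    exact congrArg _ (one_mul T).symm
  rw [h]
  exact (opNorm_mul_le p _ _).trans (mul_le_mul (A.isSQp.opNorm_scalar_le z)
    (opNorm_diagonal_le p Fact.out T) (norm_nonneg _) (cNorm_nonneg p z))

theorem one_mem (A : FilteredSQpAlgebra p E) (hA : A.IsUnital) : A.one ∈ A.alg := by
  rw [one, dif_pos hA]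
  exact (Classical.choose_spec hA).1

theorem norm_one_sub_one_le (A J : FilteredSQpAlgebra p E) : ‖A.one - J.one‖ ≤ 2 :=
  (norm_sub_le _ _).trans (by linarith [A.norm_one_le, J.norm_one_le])

/-- The elements of `A⁺` and `J⁺` have the same components but act on `E` with different units. The
representations differ by the scalar part times `A.one - J.one`, of norm at most `2`, whence `1 + 2
= 3`. No inclusion between the algebras is assumed, so the estimate can be used in both directions.
-/
theorem nrm_le_three_mul {A J : FilteredSQpAlgebra p E} {n : ℕ}
    {x : Matrix (Fin n) (Fin n) (Unitization ℂ A.alg)}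
    {y : Matrix (Fin n) (Fin n) (Unitization ℂ J.alg)}
    (hfst : ∀ i j, (x i j).fst = (y i j).fst)
    (hsnd : ∀ i j, ((x i j).snd : E →L[ℂ] E) = (y i j).snd) : A.nrm n x ≤ 3 * J.nrm n y := by
  have h1 : x.map A.rep =
      y.map J.rep + (y.map fun a => a.fst).map fun c => c • (A.one - J.one) := by
    ext1 i j
    simp only [Matrix.map_apply, Matrix.add_apply, rep_apply, hfst, hsnd, smul_sub]
    abel
  have h2 : (x.map fun a => a.fst) = y.map fun a => a.fst := by
    ext1 i j
    exact hfst i j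
  have h3 := J.opNorm_le_nrm y
  have h4 := J.cNorm_le_nrm y
  have h5 := A.opNorm_map_smul_le (y.map fun a => a.fst) (A.one - J.one)
  have h6 := mul_le_mul_of_nonneg_left (A.norm_one_sub_one_le J)
    (cNorm_nonneg p (y.map fun a => a.fst))
  have h7 := map_add_le_add (opSem p E n) (y.map J.rep)
    ((y.map fun a => a.fst).map fun c => c • (A.one - J.one))
  rw [opSem_apply, opSem_apply, opSem_apply, ← h1] at h7
  rw [nrm_apply, h2]
  refine max_le ?_ ?_
  · linarith
  · linarith [apply_nonneg (J.nrm n) y]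

end FilteredSQpAlgebra

namespace FAlg

variable {A : Type*} [NonUnitalRing A] [Module ℂ A] [IsScalarTower ℂ A A] [SMulCommClass ℂ A A]

theorem plus_snd (φ : A →ₙₐ[ℂ] B) (x : Unitization ℂ A) : (plus φ x).snd = φ x.snd := by
  rw [plus_apply]
  simp

theorem bdd_plus_quot (X : FAlg p A) (q : A →ₙₐ[ℂ] B) (hq : Function.Surjective q) :
    QAlg.Bdd X.toQ (X.quot q hq).toQ (plus q) 1 :=
  ⟨le_rfl, fun n x => by rw [one_mul]; exact quotNrm_le rfl, fun _ _ x hx => ⟨x, hx, rfl⟩⟩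

/-- The endomorphism `z + a ↦ z` of `A⁺`. -/
noncomputable def augEnd (A : Type*) [NonUnitalRing A] [Module ℂ A] [IsScalarTower ℂ A A]
    [SMulCommClass ℂ A A] : Unitization ℂ A →ₐ[ℂ] Unitization ℂ A :=
  (Algebra.ofId ℂ _).comp (Unitization.fstHom ℂ A)

theorem bdd_ofId (X : FAlg p A) :
    QAlg.Bdd (cAlg p) X.toQ (Algebra.ofId ℂ (Unitization ℂ A)) 1 := by
  refine ⟨le_rfl, fun n z => by rw [one_mul]; exact X.toQ.scalar_le z, fun r hr z _ => ?_⟩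
  rw [Algebra.ofId_apply, Algebra.algebraMap_eq_smul_one]
  exact Submodule.smul_mem _ z (X.toQ.filt_one hr)

theorem bdd_augEnd (X : FAlg p A) : QAlg.Bdd X.toQ X.toQ (augEnd A) 1 := by
  have h := X.aug.comp X.bdd_ofId
  rwa [one_mul] at h

/-- If `b` is a right unit of `B` with norm at most `1` and `s : B → A` is `p`-completely
contractive then `s⁺` is bounded by `3`. -/
theorem nrm_plus_le {X : FAlg p A} {Y : FAlg p B} {s : B →ₙₐ[ℂ] A} {b : B}
    (hmul : ∀ c : B, c * b = c)
    (hs : ∀ n (y : Matrix (Fin n) (Fin n) B), X.toQ.nrm n (y.map fun c => Unitization.inr (s c)) ≤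
      Y.toQ.nrm n (y.map fun c => Unitization.inr c)) {n : ℕ}
    (hb : Y.toQ.nrm n ((Matrix.diagonal fun _ => b).map fun c => Unitization.inr c) ≤ 1)
    (y : Matrix (Fin n) (Fin n) (Unitization ℂ B)) :
    X.toQ.nrm n (y.map (plus s)) ≤ 3 * Y.toQ.nrm n y := by
  set D : Matrix (Fin n) (Fin n) (Unitization ℂ B) :=
    (Matrix.diagonal fun _ => b).map fun c => Unitization.inr c with hD
  set M : Matrix (Fin n) (Fin n) B := y.map fun c => (c * Unitization.inr b).snd with hM
  have hyD : (M.map fun c => (Unitization.inr c : Unitization ℂ B)) = y * D := by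
    ext1 i j
    have : D = Matrix.diagonal fun _ => (Unitization.inr b : Unitization ℂ B) := by
      rw [hD]
      exact Matrix.diagonal_map rfl
    rw [this, Matrix.mul_diagonal]
    refine Unitization.ext ?_ rfl
    simp [hM]
  have h1 : X.toQ.nrm n (M.map fun c => Unitization.inr (s c)) ≤ Y.toQ.nrm n y := by
    refine (hs n M).trans ?_
    rw [hyD]
    exact (Y.toQ.mul_le y D).trans (mul_le_of_le_one_right (apply_nonneg _ _) hb)
  set F : Matrix (Fin n) (Fin n) (Unitization ℂ A) :=
    (Matrix.diagonal fun _ => b).map fun c => Unitization.inr (s c) with hF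
  have h2 : X.toQ.nrm n F ≤ 1 := (hs n _).trans hb
  have h3 : X.toQ.nrm n 1 ≤ 1 := by
    have := X.toQ.scalar_le (1 : Matrix (Fin n) (Fin n) ℂ)
    rw [Matrix.map_one _ (map_zero _) (map_one _)] at this
    exact this.trans (cNorm_one_le' p)
  set z : Matrix (Fin n) (Fin n) ℂ := y.map fun c => c.fst with hz
  have h4 : cNorm p z ≤ Y.toQ.nrm n y := by
    have := Y.aug.bound n y
    rwa [one_mul] at this
  -- Entrywise, `s⁺(z + c) = s((z + c) b) + z(1 - s(b))`. The first part has norm at most `‖y‖`; the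
  -- second is a scalar matrix times an element of norm at most `2`.
  have h5 : y.map (plus s) = (M.map fun c => Unitization.inr (s c)) +
      z.map (algebraMap ℂ (Unitization ℂ A)) * (1 - F) := by
    have : (1 - F) = Matrix.diagonal fun _ => (1 - Unitization.inr (s b) : Unitization ℂ A) := by
      rw [hF, ← Matrix.diagonal_one, Matrix.diagonal_map (by rw [map_zero]; rfl),
        Matrix.diagonal_sub]
    ext1 i j
    rw [this, Matrix.add_apply, Matrix.mul_diagonal]
    simp only [hM, hz, Matrix.map_apply, plus_apply, Unitization.algebraMap_eq_inl]
    have hsnd : (y i j * (Unitization.inr b : Unitization ℂ B)).snd =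
        (y i j).fst • b + (y i j).snd := by simp [hmul]
    rw [hsnd, map_add, map_smul, mul_sub, mul_one, Unitization.inl_mul_inr, Unitization.inr_add]
    abel
  have h6 := X.toQ.scalar_le z
  have h7 := X.toQ.mul_le (z.map (algebraMap ℂ (Unitization ℂ A))) (1 - F)
  have h8 := (map_sub_le_add (X.toQ.nrm n) 1 F).trans (add_le_add h3 h2)
  have h9 := mul_le_mul (h6.trans h4) h8 (apply_nonneg _ _) (apply_nonneg _ y)
  rw [h5]
  refine (map_add_le_add (X.toQ.nrm n) _ _).trans ?_
  linarith

/-- Maps which factor through the augmentation vanish on `K_i(A)`. -/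
theorem kuMap_eq_zero_of_fst {X : FAlg p A} {W : Type*} [Ring W] [Algebra ℂ W] {Z : QAlg p W}
    {χ : Unitization ℂ A →ₐ[ℂ] W} (hχ : ∀ a : A, χ (Unitization.inr a) = 0) {c : ℝ}
    (h : QAlg.Bdd X.toQ Z χ c) {P Q : Param} (hPQ : QAlg.Scaled c P Q) {i : Fin 2}
    {x : X.toQ.KU i P} (hx : x ∈ X.K i P) : QAlg.kuMap h hPQ i x = 0 := by
  -- The scalar embedding into `W` is `χ` composed with the scalar embedding into `A⁺`, because
  -- unital algebra homomorphisms out of `ℂ` are unique. It therefore inherits the bound of `χ`.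
  have hz : QAlg.Bdd (cAlg p) Z (Algebra.ofId ℂ W) c := by
    have h1 := X.bdd_ofId.comp h
    rw [mul_one] at h1
    convert h1
    ext
  have hx' : QAlg.kuMap X.aug (scaled_one (le_refl P)) i x = 0 := hx
  have e := QAlg.kuMap_comp (χ := χ) (φ := Unitization.fstHom ℂ A) (ψ := Algebra.ofId ℂ W)
    (fun y => by
      conv_lhs => rw [← Unitization.inl_fst_add_inr_snd_eq y]
      rw [map_add, hχ, add_zero, ← Unitization.algebraMap_eq_inl, AlgHom.commutes]
      rfl) X.aug hz h (scaled_one (le_refl P)) hPQ hPQ i x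
  rw [← e, hx', map_zero]

end FAlg

namespace IsExtension

variable {J A : FilteredSQpAlgebra p E} {q : A.alg →ₙₐ[ℂ] B} (h : IsExtension J A q)

theorem coe_incl (a : J.alg) : ((h.incl a : A.alg) : E →L[ℂ] E) = a := rfl

theorem bdd_plus_incl : QAlg.Bdd J.toFAlg.toQ A.toFAlg.toQ (FAlg.plus h.incl) 3 := by
  refine ⟨by norm_num, fun n x => ?_, h.filteredHom_incl.bdd.filt⟩
  exact FilteredSQpAlgebra.nrm_le_three_mul (fun i j => FAlg.plus_fst _ _)
    fun i j => by rw [Matrix.map_apply, FAlg.plus_snd]; rfl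

/-- Norms are compared as for `j⁺` with the roles of `J` and `A` exchanged. The filtration is
reflected because `J_r = J ∩ A_r`. -/
theorem emb_plus_incl : QAlg.Emb J.toFAlg.toQ A.toFAlg.toQ (FAlg.plus h.incl) := by
  refine ⟨fun n y => ?_, fun r hr y hy => ?_, fun x y hxy => ?_⟩
  · exact FilteredSQpAlgebra.nrm_le_three_mul (fun i j => (FAlg.plus_fst _ _).symm)
      fun i j => by rw [Matrix.map_apply, FAlg.plus_snd]; rfl
  · refine (h.mem_filt r hr _).2 ⟨y.snd.2, ?_⟩
    have : ((FAlg.plus h.incl y).snd : E →L[ℂ] E) ∈ A.filt r := hy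
    rwa [FAlg.plus_snd] at this
  · have h1 := congrArg (fun x => x.fst) hxy
    have h2 := congrArg (fun x => x.snd) hxy
    simp only [FAlg.plus_fst] at h1
    simp only [FAlg.plus_snd] at h2
    refine Unitization.ext h1 (Subtype.ext ?_)
    exact congrArg (fun a : A.alg => (a : E →L[ℂ] E)) h2

theorem apply_incl (a : J.alg) : q (h.incl a) = 0 := (h.ker _).2 a.2

end IsExtension

namespace IsSplitExtension

variable {J A : FilteredSQpAlgebra p E} {q : A.alg →ₙₐ[ℂ] B} {s : B →ₙₐ[ℂ] A.alg}
  (h : IsSplitExtension J A q s)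

include h

/-- For non-unital `A` complete contractivity of `s⁺` is a hypothesis. For unital `A` only `s` is
assumed to be contractive, and `s` need not be unital; the passage to `s⁺` then goes through the
unit `q(1)` of `B`. -/
theorem bdd_plus_section :
    QAlg.Bdd h.quotient.toQ A.toFAlg.toQ (FAlg.plus s) 3 := by
  refine ⟨by norm_num, fun n y => ?_, h.filteredHom_section.bdd.filt⟩
  by_cases hA : A.IsUnital
  swap
  · have := h.contractive_of_not_isUnital hA n y
    linarith [apply_nonneg (h.quotient.toQ.nrm n) y]
  refine FAlg.nrm_plus_le (b := q ⟨A.one, A.one_mem hA⟩) (fun c => ?_)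
    (h.contractive_of_isUnital hA) ?_ y
  · obtain ⟨a, rfl⟩ := h.surj c
    rw [← map_mul]
    exact congrArg q (Subtype.ext (A.mul_one_mem a.2))
  -- The quotient norm of the diagonal matrix with entries `q(1)` is bounded by that of its lift,
  -- the diagonal matrix with entries the unit of `A`.
  · refine (FAlg.quotNrm_le (x := (Matrix.diagonal fun _ : Fin n =>
      (⟨A.one, A.one_mem hA⟩ : A.alg)).map fun a => Unitization.inr a) ?_).trans ?_
    · ext1 i j
      simp only [Matrix.map_apply, FAlg.plus_apply, Unitization.fst_inr, Unitization.snd_inr,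
        Unitization.inl_zero, zero_add, Matrix.diagonal_apply, apply_ite q, map_zero]
    · rw [A.nrm_inr]
      refine le_trans (le_of_eq (congrArg _ ?_))
        ((opNorm_diagonal_le p Fact.out (n := n) A.one).trans A.norm_one_le)
      ext1 i j
      rw [Matrix.map_apply, Matrix.diagonal_apply, Matrix.diagonal_apply]
      split_ifs <;> rfl

theorem plus_quot_plus_section (y : Unitization ℂ B) : FAlg.plus q (FAlg.plus s y) = y :=
  Unitization.ext (by rw [FAlg.plus_fst, FAlg.plus_fst])
    (by rw [FAlg.plus_snd, FAlg.plus_snd, h.apply_section])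

theorem plusNorm_incl_le : h.filteredHom_incl.plusNorm ≤ 3 :=
  csInf_le ⟨1, fun _ hC => hC.1⟩ ⟨by norm_num, h.bdd_plus_incl.bound⟩

theorem plusNorm_section_le : h.filteredHom_section.plusNorm ≤ 3 :=
  csInf_le ⟨1, fun _ hC => hC.1⟩ ⟨by norm_num, h.bdd_plus_section.bound⟩

theorem plusNorm_quot_le : h.filteredHom_quot.plusNorm ≤ 1 :=
  csInf_le ⟨1, fun _ hC => hC.1⟩ ⟨le_rfl, (A.toFAlg.bdd_plus_quot q h.surj).bound⟩

omit h in
/-- The endomorphism `s⁺ ∘ q⁺` of `A⁺`. -/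
noncomputable def proj (q : A.alg →ₙₐ[ℂ] B) (s : B →ₙₐ[ℂ] A.alg) :
    Unitization ℂ A.alg →ₐ[ℂ] Unitization ℂ A.alg := (FAlg.plus s).comp (FAlg.plus q)

theorem bdd_proj : QAlg.Bdd A.toFAlg.toQ A.toFAlg.toQ (proj q s) 3 := by
  have := (A.toFAlg.bdd_plus_quot q h.surj).comp h.bdd_plus_section
  rwa [mul_one] at this

theorem proj_proj (x : Unitization ℂ A.alg) : proj q s (proj q s x) = proj q s x :=
  congrArg (FAlg.plus s) (h.plus_quot_plus_section _)

/-- The complementary projection `a ↦ a - s (q a)` of `A` onto `J`. -/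
noncomputable def toIdeal : A.alg →ₗ[ℂ] J.alg where
  toFun a := ⟨(a - s (q a) : A.alg), (h.ker _).1 (by rw [map_sub, h.apply_section, sub_self])⟩
  map_add' a b := Subtype.ext <| by
    simp only [map_add, NonUnitalSubalgebra.coe_add, NonUnitalSubalgebra.coe_sub]
    abel
  map_smul' c a := Subtype.ext <| by
    simp only [map_smul, NonUnitalSubalgebra.coe_smul, NonUnitalSubalgebra.coe_sub, smul_sub,
      RingHom.id_apply]

/-- The linear map `id - s⁺ ∘ q⁺` with values in `J⁺`. -/
noncomputable def compl : Unitization ℂ A.alg →ₗ[ℂ] Unitization ℂ J.alg :=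
  (Unitization.inrHom ℂ ℂ J.alg) ∘ₗ toIdeal h ∘ₗ (Unitization.sndHom ℂ ℂ A.alg)

theorem compl_apply (x : Unitization ℂ A.alg) : h.compl x = Unitization.inr (h.toIdeal x.snd) :=
  rfl

theorem plus_incl_compl (x : Unitization ℂ A.alg) :
    FAlg.plus h.incl (h.compl x) = x - proj q s x := by
  refine Unitization.ext ?_ ?_
  · rw [FAlg.plus_fst, compl_apply, Unitization.fst_inr]
    change 0 = x.fst - (FAlg.plus s (FAlg.plus q x)).fst
    rw [FAlg.plus_fst, FAlg.plus_fst, sub_self]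
  · rw [FAlg.plus_snd, compl_apply, Unitization.snd_inr]
    change _ = x.snd - (FAlg.plus s (FAlg.plus q x)).snd
    rw [FAlg.plus_snd, FAlg.plus_snd]
    rfl

theorem retr : QAlg.Retr A.toFAlg.toQ J.toFAlg.toQ (proj q s) h.compl :=
  ⟨h.bdd_proj, h.proj_proj, _, h.emb_plus_incl, h.plus_incl_compl⟩

/-- The same idempotent `σ`, with the difference `id - σ` regarded as having values in `A⁺`. Here
the retraction can be computed outright as `x - σ_* x`. -/
theorem retr_self :
    QAlg.Retr A.toFAlg.toQ A.toFAlg.toQ (proj q s) (LinearMap.id - (proj q s).toLinearMap) :=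
  ⟨h.bdd_proj, h.proj_proj, AlgHom.id ℂ _, QAlg.emb_id _, fun _ => rfl⟩

-- The split extension of `ℂ` by an algebra, given by its unitization, viewed as an instance of the
-- same construction. It identifies the retraction on the image of `K_i(J)`.
omit h in
theorem retr_augEnd (X : FilteredSQpAlgebra p E) :
    QAlg.Retr X.toFAlg.toQ X.toFAlg.toQ (FAlg.augEnd X.alg)
      (LinearMap.id - (FAlg.augEnd X.alg).toLinearMap) :=
  ⟨X.toFAlg.bdd_augEnd.mono (by norm_num), fun _ => rfl, AlgHom.id ℂ _, QAlg.emb_id _, fun _ => rfl⟩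

/-- Since `q` vanishes on `J`, the endomorphism `s⁺ ∘ q⁺` restricts on `J⁺` to the augmentation. -/
theorem compl_plus_incl (y : Unitization ℂ J.alg) :
    h.compl (FAlg.plus h.incl y) = y - FAlg.augEnd J.alg y := by
  rw [compl_apply, FAlg.plus_snd]
  refine Unitization.ext ?_ ?_
  · change 0 = y.fst - y.fst
    rw [sub_self]
  · refine Subtype.ext ?_
    change ((h.incl y.snd : A.alg) : E →L[ℂ] E) - (s (q (h.incl y.snd)) : A.alg) = y.snd - 0
    rw [h.apply_incl, map_zero, h.coe_incl]
    rfl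

theorem proj_plus_incl (y : Unitization ℂ J.alg) :
    proj q s (FAlg.plus h.incl y) = FAlg.plus h.incl (FAlg.augEnd J.alg y) := by
  change FAlg.plus s (FAlg.plus q (FAlg.plus h.incl y)) = _
  refine Unitization.ext ?_ ?_
  · rw [FAlg.plus_fst, FAlg.plus_fst, FAlg.plus_fst, FAlg.plus_fst]
    rfl
  · rw [FAlg.plus_snd, FAlg.plus_snd, FAlg.plus_snd, FAlg.plus_snd, h.apply_incl, map_zero]
    exact (map_zero h.incl).symm

end IsSplitExtension

end concrete
end QK

/-! ### Control pairs for the split exact sequence -/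

namespace QK

open scoped ENNReal

universe u v

/-- The control pair `(10¹⁰ N⁶, 10)` of the retraction `𝒦_i(A) → 𝒦_i(J)`. -/
noncomputable def ControlPair.ret : ControlPair where
  lam N := 10 ^ 10 * N ^ 6
  h _ _ := 10
  one_le_lam N hN := one_le_mul_of_one_le_of_one_le (by norm_num) (one_le_pow₀ hN)
  lam_mono N N' hN h := by
    have := pow_le_pow_left₀ (zero_le_one.trans hN) h 6
    linarith
  one_le_h _ _ _ _ := by norm_num
  h_anti _ _ _ _ _ _ := le_rfl

/-- The control pair `(10²¹ N¹², 10)`. -/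
noncomputable def ControlPair.split : ControlPair where
  lam N := 10 ^ 21 * N ^ 12
  h _ _ := 10
  one_le_lam N hN := one_le_mul_of_one_le_of_one_le (by norm_num) (one_le_pow₀ hN)
  lam_mono N N' hN h := by
    have := pow_le_pow_left₀ (zero_le_one.trans hN) h 12
    linarith
  one_le_h _ _ _ _ := by norm_num
  h_anti _ _ _ _ _ _ := le_rfl

namespace ControlPair

theorem scal_le_split {C : ℝ} (hC : 1 ≤ C) (hC3 : C ≤ 3) : scal C hC ≤ split := by
  intro ε N _ _ hN
  refine ⟨?_, (by norm_num : (1 : ℝ) ≤ 10)⟩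
  change C * N ≤ 10 ^ 21 * N ^ 12
  have h1 := le_self_pow₀ hN (by norm_num : 12 ≠ 0)
  have h2 := mul_le_mul_of_nonneg_right hC3 (zero_le_one.trans hN)
  linarith

theorem ret_le_split : ret ≤ split := by
  intro ε N _ _ hN
  refine ⟨?_, le_rfl⟩
  change 10 ^ 10 * N ^ 6 ≤ 10 ^ 21 * N ^ 12
  have h1 := pow_le_pow_right₀ hN (by norm_num : 6 ≤ 12)
  have h2 := pow_nonneg (zero_le_one.trans hN) 12
  linarith

theorem ret_scal_le {C : ℝ} (hC : 1 ≤ C) (hC3 : C ≤ 3) {N : ℝ} (hN : 1 ≤ N) :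
    10 ^ 10 * (C * N) ^ 6 * (C * N) ≤ 10 ^ 21 * N ^ 12 := by
  have h0 := zero_le_one.trans hN
  have h1 := pow_le_pow_right₀ hN (by norm_num : 7 ≤ 12)
  have h2 := pow_le_pow_left₀ (zero_le_one.trans hC) hC3 7
  have h3 := mul_le_mul h2 h1 (pow_nonneg h0 7) (by norm_num)
  have h4 : 10 ^ 10 * (C * N) ^ 6 * (C * N) = 10 ^ 10 * (C ^ 7 * N ^ 7) := by ring
  have h5 := pow_nonneg h0 12
  rw [h4]
  linarith

/-- The composite has `λ_N = 10¹⁰(CN)⁶ · CN`, with `C⁷ ≤ 3⁷`. -/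
theorem ret_comp_scal_le {C : ℝ} (hC : 1 ≤ C) (hC3 : C ≤ 3) : ret.comp (scal C hC) ≤ split := by
  intro ε N _ _ hN
  refine ⟨ret_scal_le hC hC3 hN, le_of_eq ?_⟩
  change (10 : ℝ) * 1 = 10
  norm_num

/-- The pair of a composite multiplies the two values of `λ`, so `λ` of the retraction enters twice:
`3 · 10²⁰N¹² ≤ 10²¹N¹²`. This composite dictates the shape of `split`. -/
theorem scal_comp_ret_le {C : ℝ} (hC : 1 ≤ C) (hC3 : C ≤ 3) : (scal C hC).comp ret ≤ split := by
  intro ε N _ _ hN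
  refine ⟨?_, le_of_eq (one_mul _)⟩
  change C * (10 ^ 10 * N ^ 6) * (10 ^ 10 * N ^ 6) ≤ 10 ^ 21 * N ^ 12
  have h1 := mul_le_mul_of_nonneg_right hC3 (pow_nonneg (zero_le_one.trans hN) 12)
  have h2 := pow_nonneg (zero_le_one.trans hN) 12
  have h3 : C * (10 ^ 10 * N ^ 6) * (10 ^ 10 * N ^ 6) = 10 ^ 20 * (C * N ^ 12) := by ring
  rw [h3]
  linarith

theorem far_ret {P : Param} (hP : ret.Adm P) : QAlg.Far P (ret.act P hP) :=
  ⟨le_refl (10 ^ 10 * P.N ^ 6 * P.ε), le_refl (10 * P.r), le_refl (10 ^ 10 * P.N ^ 6)⟩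

theorem far_split {P : Param} (hP : split.Adm P) : QAlg.Far P (split.act P hP) :=
  (far_ret (adm_of_le ret_le_split hP)).trans_le (act_le_of_le ret_le_split hP)

/-- There is room in `split` to apply `j_*`, `s_*` or `q_*` first and the retraction afterwards. -/
theorem far_scal_split {C : ℝ} {hC : 1 ≤ C} (hC3 : C ≤ 3) {P : Param} (hP : split.Adm P)
    (hP' : (scal C hC).Adm P) : QAlg.Far ((scal C hC).act P hP') (split.act P hP) := by
  have hle := ret_comp_scal_le hC hC3
  exact (far_ret (adm_act_of_comp (adm_of_le hle hP))).trans_le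
    ((act_act_le (adm_of_le hle hP)).trans (act_le_of_le hle hP))

theorem le_scal_act {C : ℝ} {hC : 1 ≤ C} {P : Param} (hP : (scal C hC).Adm P) :
    P ≤ (scal C hC).act P hP := (FAlg.scaled_act hC hP).le hC

/-- Composition with the pair `(1, 1)` of a zero morphism leaves the degree unchanged up to
multiplication by `1`, which is not a definitional equality over the reals. -/
theorem act_le_one_comp {c : ControlPair} {P : Param} (hP : (one.comp c).Adm P) :
    c.act P (adm_of_comp hP) ≤ (one.comp c).act P hP := by
  refine ⟨?_, ?_, (one_mul _).ge⟩
  · change c.lam P.N * P.ε ≤ 1 * c.lam P.N * P.ε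
    rw [one_mul]
  · change c.h P.ε P.N * P.r ≤ 1 * c.h P.ε P.N * P.r
    rw [one_mul]

end ControlPair

/-! ### Split exactness in controlled K-theory -/

namespace IsSplitExtension

variable {p : ℝ≥0∞} [Fact (1 ≤ p)] [Fact (p ≠ ⊤)]
variable {E : Type u} [NormedAddCommGroup E] [NormedSpace ℂ E] [CompleteSpace E]
variable {B : Type v} [NonUnitalRing B] [Module ℂ B] [IsScalarTower ℂ B B] [SMulCommClass ℂ B B]
variable {J A : FilteredSQpAlgebra p E} {q : A.alg →ₙₐ[ℂ] B} {s : B →ₙₐ[ℂ] A.alg}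
  (h : IsSplitExtension J A q s) {P Q Q' S : Param}

/-- The matrices produced by the retraction are a constant part plus entries from `J`, so the
augmentation sees only the constant part, whose class is cancelled. -/
theorem ret_mem_K (hPQ : QAlg.Far P Q) (i : Fin 2) (x : A.toFAlg.toQ.KU i P) :
    h.retr.ret hPQ i x ∈ J.toFAlg.K i Q :=
  h.retr.kuMap_ret_eq_zero (φ := Unitization.fstHom ℂ J.alg) (fun _ => rfl) J.toFAlg.aug hPQ
    (scaled_one le_rfl) i x

/-- The retraction `K_i(A) → K_i(J)`. -/
noncomputable def kRet (hPQ : QAlg.Far P Q) (i : Fin 2) : A.toFAlg.K i P →+ J.toFAlg.K i Q :=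
  ((h.retr.ret hPQ i).comp (A.toFAlg.K i P).subtype).codRestrict _ fun x => h.ret_mem_K hPQ i x.1

theorem relax_kRet (hPQ : QAlg.Far P Q) (hQS : Q ≤ S) (hPS : QAlg.Far P S) (i : Fin 2)
    (x : A.toFAlg.K i P) : (J.toFAlg.fam i).relax hQS (h.kRet hPQ i x) = h.kRet hPS i x :=
  Subtype.ext (h.retr.kuMap_ret h.retr (φ := AlgHom.id ℂ _) (fun _ => rfl) _ hPQ _ hPS i x.1)

theorem kRet_relax (hPQ : P ≤ Q) (hQS : QAlg.Far Q S) (hPS : QAlg.Far P S) (i : Fin 2)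
    (x : A.toFAlg.K i P) : h.kRet hQS i ((A.toFAlg.fam i).relax hPQ x) = h.kRet hPS i x :=
  Subtype.ext (h.retr.ret_kuMap h.retr (ψ := AlgHom.id ℂ _) (fun _ => rfl) (fun _ => rfl) _ _ hQS
    hPS i x.1)

/-- Along `j⁺` the retraction becomes that of the augmentation on `J⁺`, i.e. `x` minus its image
under the augmentation, and the latter is zero on `K_i(J)` by definition of the kernel. -/
theorem kRet_incl {c : ℝ} (hj : QAlg.Bdd J.toFAlg.toQ A.toFAlg.toQ (FAlg.plus h.incl) c)
    (hPQ : QAlg.Scaled c P Q) (hQS : QAlg.Far Q S) (hPS : P ≤ S) (i : Fin 2) (x : J.toFAlg.K i P) :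
    h.kRet hQS i (FAlg.kMap (FAlg.plus_fst _) hj hPQ i x) = (J.toFAlg.fam i).relax hPS x := by
  have hfar : QAlg.Far P S := hQS.of_le (hPQ.le hj.one_le)
  refine Subtype.ext ?_
  refine (h.retr.ret_kuMap (retr_augEnd J) h.proj_plus_incl h.compl_plus_incl hj hPQ hQS hfar i
    x.1).trans ?_
  have e := (retr_augEnd J).ret_add_kuMap (fun _ => rfl) hfar (scaled_one hPS) i x.1
  rwa [FAlg.kuMap_eq_zero_of_fst (fun _ => Unitization.inl_zero _) _ _ x.2, add_zero] at e

/-- The endomorphism `s⁺ ∘ q⁺` fixes the range of `s⁺`, so the difference `id - σ` vanishes there.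
-/
theorem kRet_section {c : ℝ} (hs : QAlg.Bdd h.quotient.toQ A.toFAlg.toQ (FAlg.plus s) c)
    (hPQ : QAlg.Scaled c P Q) (hQS : QAlg.Far Q S) (i : Fin 2) (x : h.quotient.K i P) :
    h.kRet hQS i (FAlg.kMap (FAlg.plus_fst _) hs hPQ i x) = 0 :=
  Subtype.ext (h.retr.ret_kuMap_eq_zero
    (fun y => congrArg (FAlg.plus s) (h.plus_quot_plus_section y)) hs hPQ hQS i x.1)

/-- The identity `x = (x - σ_* x) + σ_* x` with the two summands factored through `J` and `A/J`. The
bounds `cj`, `cq`, `cs` and the intermediate degrees are left free because the exactness and the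
isomorphism statements use different ones. -/
theorem incl_kRet_add {cj cq cs : ℝ}
    (hj : QAlg.Bdd J.toFAlg.toQ A.toFAlg.toQ (FAlg.plus h.incl) cj)
    (hq : QAlg.Bdd A.toFAlg.toQ h.quotient.toQ (FAlg.plus q) cq)
    (hs : QAlg.Bdd h.quotient.toQ A.toFAlg.toQ (FAlg.plus s) cs)
    (hPQ : QAlg.Far P Q) (hQS : QAlg.Scaled cj Q S) (hPQ' : QAlg.Scaled cq P Q')
    (hQS' : QAlg.Scaled cs Q' S) (hPS : P ≤ S) (i : Fin 2) (x : A.toFAlg.K i P) :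
    FAlg.kMap (FAlg.plus_fst _) hj hQS i (h.kRet hPQ i x) +
      FAlg.kMap (FAlg.plus_fst _) hs hQS' i (FAlg.kMap (FAlg.plus_fst _) hq hPQ' i x) =
      (A.toFAlg.fam i).relax hPS x := by
  have hfar : QAlg.Far P S := hPQ.trans_le (hQS.le hj.one_le)
  refine Subtype.ext ?_
  have e1 := h.retr.kuMap_ret h.retr_self h.plus_incl_compl hj hPQ hQS hfar i x.1
  have e2 := QAlg.kuMap_comp (χ := proj q s) (fun _ => rfl) hq hs h.bdd_proj hPQ' hQS' hfar.scaled
    i x.1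
  refine (congrArg₂ (· + ·) e1 e2).trans ?_
  exact h.retr_self.ret_add_kuMap (fun _ => rfl) hfar (scaled_one hPS) i x.1

theorem quot_incl {cj cq : ℝ}
    (hj : QAlg.Bdd J.toFAlg.toQ A.toFAlg.toQ (FAlg.plus h.incl) cj)
    (hq : QAlg.Bdd A.toFAlg.toQ h.quotient.toQ (FAlg.plus q) cq)
    (hPQ : QAlg.Scaled cj P Q) (hQS : QAlg.Scaled cq Q S) (i : Fin 2) (x : J.toFAlg.K i P) :
    FAlg.kMap (FAlg.plus_fst _) hq hQS i (FAlg.kMap (FAlg.plus_fst _) hj hPQ i x) = 0 := by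
  refine Subtype.ext ?_
  have hPS : QAlg.Scaled (cq * cj) P S := by
    have h0 := zero_le_one.trans hq.one_le
    refine ⟨?_, hPQ.r_le.trans hQS.r_le, ?_⟩
    · rw [mul_assoc]
      exact (mul_le_mul_of_nonneg_left hPQ.ε_le h0).trans hQS.ε_le
    · rw [mul_assoc]
      exact (mul_le_mul_of_nonneg_left hPQ.N_le h0).trans hQS.N_le
  refine (QAlg.kuMap_comp (χ := (FAlg.plus q).comp (FAlg.plus h.incl)) (fun _ => rfl) hj hq
    (hj.comp hq) hPQ hQS hPS i x.1).trans ?_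
  refine FAlg.kuMap_eq_zero_of_fst (fun a => ?_) _ _ x.2
  refine Unitization.ext ?_ ?_
  · rw [AlgHom.comp_apply, FAlg.plus_fst, FAlg.plus_fst]
    rfl
  · rw [AlgHom.comp_apply, FAlg.plus_snd, FAlg.plus_snd]
    exact h.apply_incl a

theorem quot_section {cq cs : ℝ}
    (hq : QAlg.Bdd A.toFAlg.toQ h.quotient.toQ (FAlg.plus q) cq)
    (hs : QAlg.Bdd h.quotient.toQ A.toFAlg.toQ (FAlg.plus s) cs)
    (hPQ : QAlg.Scaled cs P Q) (hQS : QAlg.Scaled cq Q S) (hPS : P ≤ S) (i : Fin 2)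
    (x : h.quotient.K i P) :
    FAlg.kMap (FAlg.plus_fst _) hq hQS i (FAlg.kMap (FAlg.plus_fst _) hs hPQ i x) =
      (h.quotient.fam i).relax hPS x :=
  Subtype.ext (QAlg.kuMap_comp (χ := AlgHom.id ℂ _)
    (fun y => (h.plus_quot_plus_section y).symm) hs hq _ hPQ hQS (scaled_one hPS) i x.1)

/-- The controlled morphism `𝒦_i(A) → 𝒦_i(J) ⊕ 𝒦_i(A/J)` inverse to `(x, y) ↦ j_*(x) + s_*(y)`. -/
noncomputable def decompose (i : Fin 2) :
    CMor ControlPair.ret (A.toFAlg.fam i) ((J.toFAlg.fam i).prod (h.quotient.fam i)) where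
  map P hP := (h.kRet (ControlPair.far_ret hP) i).prod
    (FAlg.kMap (FAlg.plus_fst _) (A.toFAlg.bdd_plus_quot q h.surj)
      (scaled_one (ControlPair.far_ret hP).le) i)
  comm P Q hP hQ hPQ hr x := by
    have hfar : QAlg.Far P (ControlPair.ret.act Q hQ) := (ControlPair.far_ret hQ).of_le hPQ
    refine Prod.ext ?_ ?_
    · exact (h.relax_kRet _ (ControlPair.ret.act_le_act hP hQ hPQ hr) hfar i x).trans
        (h.kRet_relax _ _ hfar i x).symm
    · refine Subtype.ext ?_
      exact (QAlg.kuMap_comp (χ := FAlg.plus q) (fun _ => rfl) _ _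
        (A.toFAlg.bdd_plus_quot q h.surj) _ _ (scaled_one hfar.le) i x.1).trans
        (QAlg.kuMap_comp (χ := FAlg.plus q) (fun _ => rfl) _ _ _ _ _ _ i x.1).symm

/-- The retraction is a left inverse of `j_*` up to relaxation: a class killed by `j_*` vanishes
after applying it. -/
theorem exact_incl (i : Fin 2) : CMor.Exact ControlPair.split
    (CMor.zeroMor QFam.zero (J.toFAlg.fam i)) (h.filteredHom_incl.kHom i) := by
  refine ⟨fun P hP x => map_zero _, fun P h₁ h₂ y hy => ⟨(), ?_⟩⟩
  have hfar := (ControlPair.far_scal_split h.plusNorm_incl_le (ControlPair.adm_of_comp h₁)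
    h₂).trans_le (ControlPair.act_le_one_comp h₁)
  have hle : P ≤ (ControlPair.one.comp ControlPair.split).act P h₁ :=
    (ControlPair.le_scal_act h₂).trans hfar.le
  refine ⟨hle, (map_zero _).trans ?_⟩
  refine Eq.trans ?_ (h.kRet_incl h.filteredHom_incl.bdd (FAlg.scaled_act _ h₂) hfar hle i y)
  exact ((congrArg (h.kRet hfar i) hy).trans (map_zero _)).symm

/-- The preimage of `y` is its retraction: when `q_* y = 0`, the summand `s_* q_* y` in
`incl_kRet_add` disappears. -/
theorem exact_middle (i : Fin 2) : CMor.Exact ControlPair.split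
    (h.filteredHom_incl.kHom i) (h.filteredHom_quot.kHom i) := by
  refine ⟨fun P hP x => h.quot_incl h.filteredHom_incl.bdd h.filteredHom_quot.bdd
    (FAlg.scaled_act _ (ControlPair.adm_of_comp hP))
    (FAlg.scaled_act _ (ControlPair.adm_act_of_comp hP)) i x, fun P h₁ h₂ y hy => ?_⟩
  have hc := ControlPair.adm_of_comp h₁
  have hfar := ControlPair.far_split hc
  have hS := ControlPair.le_scal_act (ControlPair.adm_act_of_comp h₁)
  have hle := (hfar.le.trans hS).trans (ControlPair.act_act_le h₁)
  refine ⟨h.kRet hfar i y, hle, ?_⟩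
  -- The vanishing class `q_* y` lives in the degree prescribed by the control pair of `q_*`. The
  -- section, with bound `3`, must carry it from there to the degree reached by `j_*`.
  have hfar' := (ControlPair.far_scal_split (h.plusNorm_quot_le.trans (by norm_num)) hc
    h₂).trans_le hS
  have e := h.incl_kRet_add h.filteredHom_incl.bdd h.filteredHom_quot.bdd h.bdd_plus_section hfar
    (FAlg.scaled_act _ (ControlPair.adm_act_of_comp h₁)) (FAlg.scaled_act _ h₂) hfar'.scaled
    (hfar.le.trans hS) i y
  have hy' : FAlg.kMap (FAlg.plus_fst _) h.filteredHom_quot.bdd (FAlg.scaled_act _ h₂) i y = 0 := hy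
  have hz := congrArg (FAlg.kMap (FAlg.plus_fst _) h.bdd_plus_section hfar'.scaled i) hy'
  have e' := ((add_zero _).symm.trans (congrArg (_ + ·) (hz.trans (map_zero _)).symm)).trans e
  clear hz hy' e
  refine (congrArg ((A.toFAlg.fam i).relax (ControlPair.act_act_le h₁)) e').trans ?_
  exact (A.toFAlg.fam i).relax_trans _ _ hle y

/-- Surjectivity of `q_*` up to control: `s_* y` is a preimage, with no condition on `y`. -/
theorem exact_quot (i : Fin 2) : CMor.Exact ControlPair.split
    (h.filteredHom_quot.kHom i) (CMor.zeroMor (h.quotient.fam i) QFam.zero) := by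
  refine ⟨fun P hP x => rfl, fun P h₁ h₂ y _ => ?_⟩
  have hfar := ControlPair.far_split (ControlPair.adm_of_comp h₁)
  have hS := ControlPair.le_scal_act (ControlPair.adm_act_of_comp h₁)
  have hle := (hfar.le.trans hS).trans (ControlPair.act_act_le h₁)
  refine ⟨FAlg.kMap (FAlg.plus_fst _) h.bdd_plus_section hfar.scaled i y, hle, ?_⟩
  refine (congrArg ((h.quotient.fam i).relax (ControlPair.act_act_le h₁))
    (h.quot_section h.filteredHom_quot.bdd h.bdd_plus_section hfar.scaled
    (FAlg.scaled_act _ (ControlPair.adm_act_of_comp h₁)) (hfar.le.trans hS) i y)).trans ?_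
  exact (h.quotient.fam i).relax_trans _ _ hle y

theorem isIso_sumHom (i : Fin 2) : CMor.IsIso ControlPair.split
    (sumHom h.filteredHom_incl h.filteredHom_section i) := by
  have hC3 := max_le h.plusNorm_incl_le h.plusNorm_section_le
  have hC1 := h.filteredHom_incl.bdd.one_le.trans (le_max_left _ h.filteredHom_section.plusNorm)
  refine ⟨ControlPair.scal_le_split hC1 hC3, ControlPair.ret, h.decompose i, ?_, ?_⟩
  · refine ⟨ControlPair.ret_comp_scal_le hC1 hC3, ControlPair.scal_le_split le_rfl (by norm_num),
      fun P hP x => ?_⟩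
    have hP' := ControlPair.adm_of_le (ControlPair.ret_comp_scal_le hC1 hC3) hP
    have hA := ControlPair.adm_of_comp hP'
    have hle := ControlPair.le_scal_act hA
    have hfar := ControlPair.far_ret (ControlPair.adm_act_of_comp hP')
    have hj := h.filteredHom_incl.bdd.mono (le_max_left _ h.filteredHom_section.plusNorm)
    have hs := h.filteredHom_section.bdd.mono (le_max_right h.filteredHom_incl.plusNorm _)
    have hq := A.toFAlg.bdd_plus_quot q h.surj
    -- The composite with `decompose` is a two by two matrix of maps: the diagonal entries `e1` and
    -- `e4` are relaxations, the off-diagonal entries `e2` and `e3` are zero.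
    have e1 := h.kRet_incl hj (FAlg.scaled_act hC1 hA) hfar (hle.trans hfar.le) i x.1
    have e2 := h.kRet_section hs (FAlg.scaled_act hC1 hA) hfar i x.2
    have e3 := h.quot_incl hj hq (FAlg.scaled_act hC1 hA) (scaled_one hfar.le) i x.1
    have e4 := h.quot_section hq hs (FAlg.scaled_act hC1 hA) (scaled_one hfar.le)
      (hle.trans hfar.le) i x.2
    have e : (h.decompose i).map _ (ControlPair.adm_act_of_comp hP')
        ((sumHom h.filteredHom_incl h.filteredHom_section i).map P hA x) =
        ((J.toFAlg.fam i).prod (h.quotient.fam i)).relax (hle.trans hfar.le) x := by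
      refine Prod.ext ?_ ?_
      · refine (map_add (h.kRet hfar i) _ _).trans ?_
        exact (congrArg₂ (· + ·) e1 e2).trans (add_zero _)
      · refine (map_add (FAlg.kMap (FAlg.plus_fst _) hq (scaled_one hfar.le) i) _ _).trans ?_
        exact (congrArg₂ (· + ·) e3 e4).trans (zero_add _)
    -- What remains is to collapse the successive relaxation maps to a single one, on either side.
    refine Eq.trans (congrArg (((J.toFAlg.fam i).prod (h.quotient.fam i)).relax (ControlPair.act_le_of_le
      (ControlPair.ret_comp_scal_le hC1 hC3) hP))
      (congrArg (((J.toFAlg.fam i).prod (h.quotient.fam i)).relax (ControlPair.act_act_le hP')) e)) ?_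
    refine Eq.trans (congrArg (((J.toFAlg.fam i).prod (h.quotient.fam i)).relax (ControlPair.act_le_of_le
      (ControlPair.ret_comp_scal_le hC1 hC3) hP)) (QFam.relax_trans _ _ _
      ((hle.trans hfar.le).trans (ControlPair.act_act_le hP')) x)) ?_
    refine (QFam.relax_trans _ _ _ (ControlPair.far_split hP).le x).trans ?_
    exact (QFam.relax_trans _ (CMor.id_le P _) _ (ControlPair.far_split hP).le x).symm
  · refine ⟨ControlPair.scal_comp_ret_le hC1 hC3, ControlPair.scal_le_split le_rfl (by norm_num),
      fun P hP x => ?_⟩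
    have hP' := ControlPair.adm_of_le (ControlPair.scal_comp_ret_le hC1 hC3) hP
    have hfar := ControlPair.far_ret (ControlPair.adm_of_comp hP')
    have hA := ControlPair.adm_act_of_comp hP'
    have hle := ControlPair.le_scal_act hA
    -- In the other order the composite is `j_* ∘ ret + s_* ∘ q_*`, which is relaxation by the
    -- decomposition formula.
    have e := h.incl_kRet_add
      (h.filteredHom_incl.bdd.mono (le_max_left _ h.filteredHom_section.plusNorm))
      (A.toFAlg.bdd_plus_quot q h.surj)
      (h.filteredHom_section.bdd.mono (le_max_right h.filteredHom_incl.plusNorm _)) hfar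
      (FAlg.scaled_act hC1 hA) (scaled_one hfar.le) (FAlg.scaled_act hC1 hA)
      (hfar.le.trans hle) i x
    refine Eq.trans (congrArg ((A.toFAlg.fam i).relax (ControlPair.act_le_of_le
      (ControlPair.scal_comp_ret_le hC1 hC3) hP))
      (congrArg ((A.toFAlg.fam i).relax (ControlPair.act_act_le hP')) e)) ?_
    refine Eq.trans (congrArg ((A.toFAlg.fam i).relax (ControlPair.act_le_of_le
      (ControlPair.scal_comp_ret_le hC1 hC3) hP)) (QFam.relax_trans _ _ _
      ((hfar.le.trans hle).trans (ControlPair.act_act_le hP')) x)) ?_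
    refine (QFam.relax_trans _ _ _ (ControlPair.far_split hP).le x).trans ?_
    exact (QFam.relax_trans _ (CMor.id_le P _) _ (ControlPair.far_split hP).le x).symm

end IsSplitExtension
end QK
theorem mainTheorem5 :
    ∃ c : QK.ControlPair, ∀ (p : ENNReal) [Fact (1 ≤ p)] [Fact (p ≠ ⊤)]
      (E : Type*) [NormedAddCommGroup E] [NormedSpace ℂ E] [CompleteSpace E]
      (J A : QK.FilteredSQpAlgebra p E)
      (B : Type*) [NonUnitalRing B] [Module ℂ B] [IsScalarTower ℂ B B] [SMulCommClass ℂ B B]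
      (q : A.alg →ₙₐ[ℂ] B) (s : B →ₙₐ[ℂ] A.alg) (h : QK.IsSplitExtension J A q s) (i : Fin 2),
      QK.CMor.Exact c (QK.CMor.zeroMor QK.QFam.zero (J.toFAlg.fam i))
        (h.filteredHom_incl.kHom i) ∧
      QK.CMor.Exact c (h.filteredHom_incl.kHom i) (h.filteredHom_quot.kHom i) ∧
      QK.CMor.Exact c (h.filteredHom_quot.kHom i)
        (QK.CMor.zeroMor (h.quotient.fam i) QK.QFam.zero) ∧
      QK.CMor.IsIso c (QK.sumHom h.filteredHom_incl h.filteredHom_section i) :=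
  ⟨QK.ControlPair.split, fun _ _ _ _ _ _ _ _ _ _ _ _ _ _ _ _ h i =>
    ⟨h.exact_incl i, h.exact_middle i, h.exact_quot i, h.isIso_sumHom i⟩⟩
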